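/- For $r\in I:=[1-1/\sqrt3,\,1/2]$ let $$\mathcal A(r):=\min\{|\Omega| : \Omega\subset\mathbb R^2 \text{ a convex body of constant width } 1 \text{ with inradius } r\},$$ where a convex body is a compact convex set with nonempty interior. A Reuleaux $(2N+1)$-gon ($N\ge 1$) is a convex body of constant width $1$ whose boundary is the union of $2N+1$ arcs (its sides) of unit circles centred at distinct points (its vertices) $P_k$, $k\in\mathbb Z/(2N+1)$, the side centred at $P_k$, called opposite to $P_k$, having the endpoints $P_{k+1}$ and $P_{k-1}$; it is regular if all its sides have the same length. Put $r_{m}:=1-\dfrac{1}{2\cos(\pi/(2m))}$ for odd $m\ge3$, the inradius of the regular Reuleaux $m$-gon. For $r\in I$, let $\Omega(r)$ be a set of the following form: * if $r=r_{2N+1}$ with $N\ge1$, a regular Reuleaux $(2N+1)$-gon; * if $r_{2N-1}<r<r_{2N+1}$ with $N\ge2$, then, with $$\ell:=2\arctan\sqrt{4(1-r)^2-1},\quad h:=\tfrac{\pi}{2}-\tfrac{2N-1}{2}\,\ell,\quad a:=2\arcsin((1-r)\sin h),\quad b:=h+\tfrac{\ell-a}{2},$$ a Reuleaux $(2N+1)$-gon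 of inradius $r$, contained in the closed disk bounded by the outercircle (the circle of radius $1-r$ concentric with the incircle), such that all sides but one are tangent to the incircle; the non-tangent side has both endpoints on the outercircle and length $a$; the two sides opposite to these endpoints have length $b$, meet at a point of the open annulus between incircle and outercircle, and have their other endpoint on the outercircle; the remaining $2N-2$ sides have both endpoints on the outercircle and length $\ell$; * if $r=1/2$, a closed disk of radius $1/2$. Then the minimum $\mathcal A(r)$ exists for every $r\in I$ and $r\mapsto\mathcal A(r)$ is continuous on $I$. Moreover, such a set $\Omega(r)$ exists for every $r\in I$, and, for every choice of these sets, $r\mapsto\Omega(r)$ is continuous up to rigid motion with respect to the Hausdorff distance $d_{\mathcal H}$: there are isometries $T_r$ of the plane, $r\in I$, such that for every $\varepsilon>0$ there is $\delta>0$ with $$r_1,r_2\in I,\ |r_1-r_2|<\delta\ \Longrightarrow\ d_{\mathcal H}\big(T_{r_1}(\Omega(r_1)),T_{r_2}(\Omega(r_2))\big)<\varepsilon .$$ -/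

import Mathlib

open MeasureTheory Metric

namespace ConstWidth

/-! The Euclidean plane is `ℂ` (Euclidean norm, Lebesgue measure as `volume`), so that the unit
vector `(cos t, sin t)` is `Complex.exp (t * Complex.I)`. -/

/-- A convex body: a compact convex set with nonempty interior. -/
def IsConvexBody (Ω : Set ℂ) : Prop :=
  IsCompact Ω ∧ Convex ℝ Ω ∧ (interior Ω).Nonempty

/-- The width in direction `ν` (a unit vector): the distance between the two supporting lines
orthogonal to `ν`. -/
noncomputable def width (Ω : Set ℂ) (ν : ℂ) : ℝ :=
  sSup ((fun x : ℂ => inner ℝ ν x) '' Ω) - sInf ((fun x : ℂ => inner ℝ ν x) '' Ω)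

/-- `Ω` has constant width `d`. -/
def HasConstantWidth (Ω : Set ℂ) (d : ℝ) : Prop :=
  ∀ ν : ℂ, ‖ν‖ = 1 → width Ω ν = d

/-- The inradius: the largest radius of an open disk contained in `Ω`. -/
noncomputable def inradius (Ω : Set ℂ) : ℝ :=
  sSup {ρ : ℝ | 0 ≤ ρ ∧ ∃ c : ℂ, ball c ρ ⊆ Ω}

/-- The plane convex bodies of constant width `1` and inradius `r`. -/
def admissible (r : ℝ) : Set (Set ℂ) :=
  {Ω | IsConvexBody Ω ∧ HasConstantWidth Ω 1 ∧ inradius Ω = r}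

/-- The least area of a convex body of constant width `1` and inradius `r`. -/
noncomputable def minArea (r : ℝ) : ℝ :=
  sInf ((fun Ω : Set ℂ => volume.real Ω) '' admissible r)

/-- The arc of the unit circle centred at `p` between the angles `s` and `t`. -/
def arc (p : ℂ) (s t : ℝ) : Set ℂ :=
  (fun θ : ℝ => p + Complex.exp (θ * Complex.I)) '' Set.Icc s t

/-- `Ω` is a Reuleaux polygon of width `1` with `2 * N + 1` sides: its boundary consists of the
arcs `arc (P k) (α k) (β k)` of length `β k - α k`; the centres `P k` are the distinct vertices,
and the side opposite to `P k` has the endpoints `P (k + 1)` (angle `α k`) and `P (k - 1)`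
(angle `β k`), the indices being taken modulo `2 * N + 1`. -/
structure IsReuleauxPolygon (N : ℕ) (Ω : Set ℂ) (P : ZMod (2 * N + 1) → ℂ)
    (α β : ZMod (2 * N + 1) → ℝ) : Prop where
  convexBody : IsConvexBody Ω
  constantWidth : HasConstantWidth Ω 1
  vertices_distinct : Function.Injective P
  angle_lt : ∀ k, α k < β k
  angle_lt_add : ∀ k, β k < α k + 2 * Real.pi
  next_vertex : ∀ k, P (k + 1) = P k + Complex.exp (α k * Complex.I)
  prev_vertex : ∀ k, P (k - 1) = P k + Complex.exp (β k * Complex.I)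
  frontier_eq : frontier Ω = ⋃ k, arc (P k) (α k) (β k)

/-- `Ω` is a regular Reuleaux polygon of width `1` with `2 * N + 1` sides. -/
def IsRegularReuleauxPolygon (N : ℕ) (Ω : Set ℂ) : Prop :=
  ∃ (P : ZMod (2 * N + 1) → ℂ) (α β : ZMod (2 * N + 1) → ℝ),
    IsReuleauxPolygon N Ω P α β ∧ ∀ j k, β j - α j = β k - α k

/-- The inradius of the regular Reuleaux polygon of width `1` with `m` sides. -/
noncomputable def regularInradius (m : ℕ) : ℝ :=
  1 - 1 / (2 * Real.cos (Real.pi / (2 * m)))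

/-- The length `ℓ`. -/
noncomputable def sideL (r : ℝ) : ℝ :=
  2 * Real.arctan (Real.sqrt (4 * (1 - r) ^ 2 - 1))

/-- The parameter `h`. -/
noncomputable def paramH (N : ℕ) (r : ℝ) : ℝ :=
  Real.pi / 2 - (2 * (N : ℝ) - 1) / 2 * sideL r

/-- The length `a`. -/
noncomputable def sideA (N : ℕ) (r : ℝ) : ℝ :=
  2 * Real.arcsin ((1 - r) * Real.sin (paramH N r))

/-- The length `b`. -/
noncomputable def sideB (N : ℕ) (r : ℝ) : ℝ :=
  paramH N r + (sideL r - sideA N r) / 2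

/-- `Ω` is a Reuleaux polygon of width `1` and inradius `r` with `2 * N + 1` sides, all of them
extremal except the three that form one cluster. Here `O` is the centre of the incircle
`sphere O r` and of the outercircle `sphere O (1 - r)`, and `k` is the index of the only side not
tangent to the incircle; as the disk `ball O r` lies in `Ω`, a side is tangent to the incircle
exactly when it meets it. -/
def IsOneClusterPolygon (N : ℕ) (r : ℝ) (Ω : Set ℂ) : Prop :=
  ∃ (P : ZMod (2 * N + 1) → ℂ) (α β : ZMod (2 * N + 1) → ℝ) (O : ℂ) (k : ZMod (2 * N + 1)),
    IsReuleauxPolygon N Ω P α β ∧ inradius Ω = r ∧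
    ball O r ⊆ Ω ∧ Ω ⊆ closedBall O (1 - r) ∧
    -- all the sides but one are tangent to the incircle
    (∀ j, (arc (P j) (α j) (β j) ∩ sphere O r).Nonempty ↔ j ≠ k) ∧
    -- the non tangent side: both endpoints on the outercircle, length `a`
    P (k + 1) ∈ sphere O (1 - r) ∧ P (k - 1) ∈ sphere O (1 - r) ∧
    β k - α k = sideA N r ∧
    -- its two opposite sides meet at `P k`, in the interior of the annulus, have the other
    -- endpoint on the outercircle, and have length `b`
    P k ∈ ball O (1 - r) \ closedBall O r ∧
    P (k + 2) ∈ sphere O (1 - r) ∧ P (k - 2) ∈ sphere O (1 - r) ∧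
    β (k + 1) - α (k + 1) = sideB N r ∧ β (k - 1) - α (k - 1) = sideB N r ∧
    -- the other `2 * N - 2` sides: both endpoints on the outercircle, length `ℓ`
    ∀ j, j ≠ k → j ≠ k + 1 → j ≠ k - 1 →
      P (j + 1) ∈ sphere O (1 - r) ∧ P (j - 1) ∈ sphere O (1 - r) ∧ β j - α j = sideL r

/-- `Ω` is (a congruent copy of) the explicit shape `Ω(r)`: a regular Reuleaux polygon if `r` is
the inradius of one, the one-cluster polygon if `r` lies strictly between two consecutive such
values, and the disk of radius `1 / 2` if `r = 1 / 2`. -/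
def IsOmega (r : ℝ) (Ω : Set ℂ) : Prop :=
  (∃ N : ℕ, 1 ≤ N ∧ r = regularInradius (2 * N + 1) ∧ IsRegularReuleauxPolygon N Ω) ∨
  (∃ N : ℕ, 2 ≤ N ∧ regularInradius (2 * N - 1) < r ∧ r < regularInradius (2 * N + 1) ∧
    IsOneClusterPolygon N r Ω) ∨
  (r = 1 / 2 ∧ ∃ O : ℂ, Ω = closedBall O (1 / 2))

/-- The interval of the possible inradii. -/
noncomputable def inradii : Set ℝ := Set.Icc (1 - 1 / Real.sqrt 3) (1 / 2)

end ConstWidth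

/-! The minimum. For a body of constant width 1, a disk of positive radius `ρ` about `c` lies in the
body precisely when the body lies in the disk of radius `1 - ρ` about `c`; hence inradius plus
circumradius is 1 (`inradius_eq`). The bodies with circumcentre 0 and circumradius at most `1 / √3`
form a compact set for the Hausdorff distance (`isCompact_centred`), on which circumradius and area
are continuous. This yields minimizers and the lower semicontinuity of the least area.

Upper semicontinuity needs, for every inradius near `r`, a body of almost minimal area. Such bodies
are Minkowski combinations of a minimizer with a second body `K` of constant width 1: they again
have constant width 1, their area is close to the minimum, and by the intermediate value theorem
their circumradii fill an interval. With `K` a disk the circumradius decreases. To make it increase,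
write 0 as a convex combination of at most three contact points with the outercircle. The weights
and directions give a linear lower bound for the circumradius (`sum_inner_le_circR`); since the
circumradius is below `1 / √3`, one contact point can be pushed outwards without violating diameter
1 (`exists_moved_triple`), and `K` is a completion of the moved triple to constant width
(`exists_CW_superset`).

The shapes. A radius of curvature `ρ` with values in `[0, 1]`, `ρ (s + π) = 1 - ρ s` and a closing
condition produces a body of constant width 1; Reuleaux polygons are the case `ρ ∈ {0, 1}`, where
`ρ` switches at the break angles. The shape `Ω(r)` has in `[-π/2, π/2]` the breaks `j ℓ` for `|j| <
N` and the two breaks `±τ` with `τ = π/2 - a/2`. It is unique up to congruence, because the side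
lengths determine the polygon by a recursion for the angles (`IsReuleauxPolygon.exists_motion`); for
a regular polygon the common length is forced to be `π / (2N+1)` (`IsReuleauxPolygon.length_eq`).

Continuity. Boundary curves differ uniformly by at most the distance of their base points plus the
`L¹` distance of their profiles. Near each `r₀ < 1/2` the profiles converge almost everywhere, also
when `N` jumps, because away from the cluster the profile is the parity of `⌊s / ℓ⌋` whatever `N`
is. At `r = 1/2` the shape is squeezed between concentric disks. Compactness of the interval makes
the continuity uniform. -/

namespace ConstWidth

/-! ### Constant width through chords; inradius and circumradius -/

/-- Constant width `1`, expressed through points only: the diameter is at most `1`, and in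
every direction there are two points at distance `1`. -/
structure CW (Ω : Set ℂ) : Prop where
  diam : ∀ x ∈ Ω, ∀ y ∈ Ω, ‖x - y‖ ≤ 1
  chord : ∀ u : ℂ, ‖u‖ = 1 → ∃ x ∈ Ω, x - u ∈ Ω

theorem CW.nonempty {Ω : Set ℂ} (h : CW Ω) : Ω.Nonempty :=
  let ⟨x, hx, _⟩ := h.chord 1 (by simp)
  ⟨x, hx⟩

theorem eq_of_inner_ge_one {u w : ℂ} (hu : ‖u‖ = 1) (hw : ‖w‖ ≤ 1) (h : 1 ≤ inner ℝ u w) :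
    w = u := by
  have h1 : ‖w - u‖ ^ 2 ≤ 0 := by
    rw [norm_sub_sq_real, hu, real_inner_comm]
    nlinarith [norm_nonneg w]
  have h2 : ‖w - u‖ = 0 := by nlinarith [norm_nonneg (w - u)]
  exact sub_eq_zero.mp (norm_eq_zero.mp h2)

theorem isCompact_inner_image {Ω : Set ℂ} (hc : IsCompact Ω) (u : ℂ) :
    IsCompact ((fun x : ℂ => (inner ℝ u x : ℝ)) '' Ω) :=
  hc.image (by fun_prop)

/-- The width in the direction of `x - y` bounds `‖x - y‖`, so the diameter is at most 1. The two
support points in direction `u` then differ by a vector of norm at most 1 whose `u`-component is 1,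
and the equality case of Cauchy-Schwarz forces this vector to be `u`. -/
theorem hasConstantWidth_iff {Ω : Set ℂ} (hc : IsCompact Ω) (hne : Ω.Nonempty) :
    HasConstantWidth Ω 1 ↔ CW Ω := by
  constructor
  · intro h
    have hle : ∀ u : ℂ, ‖u‖ = 1 → ∀ x ∈ Ω, ∀ y ∈ Ω, inner ℝ u (x - y) ≤ (1 : ℝ) := by
      intro u hu x hx y hy
      have hw := h u hu
      have hcc := isCompact_inner_image hc u
      have h1 := le_csSup hcc.bddAbove (Set.mem_image_of_mem _ hx)
      have h2 := csInf_le hcc.bddBelow (Set.mem_image_of_mem _ hy)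
      simp only [width] at hw
      rw [inner_sub_right]
      linarith
    have hd : ∀ x ∈ Ω, ∀ y ∈ Ω, ‖x - y‖ ≤ 1 := by
      intro x hx y hy
      by_cases h0 : x - y = 0
      · simp [h0]
      have hn : 0 < ‖x - y‖ := norm_pos_iff.mpr h0
      have := hle ((‖x - y‖⁻¹ : ℝ) • (x - y)) (by
        rw [norm_smul, norm_inv, norm_norm, inv_mul_cancel₀ hn.ne']) x hx y hy
      rw [real_inner_smul_left, real_inner_self_eq_norm_sq, pow_two, inv_mul_cancel_left₀ hn.ne']
        at this
      exact this
    refine ⟨hd, fun u hu => ?_⟩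
    have hcc := isCompact_inner_image hc u
    obtain ⟨x, hx, hx'⟩ := hcc.sSup_mem (hne.image _)
    obtain ⟨y, hy, hy'⟩ := hcc.sInf_mem (hne.image _)
    have hw := h u hu
    simp only [width] at hw
    simp only at hx' hy'
    rw [← hx', ← hy', ← inner_sub_right] at hw
    have := eq_of_inner_ge_one hu (hd x hx y hy) hw.ge
    refine ⟨x, hx, ?_⟩
    rw [← this]
    simpa using hy
  · intro h u hu
    obtain ⟨x, hx, hxu⟩ := h.chord u hu
    have hb : ∀ y ∈ Ω, ∀ z ∈ Ω, inner ℝ u y - inner ℝ u z ≤ (1 : ℝ) := by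
      intro y hy z hz
      rw [← inner_sub_right]
      exact (real_inner_le_norm _ _).trans (by rw [hu, one_mul]; exact h.diam y hy z hz)
    have huu : inner ℝ u (x - u) = inner ℝ u x - (1 : ℝ) := by
      rw [inner_sub_right, real_inner_self_eq_norm_sq, hu]; norm_num
    have h1 : sSup ((fun x : ℂ => (inner ℝ u x : ℝ)) '' Ω) = inner ℝ u x := by
      refine IsGreatest.csSup_eq ⟨⟨x, hx, rfl⟩, ?_⟩
      rintro _ ⟨y, hy, rfl⟩
      have := hb y hy _ hxu
      simp only
      linarith
    have h2 : sInf ((fun x : ℂ => (inner ℝ u x : ℝ)) '' Ω) = inner ℝ u (x - u) := by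
      refine IsLeast.csInf_eq ⟨⟨x - u, hxu, rfl⟩, ?_⟩
      rintro _ ⟨y, hy, rfl⟩
      have := hb x hx _ hy
      simp only
      linarith
    rw [width, h1, h2, huu]
    ring

theorem exists_norm_eq_one_smul (z : ℂ) : ∃ u : ℂ, ‖u‖ = 1 ∧ z = (‖z‖ : ℝ) • u := by
  by_cases h : z = 0
  · exact ⟨1, by simp, by simp [h]⟩
  · have hn : ‖z‖ ≠ 0 := norm_ne_zero_iff.mpr h
    refine ⟨(‖z‖⁻¹ : ℝ) • z, ?_, ?_⟩
    · rw [norm_smul, norm_inv, norm_norm, inv_mul_cancel₀ hn]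
    · rw [smul_smul, mul_inv_cancel₀ hn, one_smul]

theorem CW.subset_closedBall {Ω : Set ℂ} (h : CW Ω) {c : ℂ} {ρ : ℝ} (hρ : 0 < ρ)
    (hb : ball c ρ ⊆ Ω) : Ω ⊆ closedBall c (1 - ρ) := by
  intro w hw
  rw [mem_closedBall, dist_eq_norm]
  obtain ⟨u, hu, hwu⟩ := exists_norm_eq_one_smul (w - c)
  refine le_of_forall_pos_lt_add fun ε hε => ?_
  -- The ball is open, so the point of it opposite to `w` is taken at a distance `s` slightly below
  -- `ρ` from the centre.
  set s := max 0 (ρ - ε / 2)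
  have hs0 : 0 ≤ s := le_max_left _ _
  have hs1 : s < ρ := max_lt hρ (by linarith)
  have hs2 : ρ - ε / 2 ≤ s := le_max_right _ _
  have hm : c - s • u ∈ Ω := hb (by
    rw [mem_ball, dist_eq_norm, show c - s • u - c = -(s • u) by ring, norm_neg, norm_smul, hu,
      mul_one, Real.norm_of_nonneg hs0]
    exact hs1)
  have := h.diam w hw _ hm
  rw [show w - (c - s • u) = (‖w - c‖ + s) • u by rw [add_smul, ← hwu]; ring, norm_smul, hu,
    mul_one, Real.norm_of_nonneg (by positivity)] at this
  linarith

theorem exists_norm_eq_one_separating {Ω : Set ℂ} (hc : IsClosed Ω) (hconv : Convex ℝ Ω)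
    (hne : Ω.Nonempty) {z : ℂ} (hz : z ∉ Ω) :
    ∃ u : ℂ, ‖u‖ = 1 ∧ ∃ δ > 0, ∀ w ∈ Ω, inner ℝ u w + δ ≤ (inner ℝ u z : ℝ) := by
  obtain ⟨f, s, hs1, hs2⟩ := geometric_hahn_banach_closed_point hconv hc hz
  obtain ⟨v, rfl⟩ := (InnerProductSpace.toDual ℝ ℂ).surjective f
  simp only [InnerProductSpace.toDual_apply_apply] at hs1 hs2
  obtain ⟨u, hu, hvu⟩ := exists_norm_eq_one_smul v
  have hv : 0 < ‖v‖ := by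
    rw [norm_pos_iff]
    rintro rfl
    obtain ⟨w, hw⟩ := hne
    have := hs1 w hw
    simp at this hs2
    linarith
  refine ⟨u, hu, ‖v‖⁻¹ * (inner ℝ v z - s), mul_pos (inv_pos.mpr hv) (by linarith), fun w hw => ?_⟩
  have h1 := hs1 w hw
  rw [hvu, real_inner_smul_left] at h1 ⊢
  rw [norm_smul, hu, mul_one, norm_norm, mul_sub, inv_mul_cancel_left₀ hv.ne']
  have : inner ℝ u w < ‖v‖⁻¹ * s := by
    rw [lt_inv_mul_iff₀ hv]; exact h1
  linarith

/-- If a point `z` of the small disk were cut off from `Ω` in direction `u`, the upper end `x` of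
the chord in direction `u` would lie strictly below `z`, and its lower end `x - u` would leave the
large disk. -/
theorem CW.closedBall_subset {Ω : Set ℂ} (h : CW Ω) (hc : IsClosed Ω) (hconv : Convex ℝ Ω)
    {c : ℂ} {ρ : ℝ} (hb : Ω ⊆ closedBall c (1 - ρ)) : closedBall c ρ ⊆ Ω := by
  intro z hz
  by_contra hzΩ
  obtain ⟨u, hu, δ, hδ, hsep⟩ := exists_norm_eq_one_separating hc hconv h.nonempty hzΩ
  obtain ⟨x, hx, hxu⟩ := h.chord u hu
  have h1 := hsep x hx
  have h2 := hb hxu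
  rw [mem_closedBall, dist_eq_norm] at h2 hz
  have h3 : inner ℝ u (z - c) ≤ ρ := (real_inner_le_norm _ _).trans (by rw [hu, one_mul]; exact hz)
  have h4 : inner ℝ u (-(x - u - c)) ≤ 1 - ρ :=
    (real_inner_le_norm _ _).trans (by rw [hu, one_mul, norm_neg]; exact h2)
  simp only [inner_neg_right, inner_sub_right, real_inner_self_eq_norm_sq, hu] at h3 h4
  linarith

/-- The circumradius. -/
noncomputable def circR (Ω : Set ℂ) : ℝ := sInf {ρ : ℝ | ∃ c : ℂ, Ω ⊆ closedBall c ρ}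

theorem circR_le {Ω : Set ℂ} (hne : Ω.Nonempty) {c : ℂ} {ρ : ℝ} (h : Ω ⊆ closedBall c ρ) :
    circR Ω ≤ ρ := by
  refine csInf_le ⟨0, ?_⟩ ⟨c, h⟩
  rintro s ⟨d, hd⟩
  obtain ⟨x, hx⟩ := hne
  exact dist_nonneg.trans (hd hx)

theorem exists_subset_closedBall_circR {Ω : Set ℂ} (hcomp : IsCompact Ω) (hne : Ω.Nonempty) :
    ∃ c : ℂ, Ω ⊆ closedBall c (circR Ω) := by
  obtain ⟨x, hx⟩ := hne
  obtain ⟨D, hD⟩ := hcomp.isBounded.subset_closedBall x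
  -- A disk of radius at most `D` containing `x` has its centre within `D` of `x`, so the search for
  -- the smallest disk can be confined to a compact set of centres and radii.
  have hset : IsCompact {p : ℂ × ℝ | Ω ⊆ closedBall p.1 p.2 ∧ p ∈ closedBall x D ×ˢ Set.Icc 0 D} := by
    refine ((isCompact_closedBall x D).prod isCompact_Icc).inter_left ?_
    have : {p : ℂ × ℝ | Ω ⊆ closedBall p.1 p.2} = ⋂ y ∈ Ω, {p : ℂ × ℝ | dist y p.1 ≤ p.2} := by
      ext p; simp [Set.subset_def]
    show IsClosed {p : ℂ × ℝ | Ω ⊆ closedBall p.1 p.2}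
    rw [this]
    exact isClosed_biInter fun y _ => isClosed_le (by fun_prop) (by fun_prop)
  have hD0 : 0 ≤ D := dist_nonneg.trans (hD hx)
  obtain ⟨⟨c, ρ⟩, ⟨hcρ, -⟩, hmin⟩ := hset.exists_isMinOn (f := Prod.snd)
    ⟨(x, D), hD, by simp [hD0], by simp [hD0]⟩ continuous_snd.continuousOn
  refine ⟨c, hcρ.trans (closedBall_subset_closedBall ?_)⟩
  refine le_csInf ⟨D, x, hD⟩ ?_
  rintro s ⟨d, hd⟩
  by_cases hsD : s ≤ D
  · refine hmin (a := (d, s)) ⟨hd, ?_, dist_nonneg.trans (hd hx), hsD⟩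
    have := hd hx
    rw [mem_closedBall] at this ⊢
    rw [dist_comm]; exact this.trans hsD
  · have : ρ ≤ D := hmin (a := (x, D)) ⟨hD, by simp [hD0], by simp [hD0]⟩
    exact this.trans (not_le.mp hsD).le

theorem circR_le_add {Ω Ω' : Set ℂ} (hcomp : IsCompact Ω) (hne : Ω.Nonempty) (hne' : Ω'.Nonempty)
    {ε : ℝ} (h : ∀ x ∈ Ω', ∃ y ∈ Ω, ‖x - y‖ ≤ ε) : circR Ω' ≤ circR Ω + ε := by
  obtain ⟨c, hc⟩ := exists_subset_closedBall_circR hcomp hne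
  refine circR_le hne' (c := c) fun x hx => ?_
  obtain ⟨y, hy, hxy⟩ := h x hx
  have := hc hy
  rw [mem_closedBall] at this ⊢
  rw [← dist_eq_norm] at hxy
  linarith [dist_triangle x y c]

theorem inradius_eq {Ω : Set ℂ} (hb : IsConvexBody Ω) (h : CW Ω) : inradius Ω = 1 - circR Ω := by
  obtain ⟨hcomp, hconv, x, hx⟩ := hb
  obtain ⟨ε, hε, hball⟩ := Metric.isOpen_iff.mp isOpen_interior x hx
  obtain ⟨c, hc⟩ := exists_subset_closedBall_circR hcomp h.nonempty
  have h1 : circR Ω ≤ 1 - ε :=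
    circR_le h.nonempty (h.subset_closedBall hε (hball.trans interior_subset))
  refine IsGreatest.csSup_eq ⟨⟨by linarith, c, ?_⟩, ?_⟩
  · exact ball_subset_closedBall.trans (h.closedBall_subset hcomp.isClosed hconv (by simpa using hc))
  · rintro ρ ⟨hρ, d, hd⟩
    -- The radius 0 is treated apart because the passage to the outer disk needs a positive radius;
    -- there `h1` suffices.
    rcases hρ.eq_or_lt with rfl | hρ
    · linarith
    · linarith [circR_le h.nonempty (h.subset_closedBall hρ hd)]

theorem CW.isConvexBody {Ω : Set ℂ} (h : CW Ω) (hcomp : IsCompact Ω) (hconv : Convex ℝ Ω)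
    {c : ℂ} {ρ : ℝ} (hρ : ρ < 1) (hb : Ω ⊆ closedBall c ρ) : IsConvexBody Ω := by
  refine ⟨hcomp, hconv, c, mem_interior.mpr ⟨ball c (1 - ρ), ?_, isOpen_ball, ?_⟩⟩
  · exact ball_subset_closedBall.trans
      (h.closedBall_subset hcomp.isClosed hconv (by simpa using hb))
  · simp [hρ]

theorem mem_admissible_iff {r : ℝ} {Ω : Set ℂ} :
    Ω ∈ admissible r ↔ IsConvexBody Ω ∧ CW Ω ∧ circR Ω = 1 - r := by
  constructor
  · rintro ⟨hb, hw, hr⟩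
    have hcw := (hasConstantWidth_iff hb.1 (hb.2.2.mono interior_subset)).mp hw
    refine ⟨hb, hcw, ?_⟩
    rw [inradius_eq hb hcw] at hr
    linarith
  · rintro ⟨hb, hcw, hr⟩
    refine ⟨hb, (hasConstantWidth_iff hb.1 hcw.nonempty).mpr hcw, ?_⟩
    rw [inradius_eq hb hcw]
    linarith

end ConstWidth

/-! ### Compactness of the centred bodies; existence of the minimum and lower semicontinuity -/

namespace ConstWidth

open TopologicalSpace Filter Topology Pointwise

theorem exists_mem_norm_sub_le_dist (K L : NonemptyCompacts ℂ) {x : ℂ} (hx : x ∈ L) :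
    ∃ y ∈ (K : Set ℂ), ‖x - y‖ ≤ dist K L := by
  obtain ⟨y, hy, hxy⟩ := K.isCompact.exists_infDist_eq_dist K.nonempty x
  refine ⟨y, hy, ?_⟩
  rw [← dist_eq_norm, ← hxy, dist_comm K L, NonemptyCompacts.dist_eq]
  exact infDist_le_hausdorffDist_of_mem hx
    (hausdorffEDist_ne_top_of_nonempty_of_bounded L.nonempty K.nonempty L.isCompact.isBounded
      K.isCompact.isBounded)

theorem mem_of_tendsto_nonemptyCompacts {K : ℕ → NonemptyCompacts ℂ} {K₀ : NonemptyCompacts ℂ}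
    (hK : Tendsto K atTop (𝓝 K₀)) {x : ℕ → ℂ} {x₀ : ℂ} (hx : Tendsto x atTop (𝓝 x₀))
    (h : ∀ n, x n ∈ K n) : x₀ ∈ K₀ := by
  have h1 := (uniformContinuous_infDist_Hausdorff_dist (α := ℂ)).continuous.tendsto (x₀, K₀)
  have h2 := h1.comp (hx.prodMk_nhds hK)
  have h3 : (fun p : ℂ × NonemptyCompacts ℂ => infDist p.1 p.2) ∘ (fun n => (x n, K n)) =
      fun _ => 0 := by
    ext n
    exact infDist_zero_of_mem (h n)
  rw [h3] at h2
  have h4 := tendsto_nhds_unique tendsto_const_nhds h2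
  exact (K₀.isCompact.isClosed.mem_iff_infDist_zero K₀.nonempty).mpr h4.symm

theorem exists_tendsto_nonemptyCompacts {K : ℕ → NonemptyCompacts ℂ} {K₀ : NonemptyCompacts ℂ}
    (hK : Tendsto K atTop (𝓝 K₀)) {x₀ : ℂ} (hx : x₀ ∈ K₀) :
    ∃ x : ℕ → ℂ, (∀ n, x n ∈ K n) ∧ Tendsto x atTop (𝓝 x₀) := by
  choose x hx1 hx2 using fun n => exists_mem_norm_sub_le_dist (K n) K₀ hx
  refine ⟨x, hx1, tendsto_iff_dist_tendsto_zero.mpr ?_⟩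
  refine squeeze_zero (fun _ => dist_nonneg) (fun n => ?_) (tendsto_iff_dist_tendsto_zero.mp hK)
  rw [dist_comm, dist_eq_norm]
  exact hx2 n

theorem lipschitzWith_circR : LipschitzWith 1 fun K : NonemptyCompacts ℂ => circR K := by
  refine LipschitzWith.of_le_add fun K L => ?_
  refine circR_le_add L.isCompact L.nonempty K.nonempty fun x hx => ?_
  obtain ⟨y, hy, h⟩ := exists_mem_norm_sub_le_dist L K hx
  exact ⟨y, hy, by rwa [dist_comm]⟩

/-- The convex bodies of constant width `1` and circumradius at most `1 / √3` whose circumcentre is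
the origin. -/
def centred : Set (NonemptyCompacts ℂ) :=
  {K | Convex ℝ (K : Set ℂ) ∧ CW K ∧ (K : Set ℂ) ⊆ closedBall 0 (circR K) ∧
    circR K ≤ 1 / Real.sqrt 3}

theorem one_div_sqrt_three_lt_one : 1 / Real.sqrt 3 < 1 := by
  rw [div_lt_one (by positivity), Real.lt_sqrt (by norm_num)]
  norm_num

/-- Blaschke selection: the compact subsets of the unit disk form a compact space, and all the
defining conditions are closed. For the chords, the upper end points converge only along a
subsequence, which is enough. -/
theorem isCompact_centred : IsCompact centred := by
  refine (NonemptyCompacts.isCompact_subsets_of_isCompact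
    (isCompact_closedBall (0 : ℂ) 1)).of_isClosed_subset (IsSeqClosed.isClosed ?_) ?_
  · intro K K₀ hK hlim
    have hcirc : Tendsto (fun n => circR (K n)) atTop (𝓝 (circR K₀)) :=
      (lipschitzWith_circR.continuous.tendsto K₀).comp hlim
    refine ⟨?_, ⟨?_, ?_⟩, ?_, ?_⟩
    · intro x hx y hy a b ha hb hab
      obtain ⟨x', hx1, hx2⟩ := exists_tendsto_nonemptyCompacts hlim hx
      obtain ⟨y', hy1, hy2⟩ := exists_tendsto_nonemptyCompacts hlim hy
      exact mem_of_tendsto_nonemptyCompacts hlim ((hx2.const_smul a).add (hy2.const_smul b))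
        fun n => (hK n).1 (hx1 n) (hy1 n) ha hb hab
    · intro x hx y hy
      obtain ⟨x', hx1, hx2⟩ := exists_tendsto_nonemptyCompacts hlim hx
      obtain ⟨y', hy1, hy2⟩ := exists_tendsto_nonemptyCompacts hlim hy
      exact le_of_tendsto (hx2.sub hy2).norm
        (Eventually.of_forall fun n => (hK n).2.1.diam _ (hx1 n) _ (hy1 n))
    · intro u hu
      choose x hx1 hx2 using fun n => (hK n).2.1.chord u hu
      obtain ⟨x₀, -, φ, hφ, hx₀⟩ := (isCompact_closedBall (0 : ℂ) 1).tendsto_subseq (x := x)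
        fun n => closedBall_subset_closedBall
          ((hK n).2.2.2.trans one_div_sqrt_three_lt_one.le) ((hK n).2.2.1 (hx1 n))
      have hlim' := hlim.comp hφ.tendsto_atTop
      exact ⟨x₀, mem_of_tendsto_nonemptyCompacts hlim' hx₀ fun n => hx1 _,
        mem_of_tendsto_nonemptyCompacts hlim' (hx₀.sub_const u) fun n => hx2 _⟩
    · intro x hx
      obtain ⟨x', hx1, hx2⟩ := exists_tendsto_nonemptyCompacts hlim hx
      rw [mem_closedBall_zero_iff]
      exact le_of_tendsto_of_tendsto' hx2.norm hcirc fun n => by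
        simpa using (hK n).2.2.1 (hx1 n)
    · exact le_of_tendsto hcirc (Eventually.of_forall fun n => (hK n).2.2.2)
  · intro K hK
    exact hK.2.2.1.trans (closedBall_subset_closedBall
      (hK.2.2.2.trans one_div_sqrt_three_lt_one.le))

/-- Since `K` contains the disk of radius `r`, the disk of radius `ε` lies in `(ε / r) K`; by
convexity the `ε`-neighbourhood of `K` lies in `(1 + ε / r) K`, and area scales quadratically. -/
theorem volume_real_le {K L : Set ℂ} (hcomp : IsCompact K) (hconv : Convex ℝ K) {r ε : ℝ}
    (hr : 0 < r) (hball : closedBall 0 r ⊆ K) (hε : 0 ≤ ε) (h : ∀ x ∈ L, ∃ y ∈ K, ‖x - y‖ ≤ ε) :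
    volume.real L ≤ (1 + ε / r) ^ 2 * volume.real K := by
  have hsub : L ⊆ (1 + ε / r) • K := by
    intro x hx
    obtain ⟨y, hy, hxy⟩ := h x hx
    have hpos : 0 < 1 + ε / r := by positivity
    rcases hε.eq_or_lt with rfl | hε
    · have : x = y := sub_eq_zero.mp (norm_le_zero_iff.mp hxy)
      simpa [this] using hy
    rw [Set.mem_smul_set_iff_inv_smul_mem₀ hpos.ne']
    -- The point `x / (1 + ε / r)` is the convex combination of `y` and `(r / ε)(x - y)` with
    -- weights `r / (r + ε)` and `ε / (r + ε)`.
    have hz : (r / ε) • (x - y) ∈ K := hball (by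
      rw [mem_closedBall_zero_iff, norm_smul, Real.norm_of_nonneg (by positivity), div_mul_eq_mul_div,
        div_le_iff₀ hε]
      exact mul_le_mul_of_nonneg_left hxy hr.le)
    have := hconv hy hz (a := r / (r + ε)) (b := ε / (r + ε)) (by positivity) (by positivity)
      (by field_simp)
    convert this using 1
    rw [smul_smul, show ε / (r + ε) * (r / ε) = r / (r + ε) by field_simp, ← smul_add,
      add_sub_cancel]
    congr 1
    field_simp
  calc volume.real L ≤ volume.real ((1 + ε / r) • K) :=
        measureReal_mono hsub (hcomp.smul _).measure_lt_top.ne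
    _ = _ := by
      rw [Measure.real, Measure.addHaar_smul, Complex.finrank_real_complex, ENNReal.toReal_mul,
        ENNReal.toReal_ofReal (abs_nonneg _), abs_of_nonneg (by positivity)]
      rfl

theorem closedBall_subset_of_mem_centred {K : NonemptyCompacts ℂ} (hK : K ∈ centred) :
    closedBall 0 (1 - 1 / Real.sqrt 3) ⊆ (K : Set ℂ) := by
  refine hK.2.1.closedBall_subset K.isCompact.isClosed hK.1 ?_
  exact hK.2.2.1.trans (closedBall_subset_closedBall (by linarith [hK.2.2.2]))

/-- All centred bodies contain one fixed disk, so the dilation estimate can be applied in both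
directions with the same `r`, and the area is squeezed. -/
theorem continuousOn_volume_centred :
    ContinuousOn (fun K : NonemptyCompacts ℂ => volume.real (K : Set ℂ)) centred := by
  intro K hK
  have hr : 0 < 1 - 1 / Real.sqrt 3 := sub_pos.mpr one_div_sqrt_three_lt_one
  set r := 1 - 1 / Real.sqrt 3
  have key : ∀ K ∈ centred, ∀ L : NonemptyCompacts ℂ,
      volume.real (L : Set ℂ) ≤ (1 + dist K L / r) ^ 2 * volume.real (K : Set ℂ) := fun K hK L =>
    volume_real_le K.isCompact hK.1 hr (closedBall_subset_of_mem_centred hK) dist_nonneg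
      fun x hx => exists_mem_norm_sub_le_dist K L hx
  have hlim : Tendsto (fun L : NonemptyCompacts ℂ => (1 + dist K L / r) ^ 2) (𝓝[centred] K)
      (𝓝 1) := by
    have : Continuous fun L : NonemptyCompacts ℂ => (1 + dist K L / r) ^ 2 := by fun_prop
    have h := this.tendsto K
    simp only [dist_self, zero_div, add_zero, one_pow] at h
    exact h.mono_left nhdsWithin_le_nhds
  refine tendsto_of_tendsto_of_tendsto_of_le_of_le'
    (g := fun L => volume.real (K : Set ℂ) / (1 + dist K L / r) ^ 2)
    (h := fun L => (1 + dist K L / r) ^ 2 * volume.real (K : Set ℂ)) ?_ ?_ ?_ ?_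
  · have h := (tendsto_const_nhds (x := volume.real (K : Set ℂ))).div hlim one_ne_zero
    rw [div_one] at h
    exact h
  · simpa using hlim.mul_const (volume.real (K : Set ℂ))
  · filter_upwards [self_mem_nhdsWithin] with L hL
    have := key L hL K
    rw [div_le_iff₀ (by positivity), mul_comm, dist_comm]
    exact this
  · exact Eventually.of_forall fun L => key K hK L

theorem mem_admissible_of_mem_centred {K : NonemptyCompacts ℂ} (hK : K ∈ centred) :
    (K : Set ℂ) ∈ admissible (1 - circR K) :=
  mem_admissible_iff.mpr ⟨hK.2.1.isConvexBody K.isCompact hK.1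
    (hK.2.2.2.trans_lt one_div_sqrt_three_lt_one) hK.2.2.1, hK.2.1, by ring⟩

theorem CW.vadd {Ω : Set ℂ} (h : CW Ω) (c : ℂ) : CW ((fun x => x + c) '' Ω) := by
  constructor
  · rintro _ ⟨x, hx, rfl⟩ _ ⟨y, hy, rfl⟩
    simpa using h.diam x hx y hy
  · intro u hu
    obtain ⟨x, hx, hxu⟩ := h.chord u hu
    exact ⟨x + c, ⟨x, hx, rfl⟩, x - u, hxu, by ring⟩

theorem circR_vadd_le {Ω : Set ℂ} (hcomp : IsCompact Ω) (hne : Ω.Nonempty) (c : ℂ) :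
    circR ((fun x => x + c) '' Ω) ≤ circR Ω := by
  obtain ⟨d, hd⟩ := exists_subset_closedBall_circR hcomp hne
  refine circR_le (hne.image _) (c := d + c) ?_
  rintro _ ⟨x, hx, rfl⟩
  simpa using hd hx

theorem circR_vadd {Ω : Set ℂ} (hcomp : IsCompact Ω) (hne : Ω.Nonempty) (c : ℂ) :
    circR ((fun x => x + c) '' Ω) = circR Ω := by
  refine (circR_vadd_le hcomp hne c).antisymm ?_
  have := circR_vadd_le (hcomp.image (continuous_add_const c)) (hne.image _) (-c)
  rwa [Set.image_image, show (fun x : ℂ => x + c + -c) = id by ext; simp, Set.image_id] at this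

theorem exists_mem_centred {r : ℝ} (hr : 1 - 1 / Real.sqrt 3 ≤ r) {Ω : Set ℂ}
    (hΩ : Ω ∈ admissible r) :
    ∃ K ∈ centred, circR K = 1 - r ∧ volume.real (K : Set ℂ) = volume.real Ω := by
  obtain ⟨⟨hcomp, hconv, -⟩, hcw, hrad⟩ := mem_admissible_iff.mp hΩ
  obtain ⟨c, hc⟩ := exists_subset_closedBall_circR hcomp hcw.nonempty
  let K : NonemptyCompacts ℂ :=
    ⟨⟨(fun x => x + -c) '' Ω, hcomp.image (continuous_add_const _)⟩, hcw.nonempty.image _⟩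
  have hKc : circR K = circR Ω := circR_vadd hcomp hcw.nonempty _
  refine ⟨K, ⟨?_, hcw.vadd _, ?_, ?_⟩, hKc.trans hrad, ?_⟩
  · change Convex ℝ ((fun x => x + -c) '' Ω)
    simpa [add_comm] using hconv.translate (-c)
  · rintro _ ⟨x, hx, rfl⟩
    rw [hKc]
    simpa [dist_eq_norm, sub_eq_add_neg] using hc hx
  · rw [hKc, hrad]; linarith
  · change volume.real ((fun x => x + -c) '' Ω) = _
    rw [Measure.real, Set.image_add_right, measure_preimage_add_right]
    rfl

theorem isLeast_minArea {r : ℝ} (hr : 1 - 1 / Real.sqrt 3 ≤ r) (hne : (admissible r).Nonempty) :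
    IsLeast ((fun Ω : Set ℂ => volume.real Ω) '' admissible r) (minArea r) := by
  have hcomp : IsCompact (centred ∩ {K | circR K = 1 - r}) :=
    isCompact_centred.inter_right (isClosed_eq lipschitzWith_circR.continuous continuous_const)
  obtain ⟨Ω, hΩ⟩ := hne
  obtain ⟨K, hK, hKr, -⟩ := exists_mem_centred hr hΩ
  obtain ⟨L, ⟨hL, hLr⟩, hmin⟩ := hcomp.exists_isMinOn ⟨K, hK, hKr⟩
    (continuousOn_volume_centred.mono Set.inter_subset_left)
  have hleast : IsLeast ((fun Ω : Set ℂ => volume.real Ω) '' admissible r)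
      (volume.real (L : Set ℂ)) := by
    constructor
    · refine ⟨L, ?_, rfl⟩
      have := mem_admissible_of_mem_centred hL
      rwa [hLr, sub_sub_cancel] at this
    · rintro _ ⟨Ω', hΩ', rfl⟩
      obtain ⟨K', hK', hKr', hv⟩ := exists_mem_centred hr hΩ'
      simp only [← hv]
      exact hmin ⟨hK', hKr'⟩
  rw [minArea, hleast.csInf_eq]
  exact hleast

/-- The centred bodies of area at most `a` form a compact set; the set of their inradii is therefore
closed, and it does not contain `r`. -/
theorem eventually_lt_minArea (hne : ∀ r ∈ inradii, (admissible r).Nonempty) {r a : ℝ}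
    (hr : r ∈ inradii) (ha : a < minArea r) : ∀ᶠ s in 𝓝[inradii] r, a < minArea s := by
  have hcomp : IsCompact (centred ∩ {K | volume.real (K : Set ℂ) ≤ a}) :=
    isCompact_centred.of_isClosed_subset
      (continuousOn_volume_centred.preimage_isClosed_of_isClosed isCompact_centred.isClosed
        isClosed_Iic) Set.inter_subset_left
  have hclosed : IsClosed ((fun K : NonemptyCompacts ℂ => 1 - circR K) ''
      (centred ∩ {K | volume.real (K : Set ℂ) ≤ a})) :=
    (hcomp.image (continuous_const.sub lipschitzWith_circR.continuous)).isClosed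
  have hrn : r ∉ (fun K : NonemptyCompacts ℂ => 1 - circR K) ''
      (centred ∩ {K | volume.real (K : Set ℂ) ≤ a}) := by
    rintro ⟨K, ⟨hK, hKa⟩, rfl⟩
    have := (isLeast_minArea hr.1 (hne _ hr)).2 ⟨K, mem_admissible_of_mem_centred hK, rfl⟩
    exact absurd (ha.trans_le (this.trans hKa)) (lt_irrefl _)
  filter_upwards [self_mem_nhdsWithin, mem_nhdsWithin_of_mem_nhds
    (hclosed.isOpen_compl.mem_nhds hrn)] with s hs hsn
  by_contra hlt
  obtain ⟨Ω, hΩ, hv⟩ := (isLeast_minArea hs.1 (hne _ hs)).1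
  obtain ⟨K, hK, hKr, hKv⟩ := exists_mem_centred hs.1 hΩ
  refine hsn ⟨K, ⟨hK, ?_⟩, by simp [hKr]⟩
  simp only at hv
  change volume.real (K : Set ℂ) ≤ a
  rw [hKv, hv]
  exact not_lt.mp hlt

end ConstWidth

/-! ### Bodies for comparison: completions and Minkowski segments -/

namespace ConstWidth

open TopologicalSpace Filter Topology Pointwise

/-! ### Completion of a set of diameter at most `1` -/

/-- The vector `n` is `± i d / ‖d‖` with the sign that makes it point away from `u`; the last
identity is Pythagoras for the unit vector `u` in the basis `d / ‖d‖`, `n`. -/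
theorem exists_unit_normal {d u : ℂ} (hd : d ≠ 0) (hu : ‖u‖ = 1) :
    ∃ n : ℂ, ‖n‖ = 1 ∧ inner ℝ d n = (0 : ℝ) ∧ inner ℝ u n ≤ (0 : ℝ) ∧
      ‖d‖ ^ 2 * (inner ℝ u n : ℝ) ^ 2 = ‖d‖ ^ 2 - (inner ℝ u d : ℝ) ^ 2 := by
  have hD0 : 0 < ‖d‖ := norm_pos_iff.mpr hd
  have hDsq : ‖d‖ ^ 2 = d.re ^ 2 + d.im ^ 2 := by
    rw [← Complex.normSq_eq_norm_sq, Complex.normSq_apply]; ring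
  have husq : 1 = u.re ^ 2 + u.im ^ 2 := by
    rw [← one_pow 2, ← hu, ← Complex.normSq_eq_norm_sq, Complex.normSq_apply]; ring
  have key : ∀ κ : ℝ, κ ^ 2 = 1 → inner ℝ u ((κ / ‖d‖) • (Complex.I * d)) ≤ (0 : ℝ) →
      ∃ n : ℂ, ‖n‖ = 1 ∧ inner ℝ d n = (0 : ℝ) ∧ inner ℝ u n ≤ (0 : ℝ) ∧
        ‖d‖ ^ 2 * (inner ℝ u n : ℝ) ^ 2 = ‖d‖ ^ 2 - (inner ℝ u d : ℝ) ^ 2 := by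
    intro κ hκ hle
    refine ⟨(κ / ‖d‖) • (Complex.I * d), ?_, ?_, hle, ?_⟩
    · have : |κ| = 1 := by
        have := sq_abs κ
        nlinarith [abs_nonneg κ]
      rw [norm_smul, norm_mul, Complex.norm_I, one_mul, Real.norm_eq_abs, abs_div, this,
        abs_of_pos hD0]
      field_simp
    · rw [real_inner_smul_right, Complex.inner]
      simp
      right; ring
    · rw [real_inner_smul_right, Complex.inner, Complex.inner]
      simp only [Complex.mul_re, Complex.conj_re, Complex.conj_im, Complex.I_re, Complex.I_im,
        Complex.mul_im]
      have e1 : ‖d‖ ^ 2 * (κ / ‖d‖ * ((0 * d.re - 1 * d.im) * u.re -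
          (0 * d.im + 1 * d.re) * -u.im)) ^ 2 = (u.im * d.re - u.re * d.im) ^ 2 := by
        field_simp
        rw [hκ]; ring
      rw [e1]
      linear_combination -(d.re ^ 2 + d.im ^ 2) * husq - hDsq
  by_cases h : inner ℝ u ((1 / ‖d‖) • (Complex.I * d)) ≤ (0 : ℝ)
  · exact key 1 (by norm_num) h
  · refine key (-1) (by norm_num) ?_
    rw [neg_div, neg_smul, inner_neg_right]
    linarith [not_le.mp h]

/-- The point `p - e` is the centre of the unit circle through `p` and `p + d` whose short arc rises
above `p` in the direction `u`. -/
theorem exists_arc_centre {d u : ℂ} (hu : ‖u‖ = 1) (hd1 : ‖d‖ ≤ 1)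
    (hle : inner ℝ u d ≤ (0 : ℝ)) (hout : 1 < ‖d + u‖) :
    ∃ e : ℂ, ‖e‖ ^ 2 = 1 ∧ inner ℝ e d = -(‖d‖ ^ 2 / 2) ∧
      -2 * inner ℝ u d < inner ℝ u e * ‖d‖ ^ 2 := by
  set D := ‖d‖ with hD
  set m : ℝ := -inner ℝ u d with hm
  have hm0 : 0 ≤ m := by linarith
  have hmD : 2 * m < D ^ 2 := by
    have h1 : 1 < ‖d + u‖ ^ 2 := by nlinarith
    rw [norm_add_sq_real, hu, real_inner_comm] at h1
    linarith
  have hd0 : d ≠ 0 := by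
    rintro rfl
    rw [hD, norm_zero] at hmD
    linarith
  have hD0 : 0 < D := norm_pos_iff.mpr hd0
  have hD2 : D ^ 2 ≤ 1 := pow_le_one₀ hD0.le hd1
  obtain ⟨n, hn1, hnd, hun, hunsq⟩ := exists_unit_normal hd0 hu
  set s := Real.sqrt (1 - D ^ 2 / 4) with hs
  have hs1 : s ^ 2 = 1 - D ^ 2 / 4 := Real.sq_sqrt (by linarith)
  have hs0 : 0 < s := Real.sqrt_pos.mpr (by linarith)
  set ν : ℝ := -inner ℝ u n with hν
  have hν0 : 0 ≤ ν := by linarith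
  have hνD : 2 * s * m < ν * D ^ 2 := by
    refine lt_of_pow_lt_pow_left₀ 2 (by positivity) ?_
    have e1 : (ν * D ^ 2) ^ 2 = D ^ 2 * (D ^ 2 - m ^ 2) := by
      rw [hm, neg_sq, hD, ← hunsq, hν]; ring
    rw [e1, mul_pow, mul_pow, hs1]
    have : (2 * m) ^ 2 < (D ^ 2) ^ 2 := pow_lt_pow_left₀ hmD (by positivity) two_ne_zero
    nlinarith
  -- The centre `p - e` lies on the perpendicular bisector of `p` and `p + d`, at distance `s` from
  -- the midpoint. The last inequality says that the height of the arc in direction `u` has positive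
  -- derivative at `p`.
  refine ⟨-((1 / 2 : ℝ) • d + s • n), ?_, ?_, ?_⟩
  · rw [norm_neg, norm_add_sq_real, norm_smul, norm_smul, hn1, real_inner_smul_left,
      real_inner_smul_right, hnd, Real.norm_of_nonneg hs0.le]
    norm_num
    rw [← hD]
    linarith
  · rw [inner_neg_left, inner_add_left, real_inner_smul_left, real_inner_smul_left,
      real_inner_self_eq_norm_sq, real_inner_comm, hnd]
    ring
  · rw [inner_neg_right, inner_add_right, real_inner_smul_right, real_inner_smul_right]
    have h1 : s * (2 * s * m) < s * (ν * D ^ 2) := mul_lt_mul_of_pos_left hνD hs0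
    have h2 : s * (2 * s * m) = 2 * m - m * D ^ 2 / 2 := by linear_combination 2 * m * hs1
    have h3 : inner ℝ u d = -m := by rw [hm, neg_neg]
    have h4 : inner ℝ u n = -ν := by rw [hν, neg_neg]
    rw [h3, h4]
    linarith

/-- Quantifies "the arc rises at `p`": `β` is the parameter of a point on the chord. The last
inequality reduces to `2 * m < E * D * (1 - β)`, that is `κ < 1 - β`, which `β = (1 - κ) / 2`
satisfies. -/
theorem exists_small_parameter {D m E : ℝ} (hm0 : 0 ≤ m) (hD0 : 0 < D) (hD1 : D ≤ 1)
    (hED : 2 * m < E * D) :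
    ∃ β : ℝ, 0 < β ∧ β < 1 ∧ 0 < 1 - β * D * (1 - β) ∧ 0 ≤ E - β * m ∧ 0 < E ∧
      E ^ 2 * (1 - β * D * (1 - β)) < (E - β * m) ^ 2 := by
  have hE0 : 0 < E := by
    by_contra h
    have := mul_nonpos_of_nonpos_of_nonneg (not_lt.mp h) hD0.le
    linarith
  have hE2 : 2 * m < E := by nlinarith
  set κ := 2 * m / (E * D) with hκ
  have hκ1 : κ < 1 := (div_lt_one (by positivity)).mpr hED
  have hκ0 : 0 ≤ κ := by positivity
  have hκm : κ * (E * D) = 2 * m := div_mul_cancel₀ _ (by positivity)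
  obtain ⟨β, hβ⟩ : ∃ β, β = (1 - κ) / 2 := ⟨_, rfl⟩
  have hβ0 : 0 < β := by linarith
  have hβ1 : β ≤ 1 / 2 := by linarith
  have hβD : β * D ≤ 1 / 2 := by nlinarith
  refine ⟨β, hβ0, by linarith, by nlinarith, by nlinarith, hE0, ?_⟩
  have h2 : 2 * m < E * D * (1 - β) := by
    have h3 : 0 < E * D := by positivity
    rw [← hκm, mul_comm]
    exact mul_lt_mul_of_pos_left (by linarith) h3
  have h3 : β * E * (2 * m) < β * E * (E * D * (1 - β)) :=
    mul_lt_mul_of_pos_left h2 (by positivity)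
  nlinarith [sq_nonneg (β * m)]

/-- A point that lies in every unit disk containing `p` and `y` may be found strictly above `p` in
the direction `u`, unless `y` lies in the unit disk centred at `p - u`. -/
theorem exists_higher_point {p y u : ℂ} (hu : ‖u‖ = 1) (hpy : ‖y - p‖ ≤ 1)
    (hle : inner ℝ u (y - p) ≤ (0 : ℝ)) (hout : 1 < ‖y - p + u‖) :
    ∃ z : ℂ, (∀ x : ℂ, ‖x - p‖ ≤ 1 → ‖x - y‖ ≤ 1 → ‖z - x‖ ≤ 1) ∧
      inner ℝ u p < (inner ℝ u z : ℝ) := by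
  obtain ⟨d, hd⟩ : ∃ d, d = y - p := ⟨_, rfl⟩
  rw [← hd] at hpy hle hout
  obtain ⟨e, hee, hed, hE⟩ := exists_arc_centre hu hpy hle hout
  have hd0 : 0 < ‖d‖ := by
    rw [norm_pos_iff]
    rintro rfl
    simp [hu] at hout
  obtain ⟨β, hβ0, hβ1, hpos, hEβ, hE0, hβ⟩ := exists_small_parameter (D := ‖d‖ ^ 2)
    (m := -inner ℝ u d) (E := inner ℝ u e) (by linarith) (by positivity)
    (pow_le_one₀ hd0.le hpy) (by linarith)
  obtain ⟨g, hg⟩ : ∃ g, g = e + β • d := ⟨_, rfl⟩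
  have hgsq : ‖g‖ ^ 2 = 1 - β * ‖d‖ ^ 2 * (1 - β) := by
    rw [hg, norm_add_sq_real, hee, norm_smul, real_inner_smul_right, hed,
      Real.norm_of_nonneg hβ0.le]
    ring
  have hg0 : 0 < ‖g‖ := by
    rw [← hgsq] at hpos
    exact (norm_nonneg g).lt_of_ne fun h => by simp [← h] at hpos
  have hg1 : ‖g‖ ≤ 1 := by
    have h1 : 0 ≤ β * ‖d‖ ^ 2 * (1 - β) := by
      have : 0 ≤ 1 - β := by linarith
      positivity
    have h2 : ‖g‖ ^ 2 ≤ 1 ^ 2 := by rw [hgsq]; linarith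
    exact (sq_le_sq₀ hg0.le zero_le_one).mp h2
  -- The vector `g` leads from the centre `p - e` to the chord point `p + β d`, so this is the
  -- radial projection of that point to the arc. The disk conditions on `x` at `p` and `y` are `‖X‖²
  -- ≤ 2⟨X, e⟩` and `‖X‖² ≤ 2⟨X, e + d⟩`; their convex combination is the one for `g`, and `‖g‖ ≤ 1`
  -- completes the estimate.
  refine ⟨p - e + ‖g‖⁻¹ • g, ?_, ?_⟩
  · intro x hxp hxy
    obtain ⟨X, hX⟩ : ∃ X, X = x - (p - e) := ⟨_, rfl⟩
    have h1 : ‖X‖ ^ 2 ≤ 2 * inner ℝ X e := by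
      have : ‖X - e‖ ^ 2 ≤ 1 := by
        rw [hX, show x - (p - e) - e = x - p by ring]
        exact pow_le_one₀ (norm_nonneg _) hxp
      rw [norm_sub_sq_real, hee] at this
      linarith
    have h2 : ‖X‖ ^ 2 ≤ 2 * inner ℝ X (e + d) := by
      have h3 : ‖X - (e + d)‖ ^ 2 ≤ 1 := by
        rw [hX, hd, show x - (p - e) - (e + (y - p)) = x - y by ring]
        exact pow_le_one₀ (norm_nonneg _) hxy
      have h4 : ‖e + d‖ ^ 2 = 1 := by
        rw [norm_add_sq_real, hee, hed]; ring
      rw [norm_sub_sq_real, h4] at h3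
      linarith
    have h3 : ‖X‖ ^ 2 ≤ 2 * inner ℝ X g := by
      rw [inner_add_right] at h2
      rw [hg, inner_add_right, real_inner_smul_right]
      nlinarith
    have h4 : ‖‖g‖⁻¹ • g - X‖ ^ 2 ≤ 1 ^ 2 := by
      rw [norm_sub_sq_real, norm_smul, norm_inv, norm_norm, inv_mul_cancel₀ hg0.ne',
        real_inner_smul_left, real_inner_comm]
      have h5 : 1 ≤ ‖g‖⁻¹ := (one_le_inv₀ hg0).mpr hg1
      have h6 : (0 : ℝ) ≤ inner ℝ X g := by linarith [sq_nonneg ‖X‖]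
      nlinarith
    rw [show p - e + ‖g‖⁻¹ • g - x = ‖g‖⁻¹ • g - X by rw [hX]; ring]
    exact (sq_le_sq₀ (norm_nonneg _) zero_le_one).mp h4
  · rw [inner_add_right, inner_sub_right, real_inner_smul_right]
    have h1 : inner ℝ u e * ‖g‖ < inner ℝ u g := by
      rw [hg, inner_add_right, real_inner_smul_right, ← hg]
      refine lt_of_pow_lt_pow_left₀ 2 (by linarith) ?_
      rw [mul_pow, hgsq]
      refine hβ.trans_eq ?_
      ring
    have h2 : inner ℝ u e < ‖g‖⁻¹ * inner ℝ u g := by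
      rw [lt_inv_mul_iff₀ hg0]
      linarith
    linarith

/-- Every set of diameter at most `1` is contained in a set of constant width `1`. -/
theorem exists_CW_superset {S : Set ℂ} (hne : S.Nonempty)
    (hS : ∀ x ∈ S, ∀ y ∈ S, ‖x - y‖ ≤ 1) :
    ∃ K : Set ℂ, S ⊆ K ∧ IsCompact K ∧ Convex ℝ K ∧ CW K := by
  -- A maximal set of diameter at most 1 is the intersection of the unit disks centred at its
  -- points, hence compact and convex.
  obtain ⟨K, hSK, hK⟩ := zorn_subset_nonempty {A : Set ℂ | ∀ x ∈ A, ∀ y ∈ A, ‖x - y‖ ≤ 1}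
    (by
      intro C hC hchain _
      refine ⟨⋃₀ C, ?_, fun s hs => Set.subset_sUnion_of_mem hs⟩
      rintro x ⟨A, hA, hxA⟩ y ⟨B, hB, hyB⟩
      rcases hchain.total hA hB with h | h
      · exact hC hB x (h hxA) y hyB
      · exact hC hA x hxA y (h hyB)) S hS
  have hdiam : ∀ x ∈ K, ∀ y ∈ K, ‖x - y‖ ≤ 1 := hK.prop
  have hmem : ∀ z : ℂ, (∀ y ∈ K, ‖z - y‖ ≤ 1) → z ∈ K := by
    intro z hz
    have : insert z K ⊆ K := hK.le_of_ge (by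
      rintro x (rfl | hx) y (rfl | hy)
      · simp
      · exact hz y hy
      · rw [norm_sub_rev]; exact hz x hx
      · exact hdiam x hx y hy) (Set.subset_insert z K)
    exact this (Set.mem_insert z K)
  have hKeq : K = ⋂ y ∈ K, closedBall y 1 := by
    ext z
    simp only [Set.mem_iInter, mem_closedBall, dist_eq_norm]
    exact ⟨fun hz y hy => hdiam z hz y hy, hmem z⟩
  have hKne : K.Nonempty := hne.mono hSK
  have hclosed : IsClosed K := by
    rw [hKeq]
    exact isClosed_biInter fun y _ => isClosed_closedBall
  have hcomp : IsCompact K := by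
    obtain ⟨y, hy⟩ := hKne
    exact (isCompact_closedBall y 1).of_isClosed_subset hclosed
      fun z hz => by rw [mem_closedBall, dist_eq_norm]; exact hdiam z hz y hy
  have hconv : Convex ℝ K := by
    rw [hKeq]
    exact convex_iInter₂ fun y _ => convex_closedBall y 1
  refine ⟨K, hSK, hcomp, hconv, hdiam, fun u hu => ?_⟩
  -- The chord hangs from a highest point `p`. If `p - u` were missing, some `y ∈ K` would be at
  -- distance more than 1 from it, and `exists_higher_point` would give a point of `K` above `p`.
  obtain ⟨p, hp, hmax⟩ := hcomp.exists_isMaxOn hKne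
    (f := fun x : ℂ => (inner ℝ u x : ℝ)) (by fun_prop)
  refine ⟨p, hp, hmem _ fun y hy => ?_⟩
  by_contra hlt
  obtain ⟨z, hz1, hz2⟩ := exists_higher_point (p := p) (y := y) hu (hdiam y hy p hp)
    (by rw [inner_sub_right]; linarith [show inner ℝ u y ≤ inner ℝ u p from hmax hy])
    (by rw [show y - p + u = -(p - u - y) by ring, norm_neg]; exact not_le.mp hlt)
  have hzK : z ∈ K := hmem z fun x hx => hz1 x (hdiam x hx p hp) (hdiam x hx y hy)
  exact absurd hz2 (not_lt.mpr (hmax hzK))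

/-! ### Minkowski combinations -/

/-- The Minkowski combination `(1 - t) Ω + t K`. -/
def mix (t : ℝ) (Ω K : Set ℂ) : Set ℂ :=
  (fun p : ℂ × ℂ => (1 - t) • p.1 + t • p.2) '' Ω ×ˢ K

theorem mem_mix {t : ℝ} {Ω K : Set ℂ} {x y : ℂ} (hx : x ∈ Ω) (hy : y ∈ K) :
    (1 - t) • x + t • y ∈ mix t Ω K := ⟨(x, y), ⟨hx, hy⟩, rfl⟩

theorem mix_zero {Ω K : Set ℂ} (hK : K.Nonempty) : mix 0 Ω K = Ω := by
  ext z
  constructor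
  · rintro ⟨⟨x, y⟩, ⟨hx, -⟩, rfl⟩
    simpa using hx
  · intro hz
    obtain ⟨y, hy⟩ := hK
    simpa using mem_mix (t := 0) hz hy

theorem isCompact_mix {t : ℝ} {Ω K : Set ℂ} (hΩ : IsCompact Ω) (hK : IsCompact K) :
    IsCompact (mix t Ω K) := (hΩ.prod hK).image (by fun_prop)

theorem convex_mix {t : ℝ} {Ω K : Set ℂ} (hΩ : Convex ℝ Ω) (hK : Convex ℝ K) :
    Convex ℝ (mix t Ω K) := by
  rintro _ ⟨⟨x, y⟩, ⟨hx, hy⟩, rfl⟩ _ ⟨⟨x', y'⟩, ⟨hx', hy'⟩, rfl⟩ a b ha hb hab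
  refine ⟨(a • x + b • x', a • y + b • y'), ⟨hΩ hx hx' ha hb hab, hK hy hy' ha hb hab⟩, ?_⟩
  simp only [Complex.real_smul]
  ring

/-- Chords in a common direction `u` combine to a chord `(1 - t) u + t u = u`, and the triangle
inequality keeps the diameter at most 1. -/
theorem CW.mix {t : ℝ} (ht0 : 0 ≤ t) (ht1 : t ≤ 1) {Ω K : Set ℂ} (hΩ : CW Ω) (hK : CW K) :
    CW (mix t Ω K) := by
  constructor
  · rintro _ ⟨⟨x, y⟩, ⟨hx, hy⟩, rfl⟩ _ ⟨⟨x', y'⟩, ⟨hx', hy'⟩, rfl⟩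
    calc ‖(1 - t) • x + t • y - ((1 - t) • x' + t • y')‖
        = ‖(1 - t) • (x - x') + t • (y - y')‖ := by congr 1; simp only [Complex.real_smul]; ring
      _ ≤ (1 - t) * ‖x - x'‖ + t * ‖y - y'‖ := by
        refine (norm_add_le _ _).trans (le_of_eq ?_)
        rw [norm_smul, norm_smul, Real.norm_of_nonneg ht0, Real.norm_of_nonneg (by linarith)]
      _ ≤ 1 := by nlinarith [hΩ.diam x hx x' hx', hK.diam y hy y' hy']
  · intro u hu
    obtain ⟨x, hx, hxu⟩ := hΩ.chord u hu
    obtain ⟨y, hy, hyu⟩ := hK.chord u hu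
    refine ⟨_, mem_mix hx hy, ?_⟩
    convert mem_mix (t := t) hxu hyu using 1
    simp only [Complex.real_smul]
    push_cast
    ring

theorem exists_mem_mix_norm_sub_le {Ω K : Set ℂ} {D : ℝ} (hD : ∀ x ∈ Ω, ∀ y ∈ K, ‖x - y‖ ≤ D)
    (s t : ℝ) {z : ℂ} (hz : z ∈ mix s Ω K) : ∃ w ∈ mix t Ω K, ‖z - w‖ ≤ |s - t| * D := by
  obtain ⟨⟨x, y⟩, ⟨hx, hy⟩, rfl⟩ := hz
  refine ⟨_, mem_mix hx hy, ?_⟩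
  calc ‖(1 - s) • x + s • y - ((1 - t) • x + t • y)‖ = ‖(-(s - t)) • (x - y)‖ := by
        congr 1; simp only [Complex.real_smul]; push_cast; ring
    _ ≤ |s - t| * D := by
        rw [norm_smul, Real.norm_eq_abs, abs_neg]
        exact mul_le_mul_of_nonneg_left (hD x hx y hy) (abs_nonneg _)

theorem exists_bound_norm_sub {Ω K : Set ℂ} (hΩ : IsCompact Ω) (hK : IsCompact K) :
    ∃ D : ℝ, 0 ≤ D ∧ ∀ x ∈ Ω, ∀ y ∈ K, ‖x - y‖ ≤ D := by
  obtain ⟨A, hA⟩ := hΩ.isBounded.exists_norm_le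
  obtain ⟨B, hB⟩ := hK.isBounded.exists_norm_le
  refine ⟨|A| + |B|, by positivity, fun x hx y hy => (norm_sub_le _ _).trans ?_⟩
  exact add_le_add ((hA x hx).trans (le_abs_self _)) ((hB y hy).trans (le_abs_self _))

theorem continuous_circR_mix {Ω K : Set ℂ} (hΩ : IsCompact Ω) (hK : IsCompact K)
    (hΩn : Ω.Nonempty) (hKn : K.Nonempty) : Continuous fun t => circR (mix t Ω K) := by
  obtain ⟨D, hD0, hD⟩ := exists_bound_norm_sub hΩ hK
  refine (LipschitzWith.of_le_add_mul (K := ⟨D, hD0⟩) fun s t => ?_).continuous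
  refine circR_le_add (isCompact_mix hΩ hK) ((hΩn.prod hKn).image _) ((hΩn.prod hKn).image _)
    fun x hx => ?_
  obtain ⟨y, hy, h⟩ := exists_mem_mix_norm_sub_le hD s t hx
  refine ⟨y, hy, ?_⟩
  rwa [mul_comm, Real.dist_eq]

/-- Along a segment of Minkowski combinations starting at `Ω` the areas are close to that of `Ω`,
and all intermediate inradii occur. -/
theorem exists_minArea_lt {Ω : NonemptyCompacts ℂ} (hΩ : Ω ∈ centred) {K : Set ℂ}
    (hKcomp : IsCompact K) (hKconv : Convex ℝ K) (hK : CW K) {b : ℝ}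
    (hb : volume.real (Ω : Set ℂ) < b) :
    ∃ t : ℝ, 0 < t ∧ t ≤ 1 ∧ ∀ s ∈ inradii, 1 - s ∈ Set.uIcc (circR Ω) (circR (mix t Ω K)) →
      minArea s < b := by
  obtain ⟨D, hD0, hD⟩ := exists_bound_norm_sub Ω.isCompact hKcomp
  have hr : 0 < 1 - 1 / Real.sqrt 3 := sub_pos.mpr one_div_sqrt_three_lt_one
  set r := 1 - 1 / Real.sqrt 3
  have hvol : ∀ t, 0 ≤ t →
      volume.real (mix t Ω K) ≤ (1 + t * D / r) ^ 2 * volume.real (Ω : Set ℂ) := by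
    intro t ht
    refine volume_real_le Ω.isCompact hΩ.1 hr (closedBall_subset_of_mem_centred hΩ)
      (by positivity) fun x hx => ?_
    obtain ⟨y, hy, hxy⟩ := exists_mem_mix_norm_sub_le hD t 0 hx
    rw [mix_zero hK.nonempty] at hy
    refine ⟨y, hy, ?_⟩
    rwa [sub_zero, abs_of_nonneg ht] at hxy
  have hlim : Tendsto (fun t : ℝ => (1 + t * D / r) ^ 2 * volume.real (Ω : Set ℂ)) (𝓝 0)
      (𝓝 (volume.real (Ω : Set ℂ))) := by
    have : Continuous fun t : ℝ => (1 + t * D / r) ^ 2 * volume.real (Ω : Set ℂ) := by fun_prop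
    simpa using this.tendsto 0
  obtain ⟨δ, hδ, hδb⟩ := Metric.eventually_nhds_iff.mp (hlim.eventually_lt_const hb)
  refine ⟨min 1 (δ / 2), by positivity, min_le_left _ _, fun s hs hsu => ?_⟩
  have hcont := continuous_circR_mix Ω.isCompact hKcomp Ω.nonempty hK.nonempty
  -- Every circumradius between the two ends is attained at some parameter in `[0, min 1 (δ / 2)]`,
  -- and at all of these the area bound is below `b`.
  have hivt := intermediate_value_uIcc (a := 0) (b := min 1 (δ / 2)) hcont.continuousOn
  rw [mix_zero hK.nonempty] at hivt
  obtain ⟨t, ht, hts⟩ := hivt hsu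
  rw [Set.uIcc_of_le (by positivity)] at ht
  have hcw := CW.mix ht.1 (ht.2.trans (min_le_left _ _)) hΩ.2.1 hK
  have hcomp := isCompact_mix (t := t) Ω.isCompact hKcomp
  obtain ⟨c, hc⟩ := exists_subset_closedBall_circR hcomp hcw.nonempty
  simp only at hts
  have hadm : mix t Ω K ∈ admissible s := mem_admissible_iff.mpr
    ⟨hcw.isConvexBody hcomp (convex_mix hΩ.1 hKconv) (by linarith [hs.1]) hc, hcw, hts⟩
  refine ((isLeast_minArea hs.1 ⟨_, hadm⟩).2 ⟨_, hadm, rfl⟩).trans_lt ?_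
  refine (hvol t ht.1).trans_lt (hδb ?_)
  rw [Real.dist_eq, sub_zero, abs_of_nonneg ht.1]
  exact (ht.2.trans (min_le_right _ _)).trans_lt (by linarith)

end ConstWidth

/-! ### Increasing the circumradius; continuity of the least area -/

namespace ConstWidth

open TopologicalSpace Filter Topology

/-- Carathéodory in the plane, for the closed convex hull of a compact set. -/
theorem exists_three_of_mem_closure_convexHull {S : Set ℂ} (hS : IsCompact S) (hne : S.Nonempty)
    {z : ℂ} (hz : z ∈ closure (convexHull ℝ S)) :
    ∃ (p : Fin 3 → ℂ) (w : Fin 3 → ℝ), (∀ i, p i ∈ S) ∧ (∀ i, 0 ≤ w i) ∧ ∑ i, w i = 1 ∧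
      ∑ i, w i • p i = z := by
  have hcomp : IsCompact ((fun q : (Fin 3 → ℂ) × (Fin 3 → ℝ) => ∑ i, q.2 i • q.1 i) ''
      ((Set.univ.pi fun _ => S) ×ˢ stdSimplex ℝ (Fin 3))) :=
    ((isCompact_univ_pi fun _ => hS).prod (isCompact_stdSimplex ℝ (Fin 3))).image (by fun_prop)
  have hsub : convexHull ℝ S ⊆ (fun q : (Fin 3 → ℂ) × (Fin 3 → ℝ) => ∑ i, q.2 i • q.1 i) ''
      ((Set.univ.pi fun _ => S) ×ˢ stdSimplex ℝ (Fin 3)) := by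
    intro y hy
    obtain ⟨s₀, hs₀⟩ := hne
    obtain ⟨ι, hι, x, w, hx, hind, hw, hw1, hsum⟩ := eq_pos_convex_span_of_mem_convexHull hy
    have hcard : Fintype.card ι ≤ Fintype.card (Fin 3) := by
      have h1 := hind.card_le_finrank_succ
      have h2 := (vectorSpan ℝ (Set.range x)).finrank_le
      rw [Complex.finrank_real_complex] at h2
      rw [Fintype.card_fin]
      omega
    obtain ⟨e⟩ := Function.Embedding.nonempty_of_card_le hcard
    -- The at most three affinely independent points are padded to exactly three by copies of `s₀`
    -- with weight 0. Combinations of exactly three points form a compact set, which therefore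
    -- contains the closure too.
    refine ⟨(Function.extend e x fun _ => s₀, Function.extend e w 0), ⟨?_, ?_, ?_⟩, ?_⟩
    · intro k _
      by_cases hk : ∃ i, e i = k
      · obtain ⟨i, rfl⟩ := hk
        simp only [e.injective.extend_apply]
        exact hx ⟨i, rfl⟩
      · simp only [Function.extend_apply' _ _ _ hk]
        exact hs₀
    · intro k
      by_cases hk : ∃ i, e i = k
      · obtain ⟨i, rfl⟩ := hk
        simp only [e.injective.extend_apply]
        exact (hw i).le
      · simp [Function.extend_apply' _ _ _ hk]
    · rw [← hw1]
      refine (Fintype.sum_of_injective e e.injective _ _ (fun k hk => ?_) fun i => ?_).symm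
      · exact Function.extend_apply' _ _ _ hk
      · exact (e.injective.extend_apply _ _ _).symm
    · rw [← hsum]
      refine (Fintype.sum_of_injective e e.injective _ _ (fun k hk => ?_) fun i => ?_).symm
      · simp only
        rw [Function.extend_apply' w _ _ hk]
        simp
      · simp only [e.injective.extend_apply]
  obtain ⟨⟨p, w⟩, ⟨hp, hw⟩, rfl⟩ := (hcomp.isClosed.closure_subset_iff.mpr hsub) hz
  exact ⟨p, w, fun i => hp i trivial, hw.1, hw.2, rfl⟩

/-- The circumcentre lies in the closed convex hull of the contact points. -/
theorem zero_mem_closure_convexHull {Ω : Set ℂ} (hcomp : IsCompact Ω) (hne : Ω.Nonempty)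
    (hR : 0 < circR Ω) (hΩ : Ω ⊆ closedBall 0 (circR Ω)) :
    (Ω ∩ sphere 0 (circR Ω)).Nonempty ∧
      (0 : ℂ) ∈ closure (convexHull ℝ (Ω ∩ sphere 0 (circR Ω))) := by
  obtain ⟨R, hRdef⟩ : ∃ R, R = circR Ω := ⟨_, rfl⟩
  rw [← hRdef] at hR hΩ ⊢
  -- Otherwise all contact points satisfy `⟨v, x⟩ ≥ δ`, and moving the centre to `η v` allows a
  -- smaller disk: points with `⟨v, x⟩ > δ / 2` get within `√(R² - η (δ - η))`, and the remaining
  -- ones have norm at most `R' < R - η`.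
  have key : ∀ v : ℂ, ‖v‖ = 1 → ∀ δ > 0, ∃ x ∈ Ω ∩ sphere 0 R, inner ℝ v x < δ := by
    intro v hv δ hδ
    by_contra! hcon
    have hfar : IsCompact (Ω ∩ {x : ℂ | inner ℝ v x ≤ δ / 2}) :=
      hcomp.inter_right (isClosed_le (by fun_prop) continuous_const)
    obtain ⟨R', hR'0, hR'R, hR'⟩ : ∃ R', 0 ≤ R' ∧ R' < R ∧
        ∀ x ∈ Ω, inner ℝ v x ≤ δ / 2 → ‖x‖ ≤ R' := by
      rcases (Ω ∩ {x : ℂ | inner ℝ v x ≤ δ / 2}).eq_empty_or_nonempty with h | h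
      · refine ⟨0, le_rfl, hR, fun x hx hxv => absurd (show x ∈ (∅ : Set ℂ) from ?_) id⟩
        rw [← h]; exact ⟨hx, hxv⟩
      · obtain ⟨y, hy, hmax⟩ := hfar.exists_isMaxOn h continuous_norm.continuousOn
        refine ⟨‖y‖, norm_nonneg _, ?_, fun x hx hxv => hmax ⟨hx, hxv⟩⟩
        refine lt_of_le_of_ne (by simpa using hΩ hy.1) fun hyR => ?_
        have h1 := hcon y ⟨hy.1, by simpa using hyR⟩
        have h2 : inner ℝ v y ≤ δ / 2 := hy.2
        linarith
    obtain ⟨η, hη0, hη1, hη2⟩ : ∃ η : ℝ, 0 < η ∧ η < δ ∧ R' + η < R := by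
      refine ⟨min (δ / 2) ((R - R') / 2), ?_, ?_, ?_⟩
      · have : 0 < R - R' := by linarith
        positivity
      · exact (min_le_left _ _).trans_lt (by linarith)
      · have := min_le_right (δ / 2) ((R - R') / 2); linarith
    have hlt : ∃ ρ < R, Ω ⊆ closedBall (η • v) ρ := by
      have hs : Real.sqrt (R ^ 2 - η * (δ - η)) < R := by
        rw [Real.sqrt_lt' hR]
        nlinarith
      refine ⟨max (R' + η) (Real.sqrt (R ^ 2 - η * (δ - η))), max_lt hη2 hs, fun x hx => ?_⟩
      rw [mem_closedBall, dist_eq_norm]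
      have hηv : ‖η • v‖ = η := by rw [norm_smul, hv, mul_one, Real.norm_of_nonneg hη0.le]
      by_cases hxv : inner ℝ v x ≤ δ / 2
      · refine le_max_of_le_left ((norm_sub_le _ _).trans ?_)
        rw [hηv]
        linarith [hR' x hx hxv]
      · refine le_max_of_le_right (Real.le_sqrt_of_sq_le ?_)
        rw [norm_sub_sq_real, hηv, real_inner_smul_right, real_inner_comm]
        have hxR : ‖x‖ ≤ R := by simpa using hΩ hx
        have : ‖x‖ ^ 2 ≤ R ^ 2 := pow_le_pow_left₀ (norm_nonneg _) hxR 2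
        nlinarith [not_le.mp hxv]
    obtain ⟨ρ, hρ, hsub⟩ := hlt
    have := circR_le hne hsub
    linarith
  have hne' : (Ω ∩ sphere 0 R).Nonempty := by
    obtain ⟨x, hx, -⟩ := key 1 (by simp) 1 one_pos
    exact ⟨x, hx⟩
  refine ⟨hne', ?_⟩
  by_contra h0
  obtain ⟨u, hu, δ, hδ, hsep⟩ := exists_norm_eq_one_separating isClosed_closure
    (convex_convexHull ℝ _).closure (hne'.mono ((subset_convexHull ℝ _).trans subset_closure)) h0
  obtain ⟨x, hx, hxδ⟩ := key (-u) (by simpa using hu) δ hδ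
  have := hsep x (subset_closure (subset_convexHull ℝ _ hx))
  rw [inner_neg_left] at hxδ
  rw [inner_zero_right] at this
  linarith

/-- As `∑ w i • u i = 0`, the sum does not change when the circumcentre is moved to the origin. The
bound is linear in the points `z i`, which makes it suitable for Minkowski combinations. -/
theorem sum_inner_le_circR {A : Set ℂ} (hA : IsCompact A) {u z : Fin 3 → ℂ} {w : Fin 3 → ℝ}
    (hu : ∀ i, ‖u i‖ = 1) (hw : ∀ i, 0 ≤ w i) (hw1 : ∑ i, w i = 1) (hwu : ∑ i, w i • u i = 0)
    (hz : ∀ i, z i ∈ A) : ∑ i, w i * inner ℝ (u i) (z i) ≤ circR A := by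
  obtain ⟨c, hc⟩ := exists_subset_closedBall_circR hA ⟨_, hz 0⟩
  have h1 : ∑ i, w i * inner ℝ (u i) (z i) = ∑ i, w i * inner ℝ (u i) (z i - c) := by
    have h2 : ∑ i, w i * inner ℝ (u i) c = (0 : ℝ) := by
      have : inner ℝ (∑ i, w i • u i) c = (0 : ℝ) := by rw [hwu, inner_zero_left]
      rw [sum_inner] at this
      simpa only [real_inner_smul_left] using this
    simp only [inner_sub_right, mul_sub, Finset.sum_sub_distrib, h2, sub_zero]
  rw [h1]
  calc ∑ i, w i * inner ℝ (u i) (z i - c) ≤ ∑ i, w i * circR A := by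
        refine Finset.sum_le_sum fun i _ => mul_le_mul_of_nonneg_left ?_ (hw i)
        refine (real_inner_le_norm _ _).trans ?_
        rw [hu, one_mul, ← dist_eq_norm]
        exact hc (hz i)
    _ = circR A := by rw [← Finset.sum_mul, hw1, one_mul]

/-- Moving `a` along `d = c + κ a` leads outwards if `κ > -g / R²` and towards `c` if `κ < 1`; the
chosen `κ` is the midpoint of these bounds. The distance to `b` has slack, so a small step is
allowed. -/
theorem exists_moved_point {a b c : ℂ} {R : ℝ} (hR : 0 < R) (ha : ‖a‖ = R) (hc : ‖c‖ = R)
    (hab : ‖a - b‖ < 1) (hac : ‖a - c‖ ≤ 1) (h1 : -R ^ 2 < inner ℝ a c)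
    (h2 : inner ℝ a c < R ^ 2) :
    ∃ a' : ℂ, ‖a' - b‖ ≤ 1 ∧ ‖a' - c‖ ≤ 1 ∧ R ^ 2 < inner ℝ a a' := by
  obtain ⟨g, hg⟩ : ∃ g : ℝ, g = inner ℝ a c := ⟨_, rfl⟩
  rw [← hg] at h1 h2
  obtain ⟨κ, hκ⟩ : ∃ κ : ℝ, κ = (1 - g / R ^ 2) / 2 := ⟨_, rfl⟩
  have hR2 : 0 < R ^ 2 := by positivity
  have hκR : κ * R ^ 2 = (R ^ 2 - g) / 2 := by rw [hκ]; field_simp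
  have hκ1 : κ < 1 := by
    have : -1 < g / R ^ 2 := by rw [lt_div_iff₀ hR2]; linarith
    linarith
  obtain ⟨d, hd⟩ : ∃ d, d = c + κ • a := ⟨_, rfl⟩
  have hda : (0 : ℝ) < inner ℝ a d := by
    rw [hd, inner_add_right, real_inner_smul_right, real_inner_self_eq_norm_sq, ha, ← hg]
    linarith
  have hdac : inner ℝ d (a - c) < (0 : ℝ) := by
    rw [hd, inner_sub_right, inner_add_left, inner_add_left, real_inner_smul_left,
      real_inner_smul_left, real_inner_self_eq_norm_sq, real_inner_self_eq_norm_sq, ha, hc,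
      real_inner_comm, ← hg]
    nlinarith
  have hev1 : ∀ᶠ ε : ℝ in 𝓝[>] 0, ‖a + ε • d - b‖ < 1 := by
    have hcont : Continuous fun ε : ℝ => ‖a + ε • d - b‖ := by fun_prop
    have := hcont.tendsto 0
    simp only [zero_smul, add_zero] at this
    exact (this.eventually_lt_const hab).filter_mono nhdsWithin_le_nhds
  have hev2 : ∀ᶠ ε : ℝ in 𝓝[>] 0, 2 * inner ℝ d (a - c) + ε * ‖d‖ ^ 2 < 0 := by
    have hcont : Continuous fun ε : ℝ => 2 * (inner ℝ d (a - c) : ℝ) + ε * ‖d‖ ^ 2 := by fun_prop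
    have := hcont.tendsto 0
    simp only [zero_mul, add_zero] at this
    exact (this.eventually_lt_const (by linarith)).filter_mono nhdsWithin_le_nhds
  obtain ⟨ε, hε1, hε2, hε0⟩ := (hev1.and (hev2.and self_mem_nhdsWithin)).exists
  replace hε0 : 0 < ε := hε0
  refine ⟨a + ε • d, hε1.le, ?_, ?_⟩
  · have : ‖a + ε • d - c‖ ^ 2 ≤ 1 ^ 2 := by
      rw [show a + ε • d - c = ε • d + (a - c) by ring, norm_add_sq_real, norm_smul,
        real_inner_smul_left, Real.norm_of_nonneg hε0.le]
      have : ‖a - c‖ ^ 2 ≤ 1 := pow_le_one₀ (norm_nonneg _) hac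
      nlinarith
    exact (sq_le_sq₀ (norm_nonneg _) zero_le_one).mp this
  · rw [inner_add_right, real_inner_smul_right, real_inner_self_eq_norm_sq, ha]
    nlinarith

theorem CW.half_le_circR {Ω : Set ℂ} (h : CW Ω) (hcomp : IsCompact Ω) : 1 / 2 ≤ circR Ω := by
  obtain ⟨c, hc⟩ := exists_subset_closedBall_circR hcomp h.nonempty
  obtain ⟨x, hx, hx'⟩ := h.chord 1 (by simp)
  have h1 := dist_triangle_right x (x - 1) c
  have h2 := hc hx
  have h3 := hc hx'
  rw [mem_closedBall] at h2 h3
  have h4 : dist x (x - 1) = 1 := by simp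
  linarith

/-- Three points on a circle around `0` of radius `R`, at mutual distances at most `1 < 2R`, with
`0` in their convex hull. -/
theorem exists_moved_triple {p : Fin 3 → ℂ} {w : Fin 3 → ℝ} {R : ℝ} (hR : 1 / 2 < R)
    (hR3 : R < 1 / Real.sqrt 3) (hp : ∀ i, ‖p i‖ = R) (hd : ∀ i j, ‖p i - p j‖ ≤ 1)
    (hw : ∀ i, 0 ≤ w i) (hw1 : ∑ i, w i = 1) (hwp : ∑ i, w i • p i = 0) :
    ∃ q : Fin 3 → ℂ, (∀ i j, ‖q i - q j‖ ≤ 1) ∧ R ^ 2 < ∑ i, w i * inner ℝ (p i) (q i) := by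
  have hR0 : 0 < R := by linarith
  have hR2 : 1 / 4 < R ^ 2 := by nlinarith
  have hR2' : R ^ 2 < 1 / 3 := by
    have h1 : R ^ 2 < (1 / Real.sqrt 3) ^ 2 := pow_lt_pow_left₀ hR3 hR0.le two_ne_zero
    rw [div_pow, Real.sq_sqrt (by norm_num)] at h1
    linarith
  have hself : ∀ i, inner ℝ (p i) (p i) = R ^ 2 := fun i => by
    rw [real_inner_self_eq_norm_sq, hp]
  have hdist : ∀ i j, ‖p i - p j‖ ^ 2 = 2 * R ^ 2 - 2 * inner ℝ (p i) (p j) := fun i j => by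
    rw [norm_sub_sq_real, hp, hp]; ring
  have hlow : ∀ i j, R ^ 2 - 1 / 2 ≤ inner ℝ (p i) (p j) := fun i j => by
    have := pow_le_one₀ (n := 2) (norm_nonneg _) (hd i j)
    rw [hdist] at this
    linarith
  have hrel : ∀ i j k, i ≠ j → i ≠ k → j ≠ k → w i + w j + w k = 1 ∧
      w i • p i + w j • p j + w k • p k = 0 := by
    intro i j k hij hik hjk
    have huniv : (Finset.univ : Finset (Fin 3)) = {i, j, k} := by
      ext l
      simp only [Finset.mem_univ, Finset.mem_insert, Finset.mem_singleton, true_iff]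
      omega
    rw [huniv, Finset.sum_insert (by simp [hij, hik]), Finset.sum_insert (by simp [hjk]),
      Finset.sum_singleton, ← add_assoc] at hw1 hwp
    exact ⟨hw1, hwp⟩
  have hrel' : ∀ i j k, i ≠ j → i ≠ k → j ≠ k → ∀ l, w i * inner ℝ (p l) (p i) +
      w j * inner ℝ (p l) (p j) + w k * inner ℝ (p l) (p k) = 0 := by
    intro i j k hij hik hjk l
    have := congrArg (fun z => (inner ℝ (p l) z : ℝ)) (hrel i j k hij hik hjk).2
    simpa only [inner_add_right, real_inner_smul_right, inner_zero_right] using this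
  -- If a weight vanished, 0 would be a convex combination of two points of norm `R`, hence their
  -- midpoint, and their distance would be `2R > 1`.
  have hpos : ∀ i j k, i ≠ j → i ≠ k → j ≠ k → 0 < w i := by
    intro i j k hij hik hjk
    refine (hw i).lt_of_ne fun h0 => ?_
    have h1 := (hrel i j k hij hik hjk).1
    have h2 := hrel' i j k hij hik hjk j
    have h3 := hrel' i j k hij hik hjk k
    rw [← h0, hself] at h2
    rw [← h0, hself, real_inner_comm (p j) (p k)] at h3
    have h4 := hlow j k
    have h5 : w j = w k := by
      have : (w j - w k) * (R ^ 2 - inner ℝ (p j) (p k)) = 0 := by linear_combination h2 - h3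
      rcases mul_eq_zero.mp this with h | h
      · linarith
      · have h6 : inner ℝ (p j) (p k) = R ^ 2 := by linarith
        rw [h6] at h2
        have : (w j + w k) * R ^ 2 = 0 := by linear_combination h2
        have : w j + w k = 1 := by linarith
        nlinarith
    have h6 : w j = 1 / 2 := by linarith
    rw [← h5, h6] at h2
    linarith
  -- If two of the points coincided, 0 would again be the midpoint of two antipodal points.
  have hlt : ∀ i j k, i ≠ j → i ≠ k → j ≠ k → inner ℝ (p i) (p k) < R ^ 2 := by
    intro i j k hij hik hjk
    by_contra hge
    have h0 : p i = p k := by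
      have : ‖p i - p k‖ ^ 2 ≤ 0 := by rw [hdist]; linarith
      have h2 : ‖p i - p k‖ = 0 := by nlinarith [norm_nonneg (p i - p k)]
      exact sub_eq_zero.mp (norm_eq_zero.mp h2)
    have h1 := (hrel i j k hij hik hjk).1
    have h2 := hrel' i j k hij hik hjk i
    have h3 := hrel' i j k hij hik hjk j
    rw [← h0, hself] at h2
    rw [← h0, hself, real_inner_comm] at h3
    have h4 := hlow i j
    have h5 := hpos j i k hij.symm hjk hik
    have h6 : (w j - (w i + w k)) * (R ^ 2 - inner ℝ (p i) (p j)) = 0 := by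
      linear_combination h3 - h2
    rcases mul_eq_zero.mp h6 with h | h
    · have h7 : w j = 1 / 2 := by linarith
      have h8 : (w i + w k) * R ^ 2 + w j * inner ℝ (p i) (p j) = 0 := by linear_combination h2
      rw [h7, show w i + w k = 1 / 2 by linarith] at h8
      linarith
    · have h8 : (w i + w j + w k) * R ^ 2 = 0 := by linear_combination h2 + w j * h
      rw [h1] at h8
      linarith
  -- If all mutual distances were 1, every weight would equal `1 - 2R²`, so that `R² = 1/3`,
  -- contrary to `R < 1 / √3`.
  obtain ⟨i, j, k, hij, hik, hjk, hclose⟩ : ∃ i j k : Fin 3, i ≠ j ∧ i ≠ k ∧ j ≠ k ∧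
      ‖p i - p j‖ < 1 := by
    by_contra! hcon
    have hone : ∀ i j k : Fin 3, i ≠ j → i ≠ k → j ≠ k →
        inner ℝ (p i) (p j) = R ^ 2 - 1 / 2 := by
      intro i j k hij hik hjk
      have h1 := hdist i j
      rw [le_antisymm (hd i j) (hcon i j k hij hik hjk)] at h1
      linarith
    have hw3 : ∀ i j k : Fin 3, i ≠ j → i ≠ k → j ≠ k → R ^ 2 = (1 - w i) / 2 := by
      intro i j k hij hik hjk
      have h1 := hrel' i j k hij hik hjk i
      rw [hself, hone i j k hij hik hjk, hone i k j hik hij hjk.symm] at h1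
      linear_combination h1 + (1 / 2 - R ^ 2) * (hrel i j k hij hik hjk).1
    have h0 := hw3 0 1 2 (by decide) (by decide) (by decide)
    have h1 := hw3 1 0 2 (by decide) (by decide) (by decide)
    have h2 := hw3 2 0 1 (by decide) (by decide) (by decide)
    rw [Fin.sum_univ_three] at hw1
    linarith
  obtain ⟨a, hab, hac, ha⟩ := exists_moved_point hR0 (hp i) (hp k) hclose (hd i k)
    (by have := hlow i k; linarith) (hlt i j k hij hik hjk)
  have hcases : ∀ l : Fin 3, l = i ∨ l = j ∨ l = k := by
    intro l
    omega
  have hq : ∀ l, l ≠ i → ‖a - p l‖ ≤ 1 := by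
    intro l hl
    rcases hcases l with rfl | rfl | rfl
    · exact absurd rfl hl
    · exact hab
    · exact hac
  refine ⟨Function.update p i a, fun l m => ?_, ?_⟩
  · by_cases hl : l = i <;> by_cases hm : m = i
    · simp [hl, hm]
    · rw [hl, Function.update_self, Function.update_of_ne hm]
      exact hq m hm
    · rw [hm, Function.update_self, Function.update_of_ne hl, norm_sub_rev]
      exact hq l hl
    · rw [Function.update_of_ne hm, Function.update_of_ne hl]
      exact hd l m
  · calc R ^ 2 = ∑ l, w l * R ^ 2 := by rw [← Finset.sum_mul, hw1, one_mul]
      _ < ∑ l, w l * inner ℝ (p l) (Function.update p i a l) := by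
        refine Finset.sum_lt_sum (fun l _ => mul_le_mul_of_nonneg_left ?_ (hw l))
          ⟨i, Finset.mem_univ _, mul_lt_mul_of_pos_left ?_ (hpos i j k hij hik hjk)⟩
        · by_cases hl : l = i
          · rw [hl, Function.update_self]
            exact ha.le
          · rw [Function.update_of_ne hl, hself]
        · rw [Function.update_self]
          exact ha

/-- If the circumradius of a body of constant width is smaller than `1 / √3`, there is a direction
in which it grows. -/
theorem exists_test_points {Ω : NonemptyCompacts ℂ} (hΩ : Ω ∈ centred)
    (h : circR Ω < 1 / Real.sqrt 3) :
    ∃ (u p q : Fin 3 → ℂ) (w : Fin 3 → ℝ), (∀ i, ‖u i‖ = 1) ∧ (∀ i, 0 ≤ w i) ∧ ∑ i, w i = 1 ∧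
      ∑ i, w i • u i = 0 ∧ (∀ i, p i ∈ Ω) ∧ circR Ω ≤ ∑ i, w i * inner ℝ (u i) (p i) ∧
      (∀ i j, ‖q i - q j‖ ≤ 1) ∧ circR Ω < ∑ i, w i * inner ℝ (u i) (q i) := by
  obtain ⟨hconv, hcw, hsub, -⟩ := hΩ
  have hhalf := hcw.half_le_circR Ω.isCompact
  obtain ⟨R, hRdef⟩ : ∃ R, R = circR Ω := ⟨_, rfl⟩
  have hR0 : 0 < R := by linarith
  have h3 : (0 : ℝ) < Real.sqrt 3 := by positivity
  have h3sq : Real.sqrt 3 ^ 2 = 3 := Real.sq_sqrt (by norm_num)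
  rcases hhalf.eq_or_lt with heq | hlt
  -- For circumradius `1/2` two antipodal contact points may balance each other, so the moving
  -- argument fails. But then the body contains the disk of radius `1/2`, and the equilateral
  -- triangle of side 1, of circumradius `1 / √3`, serves as `q`.
  · have hball : closedBall 0 (1 / 2) ⊆ (Ω : Set ℂ) :=
      hcw.closedBall_subset Ω.isCompact.isClosed hconv (by rw [← heq] at hsub; norm_num; simpa using hsub)
    have hnorm : ∀ i, ‖(![1, ⟨-1 / 2, Real.sqrt 3 / 2⟩, ⟨-1 / 2, -(Real.sqrt 3 / 2)⟩] :
        Fin 3 → ℂ) i‖ = 1 := by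
      intro i
      rw [← sq_eq_sq₀ (norm_nonneg _) zero_le_one, ← Complex.normSq_eq_norm_sq]
      fin_cases i
      · simp
      · simp [Complex.normSq_mk]; nlinarith
      · simp [Complex.normSq_mk]; nlinarith
    obtain ⟨u, hu⟩ : ∃ u : Fin 3 → ℂ, u =
      ![1, ⟨-1 / 2, Real.sqrt 3 / 2⟩, ⟨-1 / 2, -(Real.sqrt 3 / 2)⟩] := ⟨_, rfl⟩
    rw [← hu] at hnorm
    have hinner : ∀ i (κ : ℝ), inner ℝ (u i) (κ • u i) = κ := fun i κ => by
      rw [real_inner_smul_right, real_inner_self_eq_norm_sq, hnorm]; ring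
    refine ⟨u, fun i => (1 / 2 : ℝ) • u i, fun i => (1 / Real.sqrt 3) • u i, fun _ => 1 / 3,
      hnorm, fun _ => by norm_num, by simp, ?_, ?_, ?_, ?_, ?_⟩
    · rw [← Finset.smul_sum, Fin.sum_univ_three, hu]
      apply Complex.ext
      · simp; norm_num
      · simp
    · intro i
      refine hball ?_
      rw [mem_closedBall_zero_iff, norm_smul, hnorm]
      norm_num
    · simp only [hinner]
      rw [← heq]; simp
    · intro i j
      rw [← smul_sub, norm_smul, Real.norm_of_nonneg (by positivity), one_div, inv_mul_le_iff₀ h3,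
        mul_one]
      refine Real.le_sqrt_of_sq_le ?_
      rw [← Complex.normSq_eq_norm_sq, hu]
      fin_cases i <;> fin_cases j <;> simp [Complex.normSq_apply] <;> nlinarith
    · simp only [hinner]
      simpa using h
  · rw [← hRdef] at h hlt hsub ⊢
    obtain ⟨hne, hmem⟩ := zero_mem_closure_convexHull Ω.isCompact Ω.nonempty (by rwa [← hRdef])
      (by rwa [← hRdef])
    rw [← hRdef] at hne hmem
    obtain ⟨p, w, hp, hw, hw1, hwp⟩ := exists_three_of_mem_closure_convexHull
      (Ω.isCompact.inter_right isClosed_sphere) hne hmem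
    have hpn : ∀ i, ‖p i‖ = R := fun i => by simpa using (hp i).2
    obtain ⟨q, hq, hqR⟩ := exists_moved_triple hlt h hpn
      (fun i j => hcw.diam _ (hp i).1 _ (hp j).1) hw hw1 hwp
    have hscale : ∀ z : Fin 3 → ℂ, ∑ i, w i * inner ℝ (R⁻¹ • p i) (z i) =
        R⁻¹ * ∑ i, w i * inner ℝ (p i) (z i) := fun z => by
      rw [Finset.mul_sum]
      refine Finset.sum_congr rfl fun i _ => ?_
      rw [real_inner_smul_left]; ring
    refine ⟨fun i => R⁻¹ • p i, p, q, w, fun i => ?_, hw, hw1, ?_, fun i => (hp i).1, ?_, hq, ?_⟩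
    · rw [norm_smul, hpn, Real.norm_of_nonneg (by positivity), inv_mul_cancel₀ hR0.ne']
    · simp only [smul_comm _ R⁻¹]
      rw [← Finset.smul_sum, hwp, smul_zero]
    · rw [hscale]
      simp only [real_inner_self_eq_norm_sq, hpn]
      rw [← Finset.sum_mul, hw1, one_mul, sq, inv_mul_cancel_left₀ hR0.ne']
    · rw [hscale, lt_inv_mul_iff₀ hR0, ← sq]
      exact hqR

/-- With `K` a completion of the test points `q`, the linear lower bound on the combination is `(1 -
t)` times a number at least `circR Ω` plus `t` times a number greater than `circR Ω`. -/
theorem exists_growing_body {Ω : NonemptyCompacts ℂ} (hΩ : Ω ∈ centred)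
    (h : circR Ω < 1 / Real.sqrt 3) :
    ∃ K : Set ℂ, IsCompact K ∧ Convex ℝ K ∧ CW K ∧
      ∀ t, 0 < t → t ≤ 1 → circR Ω < circR (mix t Ω K) := by
  obtain ⟨u, p, q, w, hu, hw, hw1, hwu, hp, hpR, hq, hqR⟩ := exists_test_points hΩ h
  obtain ⟨K, hqK, hcomp, hconv, hcw⟩ := exists_CW_superset (Set.range_nonempty q) (by
    rintro _ ⟨i, rfl⟩ _ ⟨j, rfl⟩
    exact hq i j)
  refine ⟨K, hcomp, hconv, hcw, fun t ht0 ht1 => ?_⟩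
  refine lt_of_lt_of_le ?_ (sum_inner_le_circR (isCompact_mix Ω.isCompact hcomp) hu hw hw1 hwu
    (z := fun i => (1 - t) • p i + t • q i) fun i => mem_mix (hp i) (hqK ⟨i, rfl⟩))
  have : ∑ i, w i * inner ℝ (u i) ((1 - t) • p i + t • q i) =
      (1 - t) * ∑ i, w i * inner ℝ (u i) (p i) + t * ∑ i, w i * inner ℝ (u i) (q i) := by
    rw [Finset.mul_sum, Finset.mul_sum, ← Finset.sum_add_distrib]
    refine Finset.sum_congr rfl fun i _ => ?_
    rw [inner_add_right, real_inner_smul_right, real_inner_smul_right]; ring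
  rw [this]
  nlinarith

theorem CW_closedBall : CW (closedBall (0 : ℂ) (1 / 2)) := by
  constructor
  · intro x hx y hy
    rw [mem_closedBall_zero_iff] at hx hy
    exact (norm_sub_le _ _).trans (by linarith)
  · intro u hu
    refine ⟨(1 / 2 : ℝ) • u, ?_, ?_⟩
    · rw [mem_closedBall_zero_iff, norm_smul, hu]; norm_num
    · rw [mem_closedBall_zero_iff, show (1 / 2 : ℝ) • u - u = (-1 / 2 : ℝ) • u by
        simp only [Complex.real_smul]; push_cast; ring, norm_smul, hu]
      norm_num

theorem circR_mix_closedBall_lt {Ω : NonemptyCompacts ℂ} (hΩ : Ω ∈ centred)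
    (h : 1 / 2 < circR Ω) {t : ℝ} (ht0 : 0 < t) (ht1 : t ≤ 1) :
    circR (mix t Ω (closedBall 0 (1 / 2))) < circR Ω := by
  have : circR (mix t Ω (closedBall 0 (1 / 2))) ≤ (1 - t) * circR Ω + t * (1 / 2) := by
    refine circR_le (c := 0) ((Ω.nonempty.prod ⟨0, by simp⟩).image _) ?_
    rintro _ ⟨⟨x, y⟩, ⟨hx, hy⟩, rfl⟩
    have hx' := hΩ.2.2.1 hx
    simp only [mem_closedBall_zero_iff] at hx' hy ⊢
    refine (norm_add_le _ _).trans ?_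
    rw [norm_smul, norm_smul, Real.norm_of_nonneg ht0.le, Real.norm_of_nonneg (by linarith)]
    exact add_le_add (mul_le_mul_of_nonneg_left hx' (by linarith))
      (mul_le_mul_of_nonneg_left hy ht0.le)
  nlinarith

/-- Starting from a minimizer at `r`, mixing in the disk reaches the inradii just above `r`, and
mixing in the growing body reaches those just below. -/
theorem eventually_minArea_lt (hne : ∀ r ∈ inradii, (admissible r).Nonempty) {r b : ℝ}
    (hr : r ∈ inradii) (hb : minArea r < b) : ∀ᶠ s in 𝓝[inradii] r, minArea s < b := by
  obtain ⟨Ω₀, hΩ₀, hv⟩ := (isLeast_minArea hr.1 (hne r hr)).1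
  obtain ⟨Ω, hΩ, hΩr, hΩv⟩ := exists_mem_centred hr.1 hΩ₀
  simp only at hv
  rw [← hv, ← hΩv] at hb
  have hup : ∃ hi > r, ∀ s ∈ inradii, r ≤ s → s < hi → minArea s < b := by
    rcases hr.2.eq_or_lt with h | h
    · refine ⟨r + 1, by linarith, fun s hs h1 _ => ?_⟩
      rw [show s = r by linarith [hs.2], ← hv, ← hΩv]
      exact hb
    · obtain ⟨t, ht0, ht1, ht⟩ := exists_minArea_lt hΩ (isCompact_closedBall 0 (1 / 2))
        (convex_closedBall 0 _) CW_closedBall hb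
      have hlt := circR_mix_closedBall_lt hΩ (by linarith) ht0 ht1
      refine ⟨1 - circR (mix t Ω (closedBall 0 (1 / 2))), by linarith, fun s hs h1 h2 =>
        ht s hs ?_⟩
      rw [Set.uIcc_of_ge hlt.le]
      constructor <;> linarith
  have hdown : ∃ lo < r, ∀ s ∈ inradii, lo < s → s ≤ r → minArea s < b := by
    rcases hr.1.eq_or_lt with h | h
    · refine ⟨r - 1, by linarith, fun s hs _ h1 => ?_⟩
      rw [show s = r by linarith [hs.1], ← hv, ← hΩv]
      exact hb
    · obtain ⟨K, hKc, hKconv, hK, hgrow⟩ := exists_growing_body hΩ (by linarith)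
      obtain ⟨t, ht0, ht1, ht⟩ := exists_minArea_lt hΩ hKc hKconv hK hb
      have hlt := hgrow t ht0 ht1
      refine ⟨1 - circR (mix t Ω K), by linarith, fun s hs h1 h2 => ht s hs ?_⟩
      rw [Set.uIcc_of_le hlt.le]
      constructor <;> linarith
  obtain ⟨hi, hhi, hup⟩ := hup
  obtain ⟨lo, hlo, hdown⟩ := hdown
  filter_upwards [self_mem_nhdsWithin, mem_nhdsWithin_of_mem_nhds (Ioo_mem_nhds hlo hhi)]
    with s hs hsI
  rcases le_total r s with h | h
  · exact hup s hs h hsI.2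
  · exact hdown s hs hsI.1 h

theorem continuousOn_minArea (hne : ∀ r ∈ inradii, (admissible r).Nonempty) :
    ContinuousOn minArea inradii := fun _ hr =>
  tendsto_order.mpr ⟨fun _ ha => eventually_lt_minArea hne hr ha,
    fun _ hb => eventually_minArea_lt hne hr hb⟩

end ConstWidth

/-! ### Bodies of constant width from a radius of curvature -/

namespace ConstWidth

open Filter Topology

/-- The unit vector `(cos θ, sin θ)`. -/
noncomputable def cis (θ : ℝ) : ℂ := Complex.exp (θ * Complex.I)

theorem norm_cis (θ : ℝ) : ‖cis θ‖ = 1 := Complex.norm_exp_ofReal_mul_I θ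

theorem cis_zero : cis 0 = 1 := by simp [cis]

theorem cis_add (a b : ℝ) : cis (a + b) = cis a * cis b := by
  rw [cis, cis, cis, ← Complex.exp_add]
  push_cast
  ring_nf

theorem cis_add_pi (θ : ℝ) : cis (θ + Real.pi) = -cis θ := by
  rw [cis_add]
  simp [cis, Complex.exp_pi_mul_I]

theorem cis_add_int_mul_two_pi (θ : ℝ) (k : ℤ) : cis (θ + k * (2 * Real.pi)) = cis θ := by
  rw [cis_add]
  have : cis (k * (2 * Real.pi)) = 1 := by
    rw [cis, ← Complex.exp_int_mul_two_pi_mul_I k]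
    push_cast
    ring_nf
  rw [this, mul_one]

theorem cis_re (θ : ℝ) : (cis θ).re = Real.cos θ := Complex.exp_ofReal_mul_I_re θ

theorem cis_im (θ : ℝ) : (cis θ).im = Real.sin θ := Complex.exp_ofReal_mul_I_im θ

theorem continuous_cis : Continuous cis := by unfold cis; fun_prop

theorem inner_cis_cis (a b : ℝ) : inner ℝ (cis a) (cis b) = Real.cos (b - a) := by
  rw [Complex.inner]
  simp only [Complex.mul_re, Complex.conj_re, Complex.conj_im, cis_re, cis_im]
  rw [Real.cos_sub]
  ring

theorem inner_cis_I_mul_cis (a b : ℝ) :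
    inner ℝ (cis a) (Complex.I * cis b) = -Real.sin (b - a) := by
  rw [Complex.inner]
  simp only [Complex.mul_re, Complex.mul_im, Complex.conj_re, Complex.conj_im, cis_re, cis_im,
    Complex.I_re, Complex.I_im]
  rw [Real.sin_sub]
  ring

theorem hasDerivAt_cis (θ : ℝ) : HasDerivAt cis (Complex.I * cis θ) θ := by
  have h1 : HasDerivAt (fun s : ℝ => (s : ℂ) * Complex.I) (1 * Complex.I) θ :=
    (Complex.ofRealCLM.hasDerivAt).mul_const Complex.I
  have := h1.cexp
  unfold cis
  convert this using 1
  ring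

theorem integral_I_mul_cis (a b : ℝ) :
    ∫ s in a..b, Complex.I * cis s = cis b - cis a :=
  intervalIntegral.integral_eq_sub_of_hasDerivAt (fun s _ => hasDerivAt_cis s)
    ((continuous_const.mul continuous_cis).intervalIntegrable _ _)

theorem exists_cis_eq {u : ℂ} (hu : ‖u‖ = 1) : ∃ θ : ℝ, u = cis θ := by
  refine ⟨u.arg, ?_⟩
  have := Complex.norm_mul_exp_arg_mul_I u
  rw [hu] at this
  simpa [cis] using this.symm

/-- The closed curve with unit normal `cis θ` and radius of curvature `ρ θ` at the parameter `θ`. -/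
noncomputable def curve (c : ℂ) (ρ : ℝ → ℝ) (θ : ℝ) : ℂ :=
  c + ∫ s in (0 : ℝ)..θ, ρ s • (Complex.I * cis s)

/-- The conditions on a radius of curvature under which it belongs to a body of constant
width `1`. -/
structure IsProfile (c : ℂ) (ρ : ℝ → ℝ) : Prop where
  measurable : Measurable ρ
  nonneg : ∀ s, 0 ≤ ρ s
  le_one : ∀ s, ρ s ≤ 1
  add_pi : ∀ s, ρ (s + Real.pi) = 1 - ρ s
  closed : curve c ρ 0 - curve c ρ Real.pi = 1

namespace IsProfile

variable {c : ℂ} {ρ : ℝ → ℝ}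

theorem intervalIntegrable (h : IsProfile c ρ) (a b : ℝ) :
    IntervalIntegrable (fun s => ρ s • (Complex.I * cis s)) volume a b := by
  refine (intervalIntegrable_const (c := (1 : ℝ)) (μ := volume)).mono_fun ?_ ?_
  · exact (h.measurable.smul (measurable_const.mul continuous_cis.measurable)).aestronglyMeasurable
  · refine Eventually.of_forall fun s => ?_
    simp only [norm_smul, norm_mul, Complex.norm_I, norm_cis, Real.norm_eq_abs, mul_one,
      abs_of_nonneg (h.nonneg s), abs_one]
    exact h.le_one s

theorem curve_sub (h : IsProfile c ρ) (a b : ℝ) :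
    curve c ρ b - curve c ρ a = ∫ s in a..b, ρ s • (Complex.I * cis s) := by
  rw [curve, curve, add_sub_add_left_eq_sub,
    intervalIntegral.integral_interval_sub_left (h.intervalIntegrable _ _)
      (h.intervalIntegrable _ _)]

theorem continuous (h : IsProfile c ρ) : Continuous (curve c ρ) :=
  continuous_const.add (intervalIntegral.continuous_primitive
    (fun a b => h.intervalIntegrable a b) 0)

/-- As `ρ (s + π) = 1 - ρ s`, the increments of the curve and of its antipode differ by those of
`cis`; the field `closed` fixes the constant at `θ = 0`. -/
theorem curve_add_pi (h : IsProfile c ρ) (θ : ℝ) :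
    curve c ρ (θ + Real.pi) = curve c ρ θ - cis θ := by
  have h1 := h.curve_sub (0 + Real.pi) (θ + Real.pi)
  rw [← intervalIntegral.integral_comp_add_right] at h1
  have h2 : ∀ s, ρ (s + Real.pi) • (Complex.I * cis (s + Real.pi)) =
      ρ s • (Complex.I * cis s) - Complex.I * cis s := by
    intro s
    rw [h.add_pi, cis_add_pi]
    simp only [Complex.real_smul]
    push_cast
    ring
  simp only [h2] at h1
  have h3 : IntervalIntegrable (fun s => Complex.I * cis s) volume 0 θ :=
    (continuous_const.mul continuous_cis).intervalIntegrable _ _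
  rw [intervalIntegral.integral_sub (h.intervalIntegrable _ _) h3, integral_I_mul_cis,
    ← h.curve_sub, cis_zero, zero_add] at h1
  linear_combination h1 - h.closed

theorem curve_add_two_pi (h : IsProfile c ρ) (θ : ℝ) :
    curve c ρ (θ + 2 * Real.pi) = curve c ρ θ := by
  rw [show θ + 2 * Real.pi = θ + Real.pi + Real.pi by ring, h.curve_add_pi, h.curve_add_pi,
    cis_add_pi]
  ring

theorem curve_add_int_mul (h : IsProfile c ρ) (θ : ℝ) (k : ℤ) :
    curve c ρ (θ + k * (2 * Real.pi)) = curve c ρ θ :=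
  Function.Periodic.int_mul (f := curve c ρ) (c := 2 * Real.pi) h.curve_add_two_pi k θ

theorem inner_curve_sub (h : IsProfile c ρ) (θ a b : ℝ) :
    inner ℝ (cis θ) (curve c ρ b - curve c ρ a) = ∫ s in a..b, ρ s * -Real.sin (s - θ) := by
  rw [h.curve_sub]
  have := (innerSL ℝ (cis θ)).intervalIntegral_comp_comm (h.intervalIntegrable a b)
  simp only [innerSL_apply_apply] at this
  rw [← this]
  simp only [real_inner_smul_right, inner_cis_I_mul_cis]

/-- Moving away from the direction `θ` the curve descends. -/
theorem inner_curve_le_right (h : IsProfile c ρ) {θ a b : ℝ} (ha : θ ≤ a) (hab : a ≤ b)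
    (hb : b ≤ θ + Real.pi) :
    inner ℝ (cis θ) (curve c ρ b) ≤ (inner ℝ (cis θ) (curve c ρ a) : ℝ) := by
  rw [← sub_nonneg, ← inner_sub_right, h.inner_curve_sub, intervalIntegral.integral_symm,
    ← intervalIntegral.integral_neg]
  refine intervalIntegral.integral_nonneg hab fun s hs => ?_
  have := Real.sin_nonneg_of_nonneg_of_le_pi (x := s - θ) (by linarith [hs.1]) (by linarith [hs.2])
  nlinarith [h.nonneg s]

theorem inner_curve_le_left (h : IsProfile c ρ) {θ a : ℝ} (ha : θ - Real.pi ≤ a) (haθ : a ≤ θ) :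
    inner ℝ (cis θ) (curve c ρ a) ≤ (inner ℝ (cis θ) (curve c ρ θ) : ℝ) := by
  rw [← sub_nonneg, ← inner_sub_right, h.inner_curve_sub]
  refine intervalIntegral.integral_nonneg haθ fun s hs => ?_
  have := Real.sin_nonpos_of_nonpos_of_neg_pi_le (x := s - θ) (by linarith [hs.2])
    (by linarith [hs.1])
  nlinarith [h.nonneg s]

theorem inner_curve_le (h : IsProfile c ρ) (θ φ : ℝ) :
    inner ℝ (cis θ) (curve c ρ φ) ≤ (inner ℝ (cis θ) (curve c ρ θ) : ℝ) := by
  -- By periodicity `φ` may be taken within `π` of `θ`, where the height in direction `θ` is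
  -- monotone on either side.
  obtain ⟨k, hk, -⟩ := existsUnique_add_zsmul_mem_Ico Real.two_pi_pos φ (θ - Real.pi)
  rw [zsmul_eq_mul] at hk
  rw [← h.curve_add_int_mul φ k]
  rcases le_total (φ + k * (2 * Real.pi)) θ with hle | hle
  · exact h.inner_curve_le_left hk.1 hle
  · exact h.inner_curve_le_right le_rfl hle (by linarith [hk.2])

/-- The range of the curve is the image of one period. -/
theorem range_eq (h : IsProfile c ρ) :
    Set.range (curve c ρ) = curve c ρ '' Set.Icc 0 (2 * Real.pi) := by
  refine Set.Subset.antisymm ?_ (Set.image_subset_range _ _)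
  rintro _ ⟨θ, rfl⟩
  obtain ⟨k, hk, -⟩ := existsUnique_add_zsmul_mem_Ico Real.two_pi_pos θ 0
  rw [zsmul_eq_mul, zero_add] at hk
  exact ⟨_, ⟨hk.1, hk.2.le⟩, h.curve_add_int_mul θ k⟩

end IsProfile

/-- The body bounded by the curve. -/
noncomputable def curveBody (c : ℂ) (ρ : ℝ → ℝ) : Set ℂ :=
  closure (convexHull ℝ (Set.range (curve c ρ)))

namespace IsProfile

variable {c : ℂ} {ρ : ℝ → ℝ}

theorem curve_mem (θ : ℝ) : curve c ρ θ ∈ curveBody c ρ :=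
  subset_closure (subset_convexHull ℝ _ ⟨θ, rfl⟩)

theorem convex_curveBody : Convex ℝ (curveBody c ρ) := (convex_convexHull ℝ _).closure

theorem isCompact_curveBody (h : IsProfile c ρ) : IsCompact (curveBody c ρ) := by
  have : Bornology.IsBounded (Set.range (curve c ρ)) := by
    rw [h.range_eq]
    exact (isCompact_Icc.image h.continuous).isBounded
  exact isCompact_of_isClosed_isBounded isClosed_closure
    ((isBounded_convexHull.mpr this).closure)

theorem curveBody_subset_closedBall {O : ℂ} {R : ℝ}
    (hR : ∀ θ, curve c ρ θ ∈ closedBall O R) : curveBody c ρ ⊆ closedBall O R := by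
  refine closure_minimal (convexHull_min ?_ (convex_closedBall O R)) isClosed_closedBall
  rintro _ ⟨θ, rfl⟩
  exact hR θ

theorem inner_le (h : IsProfile c ρ) (θ : ℝ) {z : ℂ} (hz : z ∈ curveBody c ρ) :
    inner ℝ (cis θ) z ≤ (inner ℝ (cis θ) (curve c ρ θ) : ℝ) := by
  have : curveBody c ρ ⊆ {z | inner ℝ (cis θ) z ≤ (inner ℝ (cis θ) (curve c ρ θ) : ℝ)} := by
    refine closure_minimal (convexHull_min ?_ ?_) ?_
    · rintro _ ⟨φ, rfl⟩
      exact h.inner_curve_le θ φ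
    · exact convex_halfSpace_le (innerSL ℝ (cis θ)).toLinearMap.isLinear _
    · exact isClosed_le (by fun_prop) continuous_const
  exact this hz

/-- The support points at `θ` and `θ + π` differ by `cis θ`: they are the required chord, and they
confine the body to a strip of width 1. -/
theorem cw_curveBody (h : IsProfile c ρ) : CW (curveBody c ρ) := by
  constructor
  · intro x hx y hy
    obtain ⟨u, hu, hxy⟩ := exists_norm_eq_one_smul (x - y)
    obtain ⟨θ, rfl⟩ := exists_cis_eq hu
    have h1 := h.inner_le θ hx
    have h2 := h.inner_le (θ + Real.pi) hy
    rw [h.curve_add_pi, cis_add_pi, inner_neg_left, inner_neg_left, inner_sub_right,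
      real_inner_self_eq_norm_sq, norm_cis] at h2
    have h3 : inner ℝ (cis θ) (x - y) = ‖x - y‖ := by
      conv_lhs => rw [hxy]
      rw [real_inner_smul_right, real_inner_self_eq_norm_sq, norm_cis]
      ring
    rw [inner_sub_right] at h3
    linarith
  · intro u hu
    obtain ⟨θ, rfl⟩ := exists_cis_eq hu
    refine ⟨curve c ρ θ, curve_mem θ, ?_⟩
    rw [← h.curve_add_pi]
    exact curve_mem _

end IsProfile

theorem notMem_interior_of_inner_le {K : Set ℂ} {u z : ℂ} (hu : ‖u‖ = 1)
    (h : ∀ w ∈ K, inner ℝ u w ≤ (inner ℝ u z : ℝ)) : z ∉ interior K := by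
  intro hint
  obtain ⟨ε, hε, hball⟩ := Metric.isOpen_iff.mp isOpen_interior _ hint
  have hmem : z + (ε / 2) • u ∈ K := by
    refine interior_subset (hball ?_)
    rw [mem_ball, dist_eq_norm, add_sub_cancel_left, norm_smul, hu, mul_one,
      Real.norm_of_nonneg (by positivity)]
    linarith
  have := h _ hmem
  rw [inner_add_right, real_inner_smul_right, real_inner_self_eq_norm_sq, hu] at this
  linarith

/-- A boundary point of a convex body has a supporting direction. -/
theorem exists_support_direction {Ω : Set ℂ} (hΩ : IsConvexBody Ω) {z : ℂ}
    (hz : z ∈ frontier Ω) : ∃ u : ℂ, ‖u‖ = 1 ∧ ∀ w ∈ Ω, inner ℝ u w ≤ (inner ℝ u z : ℝ) := by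
  obtain ⟨hcomp, hconv, hint⟩ := hΩ
  obtain ⟨f, hf⟩ := geometric_hahn_banach_open_point hconv.interior isOpen_interior hz.2
  obtain ⟨v, rfl⟩ := (InnerProductSpace.toDual ℝ ℂ).surjective f
  simp only [InnerProductSpace.toDual_apply_apply] at hf
  obtain ⟨u, hu, hvu⟩ := exists_norm_eq_one_smul v
  have hv : 0 < ‖v‖ := by
    rw [norm_pos_iff]
    rintro rfl
    obtain ⟨w, hw⟩ := hint
    simpa using hf w hw
  refine ⟨u, hu, fun w hw => ?_⟩
  have hle : Ω ⊆ {w | inner ℝ v w ≤ (inner ℝ v z : ℝ)} := by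
    have h1 : closure (interior Ω) ⊆ {w | inner ℝ v w ≤ (inner ℝ v z : ℝ)} :=
      closure_minimal (fun w hw => (hf w hw).le) (isClosed_le (by fun_prop) continuous_const)
    rw [hconv.closure_interior_eq_closure_of_nonempty_interior hint] at h1
    exact subset_closure.trans h1
  have h2 : inner ℝ v w ≤ (inner ℝ v z : ℝ) := hle hw
  rw [hvu, real_inner_smul_left, real_inner_smul_left] at h2
  exact le_of_mul_le_mul_left h2 hv

/-- A boundary point supported in direction `θ` is at height at least 1 above `curve (θ + π)` and at
distance at most 1 from it, so it is `curve θ`. -/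
theorem IsProfile.frontier_curveBody {c : ℂ} {ρ : ℝ → ℝ} (h : IsProfile c ρ)
    (hb : IsConvexBody (curveBody c ρ)) : frontier (curveBody c ρ) = Set.range (curve c ρ) := by
  apply Set.Subset.antisymm
  · intro z hz
    obtain ⟨u, hu, hsupp⟩ := exists_support_direction hb hz
    obtain ⟨θ, rfl⟩ := exists_cis_eq hu
    have hzΩ : z ∈ curveBody c ρ := hb.1.isClosed.frontier_subset hz
    have h1 := hsupp _ (curve_mem θ)
    have h2 : z - curve c ρ (θ + Real.pi) = cis θ := by
      refine eq_of_inner_ge_one hu (h.cw_curveBody.diam _ hzΩ _ (curve_mem _)) ?_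
      rw [h.curve_add_pi, inner_sub_right, inner_sub_right, real_inner_self_eq_norm_sq, norm_cis]
      linarith
    refine ⟨θ, ?_⟩
    rw [h.curve_add_pi] at h2
    linear_combination -h2
  · rintro _ ⟨θ, rfl⟩
    exact ⟨subset_closure (curve_mem θ),
      notMem_interior_of_inner_le (norm_cis θ) fun _ => h.inner_le θ⟩

end ConstWidth

/-! ### Reuleaux polygons from their break angles -/

namespace ConstWidth

open Filter Topology

/-- The angles `t j` at which the boundary of a Reuleaux polygon with `2 * N + 1` sides passes from
an arc (`[t j, t (j + 1)]` with `j` even) to a vertex (`j` odd) or conversely, and the corresponding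
vertices: `Q j` is the centre of the arc for `j` even, the vertex itself for `j` odd. -/
structure IsBreaks (N : ℕ) (t : ℤ → ℝ) (Q : ℤ → ℂ) : Prop where
  strictMono : StrictMono t
  t_zero : t 0 = 0
  t_add : ∀ j, t (j + (2 * N + 1)) = t j + Real.pi
  Q_add : ∀ j, Q (j + (2 * N + 1)) = Q j
  Q_even : ∀ j, Even j → Q (j + 1) = Q j + cis (t (j + 1))
  Q_odd : ∀ j, ¬Even j → Q (j + 1) = Q j - cis (t (j + 1))

open Classical in
/-- The radius of curvature belonging to the angles `t`. -/
noncomputable def stepProfile (t : ℤ → ℝ) (s : ℝ) : ℝ :=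
  if ∃ j : ℤ, Even j ∧ s ∈ Set.Ico (t j) (t (j + 1)) then 1 else 0

theorem eq_of_mem_Ico_of_mem_Ico {t : ℤ → ℝ} (ht : StrictMono t) {s : ℝ} {i j : ℤ}
    (hi : s ∈ Set.Ico (t i) (t (i + 1))) (hj : s ∈ Set.Ico (t j) (t (j + 1))) : i = j := by
  have h1 : i < j + 1 := ht.lt_iff_lt.mp (hi.1.trans_lt hj.2)
  have h2 : j < i + 1 := ht.lt_iff_lt.mp (hj.1.trans_lt hi.2)
  omega

theorem stepProfile_even {t : ℤ → ℝ} {s : ℝ} {j : ℤ} (hj : Even j)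
    (hs : s ∈ Set.Ico (t j) (t (j + 1))) : stepProfile t s = 1 := if_pos ⟨j, hj, hs⟩

theorem stepProfile_odd {t : ℤ → ℝ} (ht : StrictMono t) {s : ℝ} {j : ℤ} (hj : ¬Even j)
    (hs : s ∈ Set.Ico (t j) (t (j + 1))) : stepProfile t s = 0 := by
  refine if_neg ?_
  rintro ⟨i, hi, his⟩
  exact hj (eq_of_mem_Ico_of_mem_Ico ht his hs ▸ hi)

theorem stepProfile_mem (t : ℤ → ℝ) (s : ℝ) : stepProfile t s = 0 ∨ stepProfile t s = 1 := by
  unfold stepProfile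
  split_ifs <;> simp

theorem measurable_stepProfile (t : ℤ → ℝ) : Measurable (stepProfile t) := by
  refine Measurable.ite ?_ measurable_const measurable_const
  have : {s | ∃ j : ℤ, Even j ∧ s ∈ Set.Ico (t j) (t (j + 1))} =
      ⋃ j : ℤ, ⋃ _ : Even j, Set.Ico (t j) (t (j + 1)) := by
    ext s
    simp only [Set.mem_iUnion, exists_prop]
    rfl
  rw [this]
  exact MeasurableSet.iUnion fun j => MeasurableSet.iUnion fun _ => measurableSet_Ico

namespace IsBreaks

variable {N : ℕ} {t : ℤ → ℝ} {Q : ℤ → ℂ}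

theorem t_add_mul (h : IsBreaks N t Q) (j k : ℤ) :
    t (j + k * (2 * N + 1)) = t j + k * Real.pi := by
  induction k using Int.induction_on with
  | zero => simp
  | succ k ih =>
    rw [show j + ((k : ℤ) + 1) * (2 * N + 1) = j + k * (2 * N + 1) + (2 * N + 1) by ring, h.t_add,
      ih]
    push_cast
    ring
  | pred k ih =>
    have := h.t_add (j + (-(k : ℤ) - 1) * (2 * N + 1))
    rw [show j + (-(k : ℤ) - 1) * (2 * N + 1) + (2 * N + 1) = j + -(k : ℤ) * (2 * N + 1) by ring,
      ih] at this
    push_cast at this ⊢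
    linarith

theorem Q_add_mul (h : IsBreaks N t Q) (j k : ℤ) : Q (j + k * (2 * N + 1)) = Q j :=
  Function.Periodic.int_mul (f := Q) (c := (2 * N + 1 : ℤ)) h.Q_add k j

theorem exists_mem_Ico (h : IsBreaks N t Q) (s : ℝ) :
    ∃ j : ℤ, s ∈ Set.Ico (t j) (t (j + 1)) := by
  obtain ⟨k, hk⟩ := exists_int_gt (s / Real.pi)
  obtain ⟨m, hm⟩ := exists_int_lt (s / Real.pi)
  rw [div_lt_iff₀ Real.pi_pos] at hk
  rw [lt_div_iff₀ Real.pi_pos] at hm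
  have hk' := h.t_add_mul 0 k
  have hm' := h.t_add_mul 0 m
  rw [h.t_zero, zero_add, zero_add] at hk' hm'
  obtain ⟨j, hj, hmax⟩ := Int.exists_greatest_of_bdd (P := fun j => t j ≤ s)
    ⟨k * (2 * N + 1), fun z hz => by
      refine (h.strictMono.lt_iff_lt.mp ?_).le
      rw [hk']
      exact hz.trans_lt hk⟩
    ⟨m * (2 * N + 1), by rw [hm']; exact hm.le⟩
  refine ⟨j, hj, not_le.mp fun hle => ?_⟩
  have := hmax _ hle
  omega

/-- A shift by `π` shifts the index by the odd number `2 * N + 1` and so exchanges arcs and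
vertices. -/
theorem stepProfile_add_pi (h : IsBreaks N t Q) (s : ℝ) :
    stepProfile t (s + Real.pi) = 1 - stepProfile t s := by
  obtain ⟨j, hj⟩ := h.exists_mem_Ico s
  have hj' : s + Real.pi ∈ Set.Ico (t (j + (2 * N + 1))) (t (j + (2 * N + 1) + 1)) := by
    rw [show j + (2 * (N : ℤ) + 1) + 1 = j + 1 + (2 * N + 1) by ring, h.t_add, h.t_add]
    exact ⟨by linarith [hj.1], by linarith [hj.2]⟩
  by_cases he : Even j
  · rw [stepProfile_even he hj, stepProfile_odd h.strictMono (by grind) hj', sub_self]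
  · rw [stepProfile_odd h.strictMono he hj, stepProfile_even (by grind) hj', sub_zero]

/-- The boundary curve. -/
noncomputable def bdry (t : ℤ → ℝ) (Q : ℤ → ℂ) : ℝ → ℂ := curve (Q 0 + 1) (stepProfile t)

/-- The Reuleaux polygon. -/
noncomputable def body (t : ℤ → ℝ) (Q : ℤ → ℂ) : Set ℂ := curveBody (Q 0 + 1) (stepProfile t)

theorem intervalIntegrable (t : ℤ → ℝ) (a b : ℝ) :
    IntervalIntegrable (fun s => stepProfile t s • (Complex.I * cis s)) volume a b := by
  refine (intervalIntegrable_const (c := (1 : ℝ)) (μ := volume)).mono_fun ?_ ?_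
  · exact ((measurable_stepProfile t).smul
      (measurable_const.mul continuous_cis.measurable)).aestronglyMeasurable
  · refine Eventually.of_forall fun s => ?_
    rcases stepProfile_mem t s with hs | hs <;> simp [hs, norm_cis]

theorem bdry_sub (t : ℤ → ℝ) (Q : ℤ → ℂ) (a b : ℝ) :
    bdry t Q b - bdry t Q a = ∫ s in a..b, stepProfile t s • (Complex.I * cis s) := by
  rw [bdry, curve, curve, add_sub_add_left_eq_sub,
    intervalIntegral.integral_interval_sub_left (intervalIntegrable _ _ _)
      (intervalIntegrable _ _ _)]

theorem bdry_sub_even {j : ℤ} (hj : Even j) {θ : ℝ}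
    (hθ : θ ∈ Set.Icc (t j) (t (j + 1))) : bdry t Q θ - bdry t Q (t j) = cis θ - cis (t j) := by
  rw [bdry_sub, ← integral_I_mul_cis]
  refine intervalIntegral.integral_congr_Ioo_of_le hθ.1 fun s hs => ?_
  rw [stepProfile_even hj ⟨hs.1.le, hs.2.trans_le hθ.2⟩, one_smul]

theorem bdry_sub_odd (h : IsBreaks N t Q) {j : ℤ} (hj : ¬Even j) {θ : ℝ}
    (hθ : θ ∈ Set.Icc (t j) (t (j + 1))) : bdry t Q θ = bdry t Q (t j) := by
  rw [← sub_eq_zero, bdry_sub, ← intervalIntegral.integral_zero (a := t j) (b := θ) (μ := volume)]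
  refine intervalIntegral.integral_congr_Ioo_of_le hθ.1 fun s hs => ?_
  rw [stepProfile_odd h.strictMono hj ⟨hs.1.le, hs.2.trans_le hθ.2⟩, zero_smul]

theorem bdry_t (h : IsBreaks N t Q) (j : ℤ) :
    (Even j → bdry t Q (t j) = Q j + cis (t j)) ∧ (¬Even j → bdry t Q (t j) = Q j) := by
  have hstep : ∀ j, t (j + 1) ∈ Set.Icc (t j) (t (j + 1)) := fun j =>
    ⟨(h.strictMono (by omega)).le, le_rfl⟩
  induction j using Int.induction_on with
  | zero =>
    refine ⟨fun _ => ?_, fun hn => absurd (by simp) hn⟩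
    rw [h.t_zero, cis_zero, bdry, curve, intervalIntegral.integral_same, add_zero]
  | succ k ih =>
    constructor
    · intro he
      have ho : ¬Even (k : ℤ) := by grind
      rw [h.bdry_sub_odd ho (hstep _), ih.2 ho, h.Q_odd _ ho]
      ring
    · intro ho
      have he : Even (k : ℤ) := by grind
      have := bdry_sub_even (Q := Q) he (hstep _)
      rw [ih.1 he] at this
      rw [h.Q_even _ he]
      linear_combination this
  | pred k ih =>
    have e1 : -(k : ℤ) - 1 + 1 = -k := by ring
    have hs := hstep (-(k : ℤ) - 1)
    have hQe := h.Q_even (-(k : ℤ) - 1)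
    have hQo := h.Q_odd (-(k : ℤ) - 1)
    rw [e1] at hs hQe hQo
    constructor
    · intro he
      have ho : ¬Even (-(k : ℤ)) := by grind
      have := bdry_sub_even (Q := Q) he (by rw [e1]; exact hs)
      rw [ih.2 ho, hQe he] at this
      linear_combination -this
    · intro ho
      have he : Even (-(k : ℤ)) := by grind
      rw [← h.bdry_sub_odd ho (by rw [e1]; exact hs), ih.1 he, hQo ho]
      ring

theorem bdry_even (h : IsBreaks N t Q) {j : ℤ} (hj : Even j) {θ : ℝ}
    (hθ : θ ∈ Set.Icc (t j) (t (j + 1))) : bdry t Q θ = Q j + cis θ := by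
  have := bdry_sub_even (Q := Q) hj hθ
  rw [(h.bdry_t j).1 hj] at this
  linear_combination this

theorem bdry_odd (h : IsBreaks N t Q) {j : ℤ} (hj : ¬Even j) {θ : ℝ}
    (hθ : θ ∈ Set.Icc (t j) (t (j + 1))) : bdry t Q θ = Q j := by
  rw [h.bdry_sub_odd hj hθ, (h.bdry_t j).2 hj]

theorem isProfile (h : IsBreaks N t Q) : IsProfile (Q 0 + 1) (stepProfile t) where
  measurable := measurable_stepProfile t
  nonneg s := by rcases stepProfile_mem t s with hs | hs <;> simp [hs]
  le_one s := by rcases stepProfile_mem t s with hs | hs <;> simp [hs]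
  add_pi := h.stepProfile_add_pi
  closed := by
    have h1 := (h.bdry_t 0).1 (by simp)
    have h2 := (h.bdry_t (0 + (2 * N + 1))).2 (by grind)
    rw [h.t_zero, cis_zero, bdry] at h1
    rw [h.t_add, h.Q_add, h.t_zero, zero_add, bdry] at h2
    rw [h1, h2]
    ring

theorem Q_prev_even (h : IsBreaks N t Q) {j : ℤ} (hj : Even j) : Q (j - 1) = Q j + cis (t j) := by
  have := h.Q_odd (j - 1) (by grind)
  rw [sub_add_cancel] at this
  rw [this]
  ring

/-- Seen in direction `t i`, the curve strictly descends along the arc over `[t (i + 1), t (i + 2)]`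
and does not rise again up to the angle `t i + π`. -/
theorem Q_ne (h : IsBreaks N t Q) {i j : ℤ} (hi : ¬Even i) (hij : i + 2 ≤ j)
    (hj : ¬Even j) (hjn : j ≤ i + (2 * N + 1)) : Q i ≠ Q j := by
  intro heq
  have hmono := h.strictMono.monotone
  have h0 : t i < t (i + 1) := h.strictMono (by omega)
  have h1 : t (i + 1) < t (i + 2) := h.strictMono (by omega)
  have h2 : t (i + 2) ≤ t j := hmono hij
  have h3 : t j ≤ t i + Real.pi := by rw [← h.t_add]; exact hmono hjn
  have hv := h.bdry_odd hi (θ := t i) ⟨le_rfl, h0.le⟩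
  have hv1 := h.bdry_odd hi (θ := t (i + 1)) ⟨h0.le, le_rfl⟩
  have hvj := h.bdry_odd hj (θ := t j) ⟨le_rfl, hmono (by omega)⟩
  have harc := bdry_sub_even (t := t) (Q := Q) (j := i + 1) (by grind) (θ := t (i + 2))
    ⟨h1.le, by rw [show i + 1 + 1 = i + 2 by ring]⟩
  have hdesc := h.isProfile.inner_curve_le_right (θ := t i) (a := t (i + 2)) (b := t j)
    (by linarith) h2 h3
  change inner ℝ (cis (t i)) (bdry t Q (t j)) ≤ inner ℝ (cis (t i)) (bdry t Q (t (i + 2))) at hdesc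
  rw [hvj, ← heq, ← hv1, ← sub_nonneg, ← inner_sub_right, harc, inner_sub_right, inner_cis_cis,
    inner_cis_cis] at hdesc
  have := Real.cos_lt_cos_of_nonneg_of_le_pi (x := t (i + 1) - t i) (y := t (i + 2) - t i)
    (by linarith) (by linarith) (by linarith)
  linarith

theorem exists_of_Q_eq (h : IsBreaks N t Q) {i j : ℤ} (hi : ¬Even i) (hj : ¬Even j)
    (heq : Q i = Q j) : ∃ k : ℤ, j = i + k * (2 * N + 1) := by
  have hn : (0 : ℤ) < 2 * (2 * N + 1) := by positivity
  -- Only the difference modulo `2 * (2 * N + 1)` matters. A remainder beyond half this period is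
  -- compared with the next copy of `i` instead of `i` itself.
  obtain ⟨d, m, hd0, hdn, hdm⟩ : ∃ d m : ℤ, 0 ≤ d ∧ d < 2 * (2 * N + 1) ∧
      j = i + d + m * (2 * (2 * N + 1)) := by
    refine ⟨(j - i) % (2 * (2 * N + 1)), (j - i) / (2 * (2 * N + 1)), Int.emod_nonneg _ hn.ne',
      Int.emod_lt_of_pos _ hn, ?_⟩
    have := Int.emod_add_mul_ediv (j - i) (2 * (2 * N + 1))
    linear_combination -this
  have hde : Even d := by grind
  have hQ : Q (i + d) = Q i := by
    rw [heq, hdm, show i + d + m * (2 * (2 * (N : ℤ) + 1)) = i + d + 2 * m * (2 * N + 1) by ring,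
      h.Q_add_mul]
  rcases hd0.eq_or_lt with h0 | h0
  · exact ⟨2 * m, by rw [hdm, ← h0]; ring⟩
  rcases le_or_gt d (2 * N + 1) with hle | hgt
  · exact absurd hQ.symm (h.Q_ne hi (by grind) (by grind) (by omega))
  · have h2 : Q (i + 2 * (2 * N + 1)) = Q i := by rw [h.Q_add_mul]
    exact absurd (hQ.trans h2.symm) (h.Q_ne (by grind) (by grind) (by grind) (by omega))

/-- The even representative of `j` modulo `2 * N + 1`. -/
def evenRep (N : ℕ) (j : ℤ) : ℤ := if Even j then j else j + (2 * N + 1)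

theorem even_evenRep (N : ℕ) (j : ℤ) : Even (evenRep N j) := by
  unfold evenRep
  split_ifs with hj
  · exact hj
  · grind

theorem Q_evenRep (h : IsBreaks N t Q) (j : ℤ) : Q (evenRep N j) = Q j := by
  unfold evenRep
  split_ifs
  · rfl
  · exact h.Q_add j

/-- The vertices of the polygon. -/
def vert (N : ℕ) (Q : ℤ → ℂ) (k : ZMod (2 * N + 1)) : ℂ := Q (-(k.val : ℤ))

/-- The angle at which the side opposite to `vert N Q k` begins. -/
def angleα (N : ℕ) (t : ℤ → ℝ) (k : ZMod (2 * N + 1)) : ℝ := t (evenRep N (-(k.val : ℤ)))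

/-- The angle at which the side opposite to `vert N Q k` ends. -/
def angleβ (N : ℕ) (t : ℤ → ℝ) (k : ZMod (2 * N + 1)) : ℝ := t (evenRep N (-(k.val : ℤ)) + 1)

theorem exists_val_intCast (N : ℕ) (j : ℤ) :
    ∃ m : ℤ, (((j : ZMod (2 * N + 1)).val : ℕ) : ℤ) = j + m * (2 * N + 1) := by
  refine ⟨-(j / (2 * N + 1)), ?_⟩
  rw [ZMod.val_intCast]
  push_cast
  linear_combination Int.emod_add_mul_ediv j (2 * N + 1)

/-- The sign reverses the order of the vertices: the arc about `Q j` begins at `Q (j - 1)`, whereas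
the side opposite to `P k` has to begin at `P (k + 1)`. -/
theorem vert_intCast (h : IsBreaks N t Q) (j : ℤ) : vert N Q (j : ZMod (2 * N + 1)) = Q (-j) := by
  obtain ⟨m, hm⟩ := exists_val_intCast N j
  rw [vert, hm, show -(j + m * (2 * (N : ℤ) + 1)) = -j + -m * (2 * N + 1) by ring, h.Q_add_mul]

theorem len_evenRep (h : IsBreaks N t Q) (j : ℤ) :
    t (evenRep N j + 1) - t (evenRep N j) = t (j + 1) - t j := by
  unfold evenRep
  split_ifs
  · rfl
  · rw [show j + (2 * (N : ℤ) + 1) + 1 = j + 1 + (2 * N + 1) by ring, h.t_add, h.t_add]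
    ring

theorem len_intCast (h : IsBreaks N t Q) (j : ℤ) :
    angleβ N t (j : ZMod (2 * N + 1)) - angleα N t (j : ZMod (2 * N + 1)) =
      t (-j + 1) - t (-j) := by
  obtain ⟨m, hm⟩ := exists_val_intCast N j
  rw [angleβ, angleα, h.len_evenRep, hm,
    show -(j + m * (2 * (N : ℤ) + 1)) + 1 = -j + 1 + -m * (2 * N + 1) by ring,
    show -(j + m * (2 * (N : ℤ) + 1)) = -j + -m * (2 * N + 1) by ring, h.t_add_mul, h.t_add_mul]
  ring

theorem exists_intCast_eq (N : ℕ) (k : ZMod (2 * N + 1)) :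
    k = (((k.val : ℕ) : ℤ) : ZMod (2 * N + 1)) := by
  rw [Int.cast_natCast, ZMod.natCast_zmod_val]

theorem arc_eq (h : IsBreaks N t Q) (k : ZMod (2 * N + 1)) :
    arc (vert N Q k) (angleα N t k) (angleβ N t k) =
      bdry t Q '' Set.Icc (angleα N t k) (angleβ N t k) := by
  refine Set.image_congr fun θ hθ => ?_
  rw [h.bdry_even (even_evenRep N _) hθ, h.Q_evenRep]
  rfl

/-- An even interval of angles describes a side. -/
theorem exists_arc_of_even (h : IsBreaks N t Q) {j : ℤ} (hj : Even j) {θ : ℝ}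
    (hθ : θ ∈ Set.Icc (t j) (t (j + 1))) :
    ∃ θ' ∈ Set.Icc (angleα N t ((-j : ℤ) : ZMod (2 * N + 1)))
      (angleβ N t ((-j : ℤ) : ZMod (2 * N + 1))), ∃ m : ℤ, θ' = θ + m * (2 * Real.pi) := by
  obtain ⟨m, hm⟩ := exists_val_intCast N (-j)
  have hrep : ∃ q : ℤ, evenRep N (-(((-j : ℤ) : ZMod (2 * N + 1)).val : ℤ)) =
      j + 2 * q * (2 * N + 1) := by
    rw [hm]
    unfold evenRep
    split_ifs with hc
    · have : Even m := by
        obtain ⟨a, ha⟩ := hc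
        obtain ⟨b, hb⟩ := hj
        grind
      obtain ⟨q, hq⟩ := this
      exact ⟨-q, by rw [hq]; ring⟩
    · have : ¬Even m := by
        intro he
        apply hc
        obtain ⟨b, hb⟩ := hj
        obtain ⟨q, hq⟩ := he
        exact ⟨b - q * (2 * N + 1), by rw [hq, hb]; ring⟩
      obtain ⟨q, hq⟩ := Int.not_even_iff_odd.mp this
      exact ⟨-q, by rw [hq]; ring⟩
  obtain ⟨q, hq⟩ := hrep
  refine ⟨θ + q * (2 * Real.pi), ?_, q, rfl⟩
  rw [angleα, angleβ, hq, show j + 2 * q * (2 * (N : ℤ) + 1) + 1 = j + 1 + 2 * q * (2 * N + 1) by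
    ring, h.t_add_mul, h.t_add_mul]
  push_cast
  constructor <;> linarith [hθ.1, hθ.2]

theorem range_bdry (h : IsBreaks N t Q) :
    Set.range (bdry t Q) = ⋃ k, arc (vert N Q k) (angleα N t k) (angleβ N t k) := by
  apply Set.Subset.antisymm
  · have key : ∀ j : ℤ, Even j → ∀ θ ∈ Set.Icc (t j) (t (j + 1)), bdry t Q θ ∈
        ⋃ k, arc (vert N Q k) (angleα N t k) (angleβ N t k) := by
      intro j hj θ hθ
      obtain ⟨θ', hθ', m, rfl⟩ := h.exists_arc_of_even hj hθ
      refine Set.mem_iUnion.mpr ⟨((-j : ℤ) : ZMod (2 * N + 1)), ?_⟩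
      rw [h.arc_eq]
      exact ⟨_, hθ', h.isProfile.curve_add_int_mul θ m⟩
    rintro _ ⟨θ, rfl⟩
    obtain ⟨j, hj⟩ := h.exists_mem_Ico θ
    by_cases he : Even j
    · exact key j he θ ⟨hj.1, hj.2.le⟩
    -- On an odd interval the curve rests at the end point of the preceding arc.
    · rw [h.bdry_sub_odd he ⟨hj.1, hj.2.le⟩]
      refine key (j - 1) (by grind) _ ⟨(h.strictMono (by omega)).le, ?_⟩
      rw [sub_add_cancel]
  · refine Set.iUnion_subset fun k => ?_
    rw [h.arc_eq]
    exact Set.image_subset_range _ _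

theorem isReuleauxPolygon (h : IsBreaks N t Q) (hb : IsConvexBody (body t Q)) :
    IsReuleauxPolygon N (body t Q) (vert N Q) (angleα N t) (angleβ N t) where
  convexBody := hb
  constantWidth :=
    (hasConstantWidth_iff hb.1 h.isProfile.cw_curveBody.nonempty).mpr h.isProfile.cw_curveBody
  vertices_distinct := by
    intro k l hkl
    -- The injectivity of `Q` is known for odd indices only, so both indices are first replaced by
    -- odd representatives.
    have hodd : ∀ j : ℤ, ∃ m : ℤ, ¬Even (j + m * (2 * N + 1)) := fun j => by
      by_cases he : Even j
      · exact ⟨1, by grind⟩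
      · exact ⟨0, by simpa using he⟩
    obtain ⟨a, ha⟩ := hodd (-(k.val : ℤ))
    obtain ⟨b, hb⟩ := hodd (-(l.val : ℤ))
    obtain ⟨m, hm⟩ := h.exists_of_Q_eq ha hb (by rw [h.Q_add_mul, h.Q_add_mul]; exact hkl)
    rw [exists_intCast_eq N k, exists_intCast_eq N l, ZMod.intCast_eq_intCast_iff_dvd_sub]
    refine ⟨b - a - m, ?_⟩
    push_cast
    linear_combination -hm
  angle_lt k := h.strictMono (by omega)
  angle_lt_add k := by
    have h1 : t (evenRep N (-(k.val : ℤ)) + 1) ≤ t (evenRep N (-(k.val : ℤ)) + (2 * N + 1)) :=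
      h.strictMono.monotone (by omega)
    rw [h.t_add] at h1
    have := Real.pi_pos
    rw [angleβ, angleα]
    linarith
  next_vertex k := by
    have h1 := h.vert_intCast ((k.val : ℤ) + 1)
    rw [Int.cast_add, ← exists_intCast_eq N k, Int.cast_one] at h1
    rw [h1, show -((k.val : ℤ) + 1) = -(k.val : ℤ) - 1 by ring]
    change Q (-(k.val : ℤ) - 1) = Q (-(k.val : ℤ)) + cis (t (evenRep N (-(k.val : ℤ))))
    rw [← h.Q_evenRep (-(k.val : ℤ)), ← h.Q_prev_even (even_evenRep N _)]
    unfold evenRep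
    split_ifs
    · rfl
    · rw [show -(k.val : ℤ) + (2 * N + 1) - 1 = -(k.val : ℤ) - 1 + (2 * N + 1) by ring, h.Q_add]
  prev_vertex k := by
    have h1 := h.vert_intCast ((k.val : ℤ) - 1)
    rw [Int.cast_sub, ← exists_intCast_eq N k, Int.cast_one] at h1
    rw [h1, show -((k.val : ℤ) - 1) = -(k.val : ℤ) + 1 by ring]
    change Q (-(k.val : ℤ) + 1) = Q (-(k.val : ℤ)) + cis (t (evenRep N (-(k.val : ℤ)) + 1))
    rw [← h.Q_evenRep (-(k.val : ℤ)), ← h.Q_even _ (even_evenRep N _)]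
    unfold evenRep
    split_ifs
    · rfl
    · rw [show -(k.val : ℤ) + (2 * N + 1) + 1 = -(k.val : ℤ) + 1 + (2 * N + 1) by ring, h.Q_add]
  frontier_eq := by
    rw [body, h.isProfile.frontier_curveBody hb, ← h.range_bdry]
    rfl

end IsBreaks

end ConstWidth

/-! ### Reduction to one period of breaks -/

namespace ConstWidth

open Filter Topology

/-- The sign `(-1) ^ j`. -/
def sg (j : ℤ) : ℝ := if Even j then 1 else -1

theorem sg_even {j : ℤ} (h : Even j) : sg j = 1 := if_pos h

theorem sg_odd {j : ℤ} (h : ¬Even j) : sg j = -1 := if_neg h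

theorem sg_add_one (j : ℤ) : sg (j + 1) = -sg j := by
  by_cases h : Even j
  · rw [sg_even h, sg_odd (by grind)]
  · rw [sg_odd h, sg_even (by grind), neg_neg]

theorem sg_neg (j : ℤ) : sg (-j) = sg j := by
  unfold sg
  simp

theorem abs_sg (j : ℤ) : |sg j| = 1 := by
  unfold sg
  split_ifs <;> simp

theorem norm_sg_smul (j : ℤ) (z : ℂ) : ‖sg j • z‖ = ‖z‖ := by
  rw [norm_smul, Real.norm_eq_abs, abs_sg, one_mul]

theorem sg_add_odd (j : ℤ) (N : ℕ) : sg (j + (2 * N + 1)) = -sg j := by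
  by_cases h : Even j
  · rw [sg_even h, sg_odd (by grind)]
  · rw [sg_odd h, sg_even (by grind), neg_neg]

/-- Each shift by `2 * N + 1` changes both signs. With `sg` the recursions for even and odd indices
merge into one that is invariant under this shift, so one period can be treated without regard to
parity. -/
theorem sg_smul_cis (N : ℕ) (j k : ℤ) (x : ℝ) :
    sg (j + k * (2 * N + 1)) • cis (x + k * Real.pi) = sg j • cis x := by
  induction k using Int.induction_on with
  | zero => simp
  | succ k ih =>
    rw [← ih, show j + ((k : ℤ) + 1) * (2 * N + 1) = j + k * (2 * N + 1) + (2 * N + 1) by ring,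
      sg_add_odd]
    push_cast
    rw [show x + ((k : ℝ) + 1) * Real.pi = x + k * Real.pi + Real.pi by ring, cis_add_pi, smul_neg,
      neg_smul, neg_neg]
  | pred k ih =>
    rw [← ih, show j + -(k : ℤ) * (2 * N + 1) = j + (-(k : ℤ) - 1) * (2 * N + 1) + (2 * N + 1) by
      ring, sg_add_odd]
    push_cast
    rw [show x + -(k : ℝ) * Real.pi = x + (-(k : ℝ) - 1) * Real.pi + Real.pi by ring, cis_add_pi,
      smul_neg, neg_smul, neg_neg]

/-! ### Periodic extension of the data on one period -/

/-- The quotient in the division with remainder in `[-N, N]`. -/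
def balDiv (N : ℕ) (m : ℤ) : ℤ := (m + N) / (2 * N + 1)

/-- The remainder in `[-N, N]`. -/
def balMod (N : ℕ) (m : ℤ) : ℤ := (m + N) % (2 * N + 1) - N

theorem balMod_add (N : ℕ) (m : ℤ) : m = balMod N m + balDiv N m * (2 * N + 1) := by
  have := Int.emod_add_mul_ediv (m + N) (2 * N + 1)
  rw [balMod, balDiv]
  linear_combination -this

theorem balMod_mem (N : ℕ) (m : ℤ) : -N ≤ balMod N m ∧ balMod N m ≤ N := by
  have h1 := Int.emod_nonneg (m + N) (b := 2 * N + 1) (by positivity)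
  have h2 := Int.emod_lt_of_pos (m + N) (b := 2 * N + 1) (by positivity)
  rw [balMod]
  omega

theorem balDiv_eq {N : ℕ} {j : ℤ} (h1 : -N ≤ j) (h2 : j ≤ N) (k : ℤ) :
    balDiv N (j + k * (2 * N + 1)) = k := by
  rw [balDiv, show j + k * (2 * (N : ℤ) + 1) + N = (j + N) + k * (2 * N + 1) by ring,
    Int.add_mul_ediv_right _ _ (by positivity), Int.ediv_eq_zero_of_lt (by omega) (by omega),
    zero_add]

theorem balMod_eq {N : ℕ} {j : ℤ} (h1 : -N ≤ j) (h2 : j ≤ N) (k : ℤ) :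
    balMod N (j + k * (2 * N + 1)) = j := by
  have := balMod_add N (j + k * (2 * N + 1))
  rw [balDiv_eq h1 h2] at this
  linear_combination -this

/-- The extension of `T` with `t (j + 2 * N + 1) = t j + π`. -/
noncomputable def extT (N : ℕ) (T : ℤ → ℝ) (m : ℤ) : ℝ := T (balMod N m) + balDiv N m * Real.pi

/-- The periodic extension of `q`. -/
def extQ (N : ℕ) (q : ℤ → ℂ) (m : ℤ) : ℂ := q (balMod N m)

theorem extT_eq {N : ℕ} {T : ℤ → ℝ} {j : ℤ} (h1 : -N ≤ j) (h2 : j ≤ N) (k : ℤ) :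
    extT N T (j + k * (2 * N + 1)) = T j + k * Real.pi := by
  rw [extT, balMod_eq h1 h2, balDiv_eq h1 h2]

theorem extQ_eq {N : ℕ} {q : ℤ → ℂ} {j : ℤ} (h1 : -N ≤ j) (h2 : j ≤ N) (k : ℤ) :
    extQ N q (j + k * (2 * N + 1)) = q j := by
  rw [extQ, balMod_eq h1 h2]

theorem extT_of_mem {N : ℕ} {T : ℤ → ℝ} {j : ℤ} (h1 : -N ≤ j) (h2 : j ≤ N) :
    extT N T j = T j := by
  simpa using extT_eq (T := T) h1 h2 0

theorem extQ_of_mem {N : ℕ} {q : ℤ → ℂ} {j : ℤ} (h1 : -N ≤ j) (h2 : j ≤ N) :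
    extQ N q j = q j := by
  simpa using extQ_eq (q := q) h1 h2 0

theorem extT_last (N : ℕ) (T : ℤ → ℝ) : extT N T (N + 1) = T (-N) + Real.pi := by
  have := extT_eq (N := N) (T := T) (j := -N) le_rfl (by omega) 1
  rw [show -(N : ℤ) + 1 * (2 * N + 1) = N + 1 by ring] at this
  simpa using this

/-- By shift invariance only the steps inside `[-N, N]` and the one step from `N` to the next period
have to be verified. -/
theorem IsBreaks.of_window {N : ℕ} {T : ℤ → ℝ} {q : ℤ → ℂ} (hT0 : T 0 = 0)
    (hT : ∀ j : ℤ, -N ≤ j → j < N → T j < T (j + 1)) (hTwrap : T N < T (-N) + Real.pi)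
    (hq : ∀ j : ℤ, -N ≤ j → j < N → q (j + 1) = q j + sg j • cis (T (j + 1)))
    (hqwrap : q (-N) = q N + sg N • cis (T (-N) + Real.pi)) :
    IsBreaks N (extT N T) (extQ N q) := by
  have hstep : ∀ m : ℤ, extT N T m < extT N T (m + 1) ∧
      extQ N q (m + 1) = extQ N q m + sg m • cis (extT N T (m + 1)) := by
    intro m
    obtain ⟨h1, h2⟩ := balMod_mem N m
    have hm := balMod_add N m
    obtain ⟨j, hj⟩ : ∃ j, j = balMod N m := ⟨_, rfl⟩
    obtain ⟨k, hk⟩ : ∃ k, k = balDiv N m := ⟨_, rfl⟩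
    rw [← hj] at h1 h2
    rw [← hj, ← hk] at hm
    rcases h2.lt_or_eq with hlt | heq
    · have e1 : m + 1 = (j + 1) + k * (2 * N + 1) := by rw [hm]; ring
      rw [e1, extT_eq (by omega) (by omega), extQ_eq (by omega) (by omega), hm,
        extT_eq h1 h2, extQ_eq h1 h2, sg_smul_cis]
      exact ⟨by linarith [hT j h1 hlt], hq j h1 hlt⟩
    · have e1 : m + 1 = -N + (k + 1) * (2 * N + 1) := by rw [hm, heq]; ring
      rw [e1, extT_eq (by omega) (by omega), extQ_eq (by omega) (by omega), hm,
        extT_eq h1 h2, extQ_eq h1 h2, heq]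
      push_cast
      rw [show T (-N) + ((k : ℝ) + 1) * Real.pi = T (-N) + Real.pi + k * Real.pi by ring,
        sg_smul_cis]
      exact ⟨by linarith, hqwrap⟩
  refine ⟨strictMono_int_of_lt_succ fun m => (hstep m).1, ?_, fun m => ?_, fun m => ?_,
    fun m hm => ?_, fun m hm => ?_⟩
  · rw [extT_of_mem (by omega) (by omega), hT0]
  · obtain ⟨h1, h2⟩ := balMod_mem N m
    have e1 : m + (2 * N + 1) = balMod N m + (balDiv N m + 1) * (2 * N + 1) := by
      linear_combination balMod_add N m
    rw [e1, extT_eq h1 h2, extT]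
    push_cast
    ring
  · obtain ⟨h1, h2⟩ := balMod_mem N m
    have e1 : m + (2 * N + 1) = balMod N m + (balDiv N m + 1) * (2 * N + 1) := by
      linear_combination balMod_add N m
    rw [e1, extQ_eq h1 h2, extQ]
  · rw [(hstep m).2, sg_even hm, one_smul]
  · rw [(hstep m).2, sg_odd hm, neg_smul, one_smul, sub_eq_add_neg]

/-! ### Points of the boundary in terms of one period -/

namespace IsBreaks

variable {N : ℕ} {t : ℤ → ℝ} {Q : ℤ → ℂ}

/-- Both alternatives may occur for every `j`: the index in the window represents even and odd
indices alike, hence an arc about `Q j` and the vertex `Q j`. -/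
theorem exists_bdry_eq (h : IsBreaks N t Q) (θ : ℝ) :
    ∃ j : ℤ, -N ≤ j ∧ j ≤ N ∧ ∃ φ ∈ Set.Icc (t j) (t (j + 1)),
      bdry t Q θ = Q j ∨ bdry t Q θ = Q j + sg j • cis φ := by
  obtain ⟨m, hm⟩ := h.exists_mem_Ico θ
  obtain ⟨h1, h2⟩ := balMod_mem N m
  have hjm := balMod_add N m
  obtain ⟨j, hj⟩ : ∃ j, j = balMod N m := ⟨_, rfl⟩
  obtain ⟨k, hk⟩ : ∃ k, k = balDiv N m := ⟨_, rfl⟩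
  rw [← hj] at h1 h2
  rw [← hj, ← hk] at hjm
  have hQ : Q m = Q j := by rw [hjm, h.Q_add_mul]
  have ht1 : t m = t j + k * Real.pi := by rw [hjm, h.t_add_mul]
  have ht2 : t (m + 1) = t (j + 1) + k * Real.pi := by
    rw [hjm, show j + k * (2 * (N : ℤ) + 1) + 1 = j + 1 + k * (2 * N + 1) by ring, h.t_add_mul]
  refine ⟨j, h1, h2, θ - k * Real.pi, ⟨by linarith [hm.1], by linarith [hm.2]⟩, ?_⟩
  by_cases he : Even m
  · right
    rw [h.bdry_even he ⟨hm.1, hm.2.le⟩, hQ, ← sg_smul_cis N j k, ← hjm, sg_even he, one_smul,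
      sub_add_cancel]
  · left
    rw [h.bdry_odd he ⟨hm.1, hm.2.le⟩, hQ]

theorem arc_neg_intCast (h : IsBreaks N t Q) (j : ℤ) :
    arc (vert N Q ((-j : ℤ) : ZMod (2 * N + 1))) (angleα N t ((-j : ℤ) : ZMod (2 * N + 1)))
      (angleβ N t ((-j : ℤ) : ZMod (2 * N + 1))) =
      (fun φ => Q j + sg j • cis φ) '' Set.Icc (t j) (t (j + 1)) := by
  obtain ⟨m, hm⟩ := exists_val_intCast N (-j)
  have hrep : ∃ k : ℤ, evenRep N (-(((-j : ℤ) : ZMod (2 * N + 1)).val : ℤ)) =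
      j + k * (2 * N + 1) := by
    rw [hm]
    unfold evenRep
    split_ifs
    · exact ⟨-m, by ring⟩
    · exact ⟨-m + 1, by ring⟩
  obtain ⟨k, hk⟩ := hrep
  have he := even_evenRep N (-(((-j : ℤ) : ZMod (2 * N + 1)).val : ℤ))
  rw [hk] at he
  have hcis : ∀ φ, sg j • cis φ = cis (φ + k * Real.pi) := fun φ => by
    rw [← sg_smul_cis N j k, sg_even he, one_smul]
  rw [h.vert_intCast, neg_neg, angleα, angleβ, hk,
    show j + k * (2 * (N : ℤ) + 1) + 1 = j + 1 + k * (2 * N + 1) by ring, h.t_add_mul, h.t_add_mul]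
  simp only [hcis]
  ext z
  constructor
  · rintro ⟨θ, hθ, rfl⟩
    refine ⟨θ - k * Real.pi, ⟨by linarith [hθ.1], by linarith [hθ.2]⟩, ?_⟩
    simp only [sub_add_cancel]
    rfl
  · rintro ⟨φ, hφ, rfl⟩
    exact ⟨φ + k * Real.pi, ⟨by linarith [hφ.1], by linarith [hφ.2]⟩, rfl⟩

end IsBreaks

end ConstWidth

/-! ### The extremal shapes and their circumradius -/

namespace ConstWidth

open Filter Topology

/-- The relations between the parameters of the extremal shapes: `R` is the radius of the
outercircle, `ℓ` the length of the tangent sides with both endpoints on it, and `2 * N - 1` of the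
`2 * N + 1` breaks in a period are `j * ℓ` with `|j| < N`, the other two being `τ` and `-τ`. -/
structure IsShape (N : ℕ) (R ℓ τ : ℝ) : Prop where
  one_le : 1 ≤ N
  R_lt_one : R < 1
  two_mul_cos : 2 * R * Real.cos (ℓ / 2) = 1
  l_pos : 0 < ℓ
  l_le : ℓ ≤ Real.pi / 3
  lower : (N - 1 / 2) * ℓ < τ
  upper : τ ≤ N * ℓ
  τ_lt : τ < Real.pi / 2
  cos_τ : Real.cos τ = R * Real.cos ((N - 1 / 2) * ℓ)
  τ_eq : N = 1 → τ = ℓ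

/-- The breaks in `[-π / 2, π / 2]`. -/
noncomputable def shapeT (N : ℕ) (ℓ τ : ℝ) (j : ℤ) : ℝ :=
  if j = N then τ else if j = -N then -τ else j * ℓ

/-- The corresponding vertices. -/
noncomputable def shapeQ (N : ℕ) (R ℓ τ : ℝ) (j : ℤ) : ℂ :=
  if j = N then -sg N • (cis τ - R • cis ((N - 1 / 2) * ℓ)) else -sg j • R • cis ((j + 1 / 2) * ℓ)

/-- The breaks of the extremal shape. -/
noncomputable def brk (N : ℕ) (ℓ τ : ℝ) : ℤ → ℝ := extT N (shapeT N ℓ τ)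

/-- The vertices of the extremal shape. -/
noncomputable def vtx (N : ℕ) (R ℓ τ : ℝ) : ℤ → ℂ := extQ N (shapeQ N R ℓ τ)

namespace IsShape

variable {N : ℕ} {R ℓ τ : ℝ}

theorem R_pos (h : IsShape N R ℓ τ) : 0 < R := by
  have h1 := h.two_mul_cos
  have h2 : 0 < Real.cos (ℓ / 2) := Real.cos_pos_of_mem_Ioo
    ⟨by linarith [h.l_pos, Real.pi_pos], by linarith [h.l_le, Real.pi_pos]⟩
  by_contra hR
  nlinarith [mul_nonneg_of_nonpos_of_nonpos (not_lt.mp hR) (neg_nonpos.mpr h2.le)]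

theorem one_le_cast (h : IsShape N R ℓ τ) : (1 : ℝ) ≤ N := by exact_mod_cast h.one_le

theorem τ_pos (h : IsShape N R ℓ τ) : 0 < τ := by
  have := h.one_le_cast
  have := h.lower
  have := h.l_pos
  nlinarith

theorem shapeT_bounds (h : IsShape N R ℓ τ) {j : ℤ} (h1 : -N ≤ j) (h2 : j < N) :
    j * ℓ ≤ shapeT N ℓ τ j ∧ shapeT N ℓ τ j < (j + 1 / 2) * ℓ ∧
      (j + 1 / 2) * ℓ < shapeT N ℓ τ (j + 1) ∧ shapeT N ℓ τ (j + 1) ≤ (j + 1) * ℓ := by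
  have hl := h.l_pos
  have hlow := h.lower
  have hup := h.upper
  have hN := h.one_le
  refine ⟨?_, ?_, ?_, ?_⟩ <;> unfold shapeT <;> split_ifs with ha hb <;>
    first
    | omega
    | (subst hb; push_cast at *; linarith)
    | (have hc : (j : ℝ) = N - 1 := by
        have : (j : ℤ) = N - 1 := by omega
        rw [this]; push_cast; ring
       rw [hc]; linarith)
    | (push_cast; linarith)

/-- From `2R cos (ℓ / 2) = 1`: the points `-R cis x` and `R cis (x + ℓ)` of the outercircle are at
distance 1. This is the step from one vertex on the outercircle to the next. -/
theorem cis_eq (h : IsShape N R ℓ τ) (x : ℝ) :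
    cis (x + ℓ / 2) = R • cis x + R • cis (x + ℓ) := by
  have h1 : ((2 * R * Real.cos (ℓ / 2) : ℝ) : ℂ) = 1 := by rw [h.two_mul_cos]; simp
  have h2 : cis (-(ℓ / 2)) + cis (ℓ / 2) = ((2 * Real.cos (ℓ / 2) : ℝ) : ℂ) := by
    apply Complex.ext
    · simp only [Complex.add_re, cis_re, Real.cos_neg, Complex.ofReal_re]; ring
    · simp only [Complex.add_im, cis_im, Real.sin_neg, Complex.ofReal_im]; ring
  have h3 : cis x = cis (x + ℓ / 2) * cis (-(ℓ / 2)) := by rw [← cis_add]; congr 1; ring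
  have h4 : cis (x + ℓ) = cis (x + ℓ / 2) * cis (ℓ / 2) := by rw [← cis_add]; congr 1; ring
  rw [h3, h4, ← smul_add, ← mul_add, h2, Complex.real_smul]
  push_cast at h1 ⊢
  linear_combination -cis (x + ℓ / 2) * h1

theorem cis_add_cis_neg (x : ℝ) : cis x + cis (-x) = ((2 * Real.cos x : ℝ) : ℂ) := by
  apply Complex.ext
  · simp only [Complex.add_re, cis_re, Real.cos_neg, Complex.ofReal_re]; ring
  · simp only [Complex.add_im, cis_im, Real.sin_neg, Complex.ofReal_im]; ring

/-- Inside the window the steps follow from `cis_eq`, except the last one, which defines the vertex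
with index `N`. The polygon closes because `cos_τ` makes the real part of this vertex vanish,
placing it on the axis of symmetry. -/
theorem isBreaks (h : IsShape N R ℓ τ) : IsBreaks N (brk N ℓ τ) (vtx N R ℓ τ) := by
  have hN := h.one_le
  refine IsBreaks.of_window ?_ ?_ ?_ ?_ ?_
  · unfold shapeT
    rw [if_neg (by omega), if_neg (by omega)]
    simp
  · intro j h1 h2
    obtain ⟨-, h3, h4, -⟩ := h.shapeT_bounds h1 h2
    exact h3.trans h4
  · unfold shapeT
    rw [if_pos rfl, if_neg (by omega), if_pos rfl]
    linarith [h.τ_lt]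
  · intro j h1 h2
    have hQj : shapeQ N R ℓ τ j = -sg j • R • cis ((j + 1 / 2) * ℓ) := if_neg (by omega)
    rw [hQj]
    rcases (Int.add_one_le_of_lt h2).lt_or_eq with hlt | heq
    · have hQ1 : shapeQ N R ℓ τ (j + 1) = -sg (j + 1) • R • cis (((j + 1 : ℤ) + 1 / 2) * ℓ) :=
        if_neg (by omega)
      have hT1 : shapeT N ℓ τ (j + 1) = (j + 1 : ℤ) * ℓ := by
        unfold shapeT
        rw [if_neg (by omega), if_neg (by omega)]
      have hc := h.cis_eq ((j + 1 / 2) * ℓ)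
      rw [hQ1, hT1, sg_add_one]
      push_cast
      rw [show ((j : ℝ) + 1 / 2) * ℓ + ℓ / 2 = (j + 1) * ℓ by ring,
        show ((j : ℝ) + 1 / 2) * ℓ + ℓ = (j + 1 + 1 / 2) * ℓ by ring] at hc
      rw [hc]
      simp only [Complex.real_smul]
      push_cast
      ring
    · have hj : j = N - 1 := by omega
      have hQ1 : shapeQ N R ℓ τ (j + 1) = -sg N • (cis τ - R • cis ((N - 1 / 2) * ℓ)) :=
        if_pos heq
      have hT1 : shapeT N ℓ τ (j + 1) = τ := if_pos heq
      rw [hQ1, hT1, ← heq, sg_add_one, hj]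
      push_cast
      rw [show ((N : ℝ) - 1 + 1 / 2) = N - 1 / 2 by ring]
      simp only [Complex.real_smul]
      push_cast
      ring
  · have hQ1 : shapeQ N R ℓ τ (-N) = -sg (-N) • R • cis (((-N : ℤ) + 1 / 2) * ℓ) :=
      if_neg (by omega)
    have hQ2 : shapeQ N R ℓ τ N = -sg N • (cis τ - R • cis ((N - 1 / 2) * ℓ)) := if_pos rfl
    have hT : shapeT N ℓ τ (-N) = -τ := by
      unfold shapeT
      rw [if_neg (by omega), if_pos rfl]
    have e1 := cis_add_cis_neg τ
    have e2 := cis_add_cis_neg ((N - 1 / 2) * ℓ)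
    rw [h.cos_τ] at e1
    rw [hQ1, hQ2, hT, sg_neg, cis_add_pi]
    push_cast at e1 e2 ⊢
    rw [show (-(N : ℝ) + 1 / 2) * ℓ = -((N - 1 / 2) * ℓ) by ring]
    simp only [Complex.real_smul]
    push_cast
    linear_combination (sg N : ℂ) * e1 - (sg N : ℂ) * R * e2

theorem brk_bounds (h : IsShape N R ℓ τ) {j : ℤ} (h1 : -N ≤ j) (h2 : j < N) :
    j * ℓ ≤ brk N ℓ τ j ∧ brk N ℓ τ j < (j + 1 / 2) * ℓ ∧
      (j + 1 / 2) * ℓ < brk N ℓ τ (j + 1) ∧ brk N ℓ τ (j + 1) ≤ (j + 1) * ℓ := by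
  rw [brk, extT_of_mem h1 h2.le, extT_of_mem (by omega) (by omega)]
  exact h.shapeT_bounds h1 h2

theorem brk_N (N : ℕ) (ℓ τ : ℝ) : brk N ℓ τ N = τ := by
  rw [brk, extT_of_mem (by omega) le_rfl]
  exact if_pos rfl

theorem brk_neg_N (h : IsShape N R ℓ τ) : brk N ℓ τ (-N) = -τ := by
  have := h.one_le
  rw [brk, extT_of_mem le_rfl (by omega), shapeT, if_neg (by omega), if_pos rfl]

theorem brk_N_add_one (h : IsShape N R ℓ τ) : brk N ℓ τ (N + 1) = Real.pi - τ := by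
  have := h.one_le
  rw [brk, extT_last, shapeT, if_neg (by omega), if_pos rfl]
  ring

theorem brk_inner {j : ℤ} (h1 : -N < j) (h2 : j < N) : brk N ℓ τ j = j * ℓ := by
  rw [brk, extT_of_mem h1.le h2.le, shapeT, if_neg (by omega), if_neg (by omega)]

theorem vtx_of_lt {j : ℤ} (h1 : -N ≤ j) (h2 : j < N) :
    vtx N R ℓ τ j = -sg j • R • cis ((j + 1 / 2) * ℓ) := by
  rw [vtx, extQ_of_mem h1 h2.le, shapeQ, if_neg (by omega)]

theorem vtx_N : vtx N R ℓ τ N = -sg N • (cis τ - R • cis ((N - 1 / 2) * ℓ)) := by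
  rw [vtx, extQ_of_mem (by omega) le_rfl]
  exact if_pos rfl

theorem norm_vtx (h : IsShape N R ℓ τ) {j : ℤ} (h1 : -N ≤ j) (h2 : j < N) :
    ‖vtx N R ℓ τ j‖ = R := by
  rw [vtx_of_lt h1 h2, neg_smul, norm_neg, norm_sg_smul, norm_smul, norm_cis, mul_one,
    Real.norm_of_nonneg h.R_pos.le]

theorem norm_cis_sub_sq (x y κ : ℝ) :
    ‖cis x - κ • cis y‖ ^ 2 = 1 + κ ^ 2 - 2 * κ * Real.cos (x - y) := by
  rw [norm_sub_sq_real, norm_cis, norm_smul, norm_cis, real_inner_smul_right, inner_cis_cis,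
    Real.norm_eq_abs, mul_one, sq_abs, show y - x = -(x - y) by ring, Real.cos_neg]
  ring

/-- The squared norm is `1 + R² - 2R cos (x - y)`, and `1 = 2R cos (ℓ / 2)`. -/
theorem norm_cis_sub_le (h : IsShape N R ℓ τ) {x y : ℝ} (hxy : |x - y| ≤ ℓ / 2) :
    ‖cis x - R • cis y‖ ≤ R := by
  rw [← sq_le_sq₀ (norm_nonneg _) h.R_pos.le, norm_cis_sub_sq, ← Real.cos_abs]
  have h1 := Real.cos_le_cos_of_nonneg_of_le_pi (abs_nonneg _)
    (by linarith [h.l_le, Real.pi_pos]) hxy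
  have h2 := h.two_mul_cos
  nlinarith [mul_le_mul_of_nonneg_left h1 h.R_pos.le]

theorem norm_cis_sub_lt (h : IsShape N R ℓ τ) {x y : ℝ} (hxy : |x - y| < ℓ / 2) :
    ‖cis x - R • cis y‖ < R := by
  rw [← sq_lt_sq₀ (norm_nonneg _) h.R_pos.le, norm_cis_sub_sq, ← Real.cos_abs]
  have h1 := Real.cos_lt_cos_of_nonneg_of_le_pi (abs_nonneg _)
    (by linarith [h.l_le, Real.pi_pos]) hxy
  have h2 := h.two_mul_cos
  nlinarith [mul_lt_mul_of_pos_left h1 h.R_pos]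

/-- The height of the vertex on the axis of symmetry. -/
theorem cis_τ_sub (h : IsShape N R ℓ τ) : ∃ y : ℝ, 0 < y ∧
    cis τ - R • cis ((N - 1 / 2) * ℓ) = y * Complex.I := by
  refine ⟨Real.sin τ - R * Real.sin ((N - 1 / 2) * ℓ), ?_, ?_⟩
  · have h0 := h.one_le_cast
    have h1 : Real.sin ((N - 1 / 2) * ℓ) < Real.sin τ :=
      Real.sin_lt_sin_of_lt_of_le_pi_div_two (by nlinarith [h.l_pos, Real.pi_pos]) h.τ_lt.le h.lower
    have h2 : 0 ≤ Real.sin ((N - 1 / 2) * ℓ) :=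
      Real.sin_nonneg_of_nonneg_of_le_pi (by nlinarith [h.l_pos]) (by
        linarith [h.lower, h.τ_lt, Real.pi_pos])
    nlinarith [h.R_lt_one]
  · apply Complex.ext
    · simp only [Complex.sub_re, Complex.real_smul, Complex.re_ofReal_mul, cis_re, h.cos_τ,
        Complex.I_re, mul_zero, sub_self]
    · simp only [Complex.sub_im, Complex.real_smul, Complex.im_ofReal_mul, cis_im, Complex.I_im,
        mul_one]

theorem abs_τ_sub_le (h : IsShape N R ℓ τ) : |τ - (N - 1 / 2) * ℓ| ≤ ℓ / 2 := by
  rw [abs_of_pos (by linarith [h.lower])]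
  linarith [h.upper]

theorem norm_vtx_N_le (h : IsShape N R ℓ τ) : ‖vtx N R ℓ τ N‖ ≤ R := by
  rw [vtx_N, neg_smul, norm_neg, norm_sg_smul]
  exact h.norm_cis_sub_le h.abs_τ_sub_le

theorem bdry_mem_closedBall (h : IsShape N R ℓ τ) (θ : ℝ) :
    IsBreaks.bdry (brk N ℓ τ) (vtx N R ℓ τ) θ ∈ closedBall 0 R := by
  rw [mem_closedBall_zero_iff]
  obtain ⟨j, h1, h2, φ, hφ, hθ⟩ := h.isBreaks.exists_bdry_eq θ
  rcases h2.lt_or_eq with hlt | heq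
  · rcases hθ with hθ | hθ
    · rw [hθ, h.norm_vtx h1 hlt]
    · rw [hθ, vtx_of_lt h1 hlt, neg_smul, neg_add_eq_sub, ← smul_sub, norm_sg_smul]
      refine h.norm_cis_sub_le ?_
      obtain ⟨hb1, -, -, hb4⟩ := h.brk_bounds h1 hlt
      rw [abs_le]
      constructor <;> linarith [hφ.1, hφ.2]
  · subst heq
    rcases hθ with hθ | hθ
    · rw [hθ]
      exact h.norm_vtx_N_le
    · obtain ⟨y, hy0, hy⟩ := h.cis_τ_sub
      rw [brk_N, h.brk_N_add_one] at hφ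
      rw [hθ, vtx_N, neg_smul, neg_add_eq_sub, ← smul_sub, norm_sg_smul, hy]
      have hI : (y : ℂ) * Complex.I = y • cis (Real.pi / 2) := by
        rw [Complex.real_smul, cis]
        push_cast
        rw [Complex.exp_pi_div_two_mul_I]
      -- The end point at `τ` of the arc about the vertex on the axis lies on the outercircle. The
      -- distance from 0 along this arc grows with `|φ - π / 2|`, so it is largest at the ends `τ`
      -- and `π - τ`.
      have hR : cis τ - y • cis (Real.pi / 2) = R • cis ((N - 1 / 2) * ℓ) := by
        rw [← hI, ← hy]; ring
      have hRn := congrArg (fun z => ‖z‖ ^ 2) hR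
      simp only [norm_cis_sub_sq, norm_smul, norm_cis, mul_one, Real.norm_eq_abs, sq_abs] at hRn
      rw [hI, ← sq_le_sq₀ (norm_nonneg _) h.R_pos.le, norm_cis_sub_sq, ← hRn]
      have hcos : Real.cos (τ - Real.pi / 2) ≤ Real.cos (φ - Real.pi / 2) := by
        rw [← Real.cos_abs (φ - Real.pi / 2), ← Real.cos_abs (τ - Real.pi / 2)]
        refine Real.cos_le_cos_of_nonneg_of_le_pi (abs_nonneg _) ?_ ?_
        · rw [abs_of_neg (by linarith [h.τ_lt])]
          linarith [h.τ_pos, Real.pi_pos]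
        · rw [abs_of_neg (a := τ - Real.pi / 2) (by linarith [h.τ_lt]), abs_le]
          constructor <;> linarith [hφ.1, hφ.2]
      nlinarith

theorem body_subset (h : IsShape N R ℓ τ) :
    IsBreaks.body (brk N ℓ τ) (vtx N R ℓ τ) ⊆ closedBall 0 R :=
  IsProfile.curveBody_subset_closedBall h.bdry_mem_closedBall

theorem isConvexBody (h : IsShape N R ℓ τ) :
    IsConvexBody (IsBreaks.body (brk N ℓ τ) (vtx N R ℓ τ)) :=
  h.isBreaks.isProfile.cw_curveBody.isConvexBody h.isBreaks.isProfile.isCompact_curveBody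
    IsProfile.convex_curveBody h.R_lt_one h.body_subset

theorem closedBall_subset_body (h : IsShape N R ℓ τ) :
    closedBall 0 (1 - R) ⊆ IsBreaks.body (brk N ℓ τ) (vtx N R ℓ τ) :=
  h.isBreaks.isProfile.cw_curveBody.closedBall_subset h.isConvexBody.1.isClosed h.isConvexBody.2.1
    (by rw [sub_sub_cancel]; exact h.body_subset)

end IsShape

theorem IsBreaks.Q_mem_body {N : ℕ} {t : ℤ → ℝ} {Q : ℤ → ℂ} (h : IsBreaks N t Q) (j : ℤ) :
    Q j ∈ body t Q := by
  by_cases he : Even j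
  · rw [← h.Q_add j, ← (h.bdry_t _).2 (by grind)]
    exact IsProfile.curve_mem _
  · rw [← (h.bdry_t _).2 he]
    exact IsProfile.curve_mem _

/-- A set with four points on the circle of radius `R` around `0`, symmetric to the imaginary axis
and not all on the same side of the real axis, has circumradius at least `R`. -/
theorem le_circR_of_symmetric {K : Set ℂ} (hK : IsCompact K) {R : ℝ} {z w : ℂ}
    (hz : ‖z‖ = R) (hw : ‖w‖ = R) (hzi : z.im ≤ 0) (hwi : 0 ≤ w.im) (hzK : z ∈ K)
    (hzK' : -(starRingEnd ℂ) z ∈ K) (hwK : w ∈ K) (hwK' : -(starRingEnd ℂ) w ∈ K) :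
    R ≤ circR K := by
  obtain ⟨c, hc⟩ := exists_subset_closedBall_circR hK ⟨z, hzK⟩
  have hρ0 : 0 ≤ circR K := dist_nonneg.trans (hc hzK)
  -- The mean of the squared distances from `c` to `x` and to its mirror image is `R² + ‖c‖² - 2
  -- x.im c.im`.
  have key : ∀ x : ℂ, ‖x‖ = R → x ∈ K → -(starRingEnd ℂ) x ∈ K → x.im * c.im ≤ 0 →
      R ≤ circR K := by
    intro x hx hxK hxK' hle
    have h1 := hc hxK
    have h2 := hc hxK'
    rw [mem_closedBall, dist_eq_norm] at h1 h2
    have h1' := pow_le_pow_left₀ (norm_nonneg _) h1 2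
    have h2' := pow_le_pow_left₀ (norm_nonneg _) h2 2
    have hR2 : R ^ 2 = x.re ^ 2 + x.im ^ 2 := by
      rw [← hx, ← Complex.normSq_eq_norm_sq, Complex.normSq_apply]; ring
    rw [← Complex.normSq_eq_norm_sq, Complex.normSq_apply] at h1' h2'
    simp at h1' h2'
    refine (sq_le_sq₀ (by rw [← hx]; exact norm_nonneg _) hρ0).mp ?_
    nlinarith [sq_nonneg c.re, sq_nonneg c.im]
  rcases le_total 0 c.im with h | h
  · exact key z hz hzK hzK' (mul_nonpos_of_nonpos_of_nonneg hzi h)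
  · exact key w hw hwK hwK' (mul_nonpos_of_nonneg_of_nonpos hwi h)

theorem neg_conj_smul_cis (R x : ℝ) :
    -(starRingEnd ℂ) (R • cis x) = -(R • cis (-x)) := by
  apply Complex.ext
  · simp [cis_re]
  · simp [cis_im]

namespace IsShape

variable {N : ℕ} {R ℓ τ : ℝ}

theorem vtx_zero (h : IsShape N R ℓ τ) : vtx N R ℓ τ 0 = -(R • cis (ℓ / 2)) := by
  have := h.one_le
  rw [vtx_of_lt (by omega) (by omega), sg_even (by decide)]
  push_cast
  rw [show (0 + 1 / 2 : ℝ) * ℓ = ℓ / 2 by ring]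
  simp

/-- The symmetric criterion is applied to the vertices with indices `-1` and `0` below the real
axis, and above it to those with indices `1` and `-2`, or for `N = 1` to the vertex on the axis,
which is its own mirror image. -/
theorem circR_body (h : IsShape N R ℓ τ) :
    circR (IsBreaks.body (brk N ℓ τ) (vtx N R ℓ τ)) = R := by
  refine le_antisymm (circR_le ⟨_, h.isBreaks.Q_mem_body 0⟩ h.body_subset) ?_
  have hN := h.one_le
  have hpi := Real.pi_pos
  have hRp := h.R_pos
  have hl0 := h.l_pos
  have hl1 := h.l_le
  have hz1 : vtx N R ℓ τ (-1) = R • cis (-(ℓ / 2)) := by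
    rw [vtx_of_lt (by omega) (by omega), sg_odd (by decide)]
    push_cast
    rw [show (-1 + 1 / 2 : ℝ) * ℓ = -(ℓ / 2) by ring]
    simp
  have hz0 := h.vtx_zero
  have hlow : ∀ w : ℂ, ‖w‖ = R → 0 ≤ w.im → w ∈ IsBreaks.body (brk N ℓ τ) (vtx N R ℓ τ) →
      -(starRingEnd ℂ) w ∈ IsBreaks.body (brk N ℓ τ) (vtx N R ℓ τ) →
      R ≤ circR (IsBreaks.body (brk N ℓ τ) (vtx N R ℓ τ)) := by
    intro w hw hwi hwK hwK'
    refine le_circR_of_symmetric h.isConvexBody.1 (z := R • cis (-(ℓ / 2))) ?_ hw ?_ hwi ?_ ?_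
      hwK hwK'
    · rw [norm_smul, norm_cis, mul_one, Real.norm_of_nonneg hRp.le]
    · have := Real.sin_nonneg_of_nonneg_of_le_pi (x := ℓ / 2) (by linarith) (by linarith)
      simp only [Complex.real_smul, Complex.im_ofReal_mul, cis_im, Real.sin_neg]
      nlinarith
    · rw [← hz1]; exact h.isBreaks.Q_mem_body _
    · rw [neg_conj_smul_cis, neg_neg, ← hz0]; exact h.isBreaks.Q_mem_body _
  by_cases hN1 : N = 1
  · have hτ := h.τ_eq hN1
    subst hN1
    obtain ⟨y, hy0, hy⟩ := h.cis_τ_sub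
    have hv : vtx 1 R ℓ τ 1 = y * Complex.I := by
      have := vtx_N (N := 1) (R := R) (ℓ := ℓ) (τ := τ)
      rw [Nat.cast_one, sg_odd (by decide), hy] at this
      simpa using this
    have hyR : ‖(y : ℂ) * Complex.I‖ = R := by
      rw [← hy, ← sq_eq_sq₀ (norm_nonneg _) hRp.le, norm_cis_sub_sq, hτ,
        show ℓ - ((1 : ℕ) - 1 / 2) * ℓ = ℓ / 2 by push_cast; ring]
      linear_combination -h.two_mul_cos
    refine hlow _ hyR (by simpa using hy0.le) ?_ ?_
    · rw [← hv]; exact h.isBreaks.Q_mem_body _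
    · have : -(starRingEnd ℂ) ((y : ℂ) * Complex.I) = y * Complex.I := by simp
      rw [this, ← hv]; exact h.isBreaks.Q_mem_body _
  · have hw1 : vtx N R ℓ τ 1 = R • cis (3 * ℓ / 2) := by
      rw [vtx_of_lt (by omega) (by omega), sg_odd (by decide)]
      push_cast
      rw [show (1 + 1 / 2 : ℝ) * ℓ = 3 * ℓ / 2 by ring]
      simp
    have hw2 : vtx N R ℓ τ (-2) = -(R • cis (-(3 * ℓ / 2))) := by
      rw [vtx_of_lt (by omega) (by omega), sg_even (by decide)]
      push_cast
      rw [show (-2 + 1 / 2 : ℝ) * ℓ = -(3 * ℓ / 2) by ring]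
      simp
    refine hlow (R • cis (3 * ℓ / 2)) ?_ ?_ ?_ ?_
    · rw [norm_smul, norm_cis, mul_one, Real.norm_of_nonneg hRp.le]
    · have := Real.sin_nonneg_of_nonneg_of_le_pi (x := 3 * ℓ / 2) (by linarith) (by linarith)
      simp only [Complex.real_smul, Complex.im_ofReal_mul, cis_im]
      positivity
    · rw [← hw1]; exact h.isBreaks.Q_mem_body _
    · rw [neg_conj_smul_cis, ← hw2]; exact h.isBreaks.Q_mem_body _

theorem body_mem_admissible (h : IsShape N R ℓ τ) :
    IsBreaks.body (brk N ℓ τ) (vtx N R ℓ τ) ∈ admissible (1 - R) :=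
  mem_admissible_iff.mpr ⟨h.isConvexBody, h.isBreaks.isProfile.cw_curveBody,
    by rw [h.circR_body]; ring⟩

end IsShape

end ConstWidth

/-! ### The parameters as functions of the inradius; existence of the shapes -/

namespace ConstWidth

open Filter Topology

/-! ### The parameters -/

theorem cos_sideL {r : ℝ} (hr : r ≤ 1 / 2) : Real.cos (sideL r / 2) = 1 / (2 * (1 - r)) := by
  have h1 : 0 ≤ 4 * (1 - r) ^ 2 - 1 := by nlinarith
  rw [sideL, mul_div_cancel_left₀ _ two_ne_zero, Real.cos_arctan, Real.sq_sqrt h1,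
    show 1 + (4 * (1 - r) ^ 2 - 1) = (2 * (1 - r)) ^ 2 by ring, Real.sqrt_sq (by linarith)]

theorem sideL_nonneg (r : ℝ) : 0 ≤ sideL r :=
  mul_nonneg zero_le_two (Real.arctan_nonneg.mpr (Real.sqrt_nonneg _))

theorem sideL_lt_pi (r : ℝ) : sideL r < Real.pi := by
  have := Real.arctan_lt_pi_div_two (Real.sqrt (4 * (1 - r) ^ 2 - 1))
  rw [sideL]
  linarith

theorem sideL_pos {r : ℝ} (hr : r < 1 / 2) : 0 < sideL r := by
  have : 0 < Real.sqrt (4 * (1 - r) ^ 2 - 1) := Real.sqrt_pos.mpr (by nlinarith)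
  exact mul_pos two_pos (Real.arctan_pos.mpr this)

theorem cos_pi_div_pos {m : ℕ} (hm : 2 ≤ m) : 0 < Real.cos (Real.pi / (2 * m)) := by
  have hm' : (2 : ℝ) ≤ m := by exact_mod_cast hm
  refine Real.cos_pos_of_mem_Ioo ⟨?_, ?_⟩
  · have : 0 < Real.pi / (2 * m) := by positivity
    linarith [Real.pi_pos]
  · rw [div_lt_div_iff_of_pos_left Real.pi_pos (by positivity) two_pos]
    linarith

theorem pi_div_mem {m : ℕ} (hm : 2 ≤ m) : Real.pi / (2 * m) ∈ Set.Icc 0 Real.pi := by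
  have hm' : (2 : ℝ) ≤ m := by exact_mod_cast hm
  refine ⟨by positivity, div_le_self Real.pi_pos.le (by linarith)⟩

theorem sideL_mem (r : ℝ) : sideL r / 2 ∈ Set.Icc 0 Real.pi :=
  ⟨by linarith [sideL_nonneg r], by linarith [sideL_lt_pi r, Real.pi_pos]⟩

/-- The inradius and `ℓ` are tied by `cos (ℓ / 2) = 1 / (2 (1 - r))`, under which the `m`-th regular
inradius corresponds to `ℓ = π / m`, and larger `r` to smaller `ℓ`. -/
theorem lt_regularInradius_iff {r : ℝ} (hr : r ≤ 1 / 2) {m : ℕ} (hm : 2 ≤ m) :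
    r < regularInradius m ↔ Real.pi / m < sideL r := by
  have hm' : (2 : ℝ) ≤ m := by exact_mod_cast hm
  have hc := cos_pi_div_pos hm
  have h1 : r < regularInradius m ↔ Real.cos (sideL r / 2) < Real.cos (Real.pi / (2 * m)) := by
    rw [cos_sideL hr, regularInradius, lt_sub_comm, div_lt_comm₀ (by linarith) hc, one_div, one_div,
      mul_inv]
    constructor <;> intro h <;> linarith
  rw [h1, Real.strictAntiOn_cos.lt_iff_gt (sideL_mem r) (pi_div_mem hm),
    show Real.pi / (2 * m) = Real.pi / m / 2 by field_simp]
  constructor <;> intro h <;> linarith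

theorem eq_regularInradius_iff {r : ℝ} (hr : r ≤ 1 / 2) {m : ℕ} (hm : 2 ≤ m) :
    r = regularInradius m ↔ sideL r = Real.pi / m := by
  have hm' : (2 : ℝ) ≤ m := by exact_mod_cast hm
  have hc := cos_pi_div_pos hm
  have h1 : r = regularInradius m ↔ Real.cos (sideL r / 2) = Real.cos (Real.pi / (2 * m)) := by
    have hr0 : 1 - r ≠ 0 := by linarith
    rw [cos_sideL hr, regularInradius]
    constructor
    · intro h
      rw [show 1 - r = 1 / (2 * Real.cos (Real.pi / (2 * m))) by linarith]
      field_simp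
    · intro h
      rw [← h]
      field_simp
      ring
  rw [h1, Real.injOn_cos.eq_iff (sideL_mem r) (pi_div_mem hm),
    show Real.pi / (2 * m) = Real.pi / m / 2 by field_simp]
  constructor <;> intro h <;> linarith

theorem regularInradius_lt_half {m : ℕ} (hm : 2 ≤ m) : regularInradius m < 1 / 2 := by
  have hm' : (2 : ℝ) ≤ m := by exact_mod_cast hm
  have hc := cos_pi_div_pos hm
  have h1 : Real.cos (Real.pi / (2 * m)) < 1 := by
    rw [← Real.cos_zero]
    exact Real.strictAntiOn_cos ⟨le_rfl, Real.pi_pos.le⟩ (pi_div_mem hm) (by positivity)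
  have : 1 / 2 < 1 / (2 * Real.cos (Real.pi / (2 * m))) :=
    one_div_lt_one_div_of_lt (by positivity) (by linarith)
  rw [regularInradius]
  linarith

theorem regularInradius_three : regularInradius 3 = 1 - 1 / Real.sqrt 3 := by
  rw [regularInradius, show Real.pi / (2 * (3 : ℕ)) = Real.pi / 6 by norm_num, Real.cos_pi_div_six]
  congr 2
  ring

theorem sideL_le {r : ℝ} (hr : r ∈ inradii) : sideL r ≤ Real.pi / 3 := by
  have h1 : ¬ r < regularInradius 3 := by
    rw [regularInradius_three]
    exact not_lt.mpr hr.1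
  rw [lt_regularInradius_iff hr.2 (by norm_num)] at h1
  simpa using h1

/-- The half-angle complementary to half the length of the side that is not tangent. -/
noncomputable def angleτ (N : ℕ) (r : ℝ) : ℝ := Real.pi / 2 - sideA N r / 2

theorem two_mul_cos_sideL {r : ℝ} (hr : r ≤ 1 / 2) :
    2 * (1 - r) * Real.cos (sideL r / 2) = 1 := by
  rw [cos_sideL hr]
  have : 1 - r ≠ 0 := by linarith
  field_simp

section

variable {N : ℕ} {r : ℝ}

theorem sideA_pos (hr : r ∈ inradii) (h0 : 0 < paramH N r) (h1 : paramH N r ≤ sideL r) :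
    0 < sideA N r := by
  have hl := sideL_le hr
  have hs : 0 < Real.sin (paramH N r) :=
    Real.sin_pos_of_pos_of_lt_pi h0 (by linarith [Real.pi_pos])
  have : 0 < 1 - r := by linarith [hr.2]
  exact mul_pos two_pos (Real.arcsin_pos.mpr (by positivity))

theorem inradii_pos (hr : r ∈ inradii) : 0 < r :=
  (sub_pos.mpr one_div_sqrt_three_lt_one).trans_le hr.1

theorem sideA_lt (hr : r ∈ inradii) (h0 : 0 < paramH N r) (h1 : paramH N r ≤ sideL r) :
    sideA N r / 2 < paramH N r := by
  have hl := sideL_le hr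
  have hpi := Real.pi_pos
  have hs : 0 < Real.sin (paramH N r) := Real.sin_pos_of_pos_of_lt_pi h0 (by linarith)
  rw [sideA, mul_div_cancel_left₀ _ two_ne_zero,
    Real.arcsin_lt_iff_lt_sin' ⟨by linarith, by linarith⟩]
  nlinarith [inradii_pos hr]

/-- From `sin h - sin (ℓ - h) = 2 sin (h - ℓ / 2) cos (ℓ / 2)`. Comparing `a / 2` with `h - ℓ / 2`
thus becomes a question about the sign of `sin (ℓ - h)`. -/
theorem sin_sub_eq (hr : r ≤ 1 / 2) (h : ℝ) :
    (1 - r) * Real.sin h =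
      Real.sin (h - sideL r / 2) + (1 - r) * Real.sin (sideL r - h) := by
  have e1 : Real.sin h = Real.sin (h - sideL r / 2) * Real.cos (sideL r / 2) +
      Real.cos (h - sideL r / 2) * Real.sin (sideL r / 2) := by
    rw [← Real.sin_add]; ring_nf
  have e2 : Real.sin (sideL r - h) = Real.sin (sideL r / 2) * Real.cos (h - sideL r / 2) -
      Real.cos (sideL r / 2) * Real.sin (h - sideL r / 2) := by
    rw [← Real.sin_sub]; ring_nf
  rw [e1, e2]
  linear_combination Real.sin (h - sideL r / 2) * two_mul_cos_sideL hr

theorem le_sideA (hr : r ∈ inradii) (h0 : 0 < paramH N r) (h1 : paramH N r ≤ sideL r) :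
    paramH N r - sideL r / 2 ≤ sideA N r / 2 := by
  have hl := sideL_le hr
  have hpi := Real.pi_pos
  have hl0 := sideL_nonneg r
  rw [sideA, mul_div_cancel_left₀ _ two_ne_zero,
    Real.le_arcsin_iff_sin_le' ⟨by linarith, by linarith⟩, sin_sub_eq hr.2]
  have h2 := Real.sin_nonneg_of_nonneg_of_le_pi (x := sideL r - paramH N r) (by linarith)
    (by linarith)
  have : 0 ≤ 1 - r := by linarith [hr.2]
  nlinarith

theorem lt_sideA (hr : r ∈ inradii) (h0 : 0 < paramH N r) (h1 : paramH N r < sideL r) :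
    paramH N r - sideL r / 2 < sideA N r / 2 := by
  have hl := sideL_le hr
  have hpi := Real.pi_pos
  have hl0 := sideL_nonneg r
  rw [sideA, mul_div_cancel_left₀ _ two_ne_zero,
    Real.lt_arcsin_iff_sin_lt' ⟨by linarith, by linarith⟩, sin_sub_eq hr.2]
  have h2 := Real.sin_pos_of_pos_of_lt_pi (x := sideL r - paramH N r) (by linarith)
    (by linarith)
  have : 0 < 1 - r := by linarith [hr.2]
  nlinarith

theorem sideA_eq (hr : r ∈ inradii) (h1 : paramH N r = sideL r) : sideA N r = sideL r := by
  have hl := sideL_le hr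
  have hpi := Real.pi_pos
  have hl0 := sideL_nonneg r
  rw [sideA, sin_sub_eq hr.2, h1, sub_self, Real.sin_zero, mul_zero, add_zero,
    Real.arcsin_sin (by linarith) (by linarith)]
  ring

/-- As `(N - 1/2) ℓ = π/2 - h` and `τ = π/2 - a/2`, the relation for `cos τ` is the definition of
`a`, and `τ ≤ N ℓ` is `a / 2 ≥ h - ℓ / 2`. For `N = 1` the bounds `h ≤ ℓ ≤ π / 3` leave only `h =
ℓ`. -/
theorem isShape (hr : r ∈ inradii) (hr2 : r < 1 / 2) (hN : 1 ≤ N) (h0 : 0 < paramH N r)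
    (h1 : paramH N r ≤ sideL r) : IsShape N (1 - r) (sideL r) (angleτ N r) := by
  have hh : (N - 1 / 2) * sideL r = Real.pi / 2 - paramH N r := by rw [paramH]; ring
  have ha := sideA_pos hr h0 h1
  have hpi := Real.pi_pos
  have hl := sideL_le hr
  have halt := sideA_lt hr h0 h1
  have hale := le_sideA hr h0 h1
  refine ⟨hN, by linarith [inradii_pos hr], two_mul_cos_sideL hr.2, sideL_pos hr2, sideL_le hr,
    ?_, ?_, ?_, ?_, ?_⟩
  · rw [hh, angleτ]; linarith
  · rw [angleτ]; nlinarith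
  · rw [angleτ]; linarith
  · rw [hh, angleτ, Real.cos_pi_div_two_sub, Real.cos_pi_div_two_sub, sideA,
      mul_div_cancel_left₀ _ two_ne_zero, Real.sin_arcsin]
    · have := Real.sin_nonneg_of_nonneg_of_le_pi (x := paramH N r) h0.le (by linarith)
      nlinarith [inradii_pos hr]
    · have := Real.sin_le_one (paramH N r)
      have := Real.sin_nonneg_of_nonneg_of_le_pi (x := paramH N r) h0.le (by linarith)
      nlinarith [inradii_pos hr]
  · rintro rfl
    have h2 : paramH 1 r = Real.pi / 2 - sideL r / 2 := by rw [paramH]; push_cast; ring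
    have h3 : paramH 1 r = sideL r := by linarith
    rw [angleτ, sideA_eq hr h3]
    linarith

end

/-- Every inradius below `1 / 2` belongs to one of the intervals between consecutive
regular inradii. -/
theorem exists_paramH_mem {r : ℝ} (hr : r ∈ inradii) (hr2 : r < 1 / 2) :
    ∃ N : ℕ, 1 ≤ N ∧ 0 < paramH N r ∧ paramH N r ≤ sideL r := by
  have hl := sideL_pos hr2
  have hpi := Real.pi_pos
  have hex : ∃ N : ℕ, Real.pi ≤ (2 * N + 1) * sideL r := by
    obtain ⟨N, hN⟩ := exists_nat_ge (Real.pi / sideL r)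
    refine ⟨N, ?_⟩
    rw [div_le_iff₀ hl] at hN
    have : (0 : ℝ) ≤ N := Nat.cast_nonneg N
    nlinarith
  classical
  -- The least `N` with `π ≤ (2N + 1) ℓ`: this inequality is `h ≤ ℓ`, and minimality at `N - 1` is
  -- `0 < h`.
  obtain ⟨N, hN, hmin⟩ : ∃ N : ℕ, Real.pi ≤ (2 * N + 1) * sideL r ∧
      ∀ M < N, (2 * M + 1) * sideL r < Real.pi :=
    ⟨Nat.find hex, Nat.find_spec hex, fun M hM => not_le.mp (Nat.find_min hex hM)⟩
  have hN1 : 1 ≤ N := by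
    by_contra h
    rw [show N = 0 by omega] at hN
    have := sideL_le hr
    norm_num at hN
    linarith
  refine ⟨N, hN1, ?_, ?_⟩
  · have := hmin (N - 1) (by omega)
    rw [Nat.cast_sub hN1] at this
    rw [paramH]
    push_cast at this
    linarith
  · rw [paramH]
    linarith

theorem paramH_lt_iff {N : ℕ} {r : ℝ} (hr : r ≤ 1 / 2) (hN : 1 ≤ N) :
    paramH N r < sideL r ↔ r < regularInradius (2 * N + 1) := by
  rw [lt_regularInradius_iff hr (by omega), paramH, div_lt_iff₀ (by positivity)]
  push_cast
  constructor <;> intro h <;> linarith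

theorem paramH_eq_iff {N : ℕ} {r : ℝ} (hr : r ≤ 1 / 2) (hN : 1 ≤ N) :
    paramH N r = sideL r ↔ r = regularInradius (2 * N + 1) := by
  rw [eq_regularInradius_iff hr (by omega), paramH, eq_div_iff (by positivity)]
  push_cast
  constructor <;> intro h <;> linarith

theorem paramH_pos_iff {N : ℕ} {r : ℝ} (hr : r ≤ 1 / 2) (hN : 2 ≤ N) :
    0 < paramH N r ↔ regularInradius (2 * N - 1) < r := by
  have h1 := lt_regularInradius_iff hr (m := 2 * N - 1) (by omega)
  have h2 := eq_regularInradius_iff hr (m := 2 * N - 1) (by omega)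
  have hN' : (2 : ℝ) ≤ N := by exact_mod_cast hN
  have hpos : (0 : ℝ) < 2 * N - 1 := by linarith
  rw [Nat.cast_sub (by omega)] at h1 h2
  push_cast at h1 h2
  have h3 : 0 < paramH N r ↔ sideL r < Real.pi / (2 * N - 1) := by
    rw [paramH, lt_div_iff₀ hpos]
    constructor <;> intro h <;> linarith
  rw [h3]
  constructor
  · intro h
    refine lt_of_not_ge fun hle => ?_
    rcases hle.lt_or_eq with h' | h'
    · exact absurd (h1.mp h') (not_lt.mpr h.le)
    · exact absurd (h2.mp h') h.ne
  · intro h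
    refine lt_of_not_ge fun hle => ?_
    rcases hle.lt_or_eq with h' | h'
    · exact absurd (h1.mpr h') (not_lt.mpr h.le)
    · exact absurd (h2.mpr h'.symm) (ne_of_gt h)

/-- The extremal shape in standard position. -/
noncomputable def shapeBody (N : ℕ) (r : ℝ) : Set ℂ :=
  IsBreaks.body (brk N (sideL r) (angleτ N r)) (vtx N (1 - r) (sideL r) (angleτ N r))

theorem exists_eq_neg_intCast (N : ℕ) (k : ZMod (2 * N + 1)) :
    ∃ m : ℤ, -N ≤ m ∧ m ≤ N ∧ k = ((-m : ℤ) : ZMod (2 * N + 1)) := by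
  obtain ⟨h1, h2⟩ := balMod_mem N (-(k.val : ℤ))
  refine ⟨_, h1, h2, ?_⟩
  have h3 := balMod_add N (-(k.val : ℤ))
  conv_lhs => rw [IsBreaks.exists_intCast_eq N k]
  rw [ZMod.intCast_eq_intCast_iff_dvd_sub]
  refine ⟨balDiv N (-(k.val : ℤ)), ?_⟩
  push_cast
  linear_combination h3

/-- For `h = ℓ` also `a = ℓ` and `τ = N ℓ`, so all breaks are spaced by `ℓ`, including the gap `π -
2τ` across the period. -/
theorem isRegular_shapeBody {N : ℕ} {r : ℝ} (hr : r ∈ inradii) (hr2 : r < 1 / 2) (hN : 1 ≤ N)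
    (hh : paramH N r = sideL r) :
    IsReuleauxPolygon N (shapeBody N r) (IsBreaks.vert N (vtx N (1 - r) (sideL r) (angleτ N r)))
      (IsBreaks.angleα N (brk N (sideL r) (angleτ N r)))
      (IsBreaks.angleβ N (brk N (sideL r) (angleτ N r))) ∧
    ∀ k, IsBreaks.angleβ N (brk N (sideL r) (angleτ N r)) k -
      IsBreaks.angleα N (brk N (sideL r) (angleτ N r)) k = sideL r := by
  have hs := isShape hr hr2 hN (by rw [hh]; exact sideL_pos hr2) hh.le
  refine ⟨hs.isBreaks.isReuleauxPolygon hs.isConvexBody, fun k => ?_⟩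
  obtain ⟨m, h1, h2, rfl⟩ := exists_eq_neg_intCast N k
  have hτ : angleτ N r = N * sideL r := by
    rw [angleτ, sideA_eq hr hh]
    rw [paramH] at hh
    linarith
  have hval : ∀ j : ℤ, -N ≤ j → j ≤ N → brk N (sideL r) (angleτ N r) j = j * sideL r := by
    intro j h1 h2
    rcases h2.lt_or_eq with h2 | h2
    · rcases h1.lt_or_eq with h1 | h1
      · exact IsShape.brk_inner h1 h2
      · rw [← h1, hs.brk_neg_N, hτ]; push_cast; ring
    · rw [h2, IsShape.brk_N, hτ]; push_cast; ring
  rw [hs.isBreaks.len_intCast, neg_neg, hval m h1 h2]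
  rcases h2.lt_or_eq with h2 | h2
  · rw [hval _ (by omega) (by omega)]; push_cast; ring
  · rw [h2, hs.brk_N_add_one, hτ]
    rw [paramH] at hh
    push_cast
    linarith

theorem isOneClusterPolygon_shapeBody {N : ℕ} {r : ℝ} (hr : r ∈ inradii) (hN : 2 ≤ N)
    (h0 : 0 < paramH N r) (h1 : paramH N r < sideL r) :
    IsOneClusterPolygon N r (shapeBody N r) := by
  have hr2 : r < 1 / 2 := by
    refine hr.2.lt_of_ne fun h => ?_
    have := (paramH_lt_iff hr.2 (by omega)).mp h1
    linarith [regularInradius_lt_half (m := 2 * N + 1) (by omega)]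
  have hs := isShape hr hr2 (by omega) h0 h1.le
  have hb := hs.isBreaks
  have hR := hs.R_pos
  have hl := hs.l_pos
  have hτlt : angleτ N r < N * sideL r := by
    have := lt_sideA hr h0 h1
    rw [angleτ]
    rw [paramH] at this
    linarith
  have hvN : ‖vtx N (1 - r) (sideL r) (angleτ N r) N‖ < 1 - r ∧
      r < ‖vtx N (1 - r) (sideL r) (angleτ N r) N‖ := by
    have hlow := hs.lower
    rw [IsShape.vtx_N, neg_smul, norm_neg, norm_sg_smul]
    constructor
    · refine hs.norm_cis_sub_lt ?_
      rw [abs_of_pos (by linarith)]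
      linarith
    · rw [← sq_lt_sq₀ (inradii_pos hr).le (norm_nonneg _), IsShape.norm_cis_sub_sq]
      have : Real.cos (angleτ N r - (N - 1 / 2) * sideL r) < 1 := by
        refine (Real.cos_lt_cos_of_nonneg_of_le_pi le_rfl ?_ (by linarith)).trans_eq Real.cos_zero
        linarith [hs.l_le, Real.pi_pos]
      nlinarith
  have hmem : ∀ j : ℤ, -N ≤ j → j < N → vtx N (1 - r) (sideL r) (angleτ N r) j ∈
      sphere (0 : ℂ) (1 - r) := fun j h1 h2 => by
    rw [mem_sphere_zero_iff_norm, hs.norm_vtx h1 h2]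
  have hQs : ∀ j : ℤ, vtx N (1 - r) (sideL r) (angleτ N r) (j + (2 * N + 1)) =
      vtx N (1 - r) (sideL r) (angleτ N r) j := hb.Q_add
  have hk : ∀ j : ℤ, (((-N : ℤ) : ZMod (2 * N + 1)) + (j : ℤ)) =
      ((-(N - j) : ℤ) : ZMod (2 * N + 1)) := fun j => by push_cast; ring
  have hk1 : ((-N : ℤ) : ZMod (2 * N + 1)) + 1 = ((-(N - 1) : ℤ) : ZMod (2 * N + 1)) := by
    simpa using hk 1
  have hkm1 : ((-N : ℤ) : ZMod (2 * N + 1)) - 1 = ((-(N + 1) : ℤ) : ZMod (2 * N + 1)) := by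
    push_cast; ring
  have hk2 : ((-N : ℤ) : ZMod (2 * N + 1)) + 2 = ((-(N - 2) : ℤ) : ZMod (2 * N + 1)) := by
    push_cast; ring
  have hkm2 : ((-N : ℤ) : ZMod (2 * N + 1)) - 2 = ((-(N + 2) : ℤ) : ZMod (2 * N + 1)) := by
    push_cast; ring
  -- The index `N + 1` is replaced by `-N`, which lies in the window where vertices and breaks are
  -- explicit.
  have hkm1' : ((-N : ℤ) : ZMod (2 * N + 1)) - 1 = ((-(-N) : ℤ) : ZMod (2 * N + 1)) := by
    rw [hkm1, ZMod.intCast_eq_intCast_iff_dvd_sub]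
    exact ⟨1, by push_cast; ring⟩
  have htτ : angleτ N r - (N - 1) * sideL r = sideB N r := by
    rw [angleτ, sideB, paramH]; ring
  refine ⟨IsBreaks.vert N (vtx N (1 - r) (sideL r) (angleτ N r)),
    IsBreaks.angleα N (brk N (sideL r) (angleτ N r)),
    IsBreaks.angleβ N (brk N (sideL r) (angleτ N r)), 0, ((-N : ℤ) : ZMod (2 * N + 1)),
    hb.isReuleauxPolygon hs.isConvexBody, ?_, ?_, hs.body_subset, ?_, ?_, ?_, ?_, ?_, ?_, ?_, ?_,
    ?_, ?_⟩
  · have := hs.body_mem_admissible.2.2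
    rwa [sub_sub_cancel] at this
  · have := hs.closedBall_subset_body
    rw [sub_sub_cancel] at this
    exact ball_subset_closedBall.trans this
  · intro j
    obtain ⟨m, hm1, hm2, rfl⟩ := exists_eq_neg_intCast N j
    rw [hb.arc_neg_intCast]
    rcases hm2.lt_or_eq with hm2 | hm2
    · obtain ⟨-, hb2, hb3, -⟩ := hs.brk_bounds hm1 hm2
      -- The contact point lies on the ray from the vertex through the centre 0, at distance `1 - (1
      -- - r) = r` beyond the centre.
      refine iff_of_true ⟨_, ⟨(m + 1 / 2) * sideL r, ⟨hb2.le, hb3.le⟩, rfl⟩, ?_⟩ ?_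
      · rw [mem_sphere_zero_iff_norm]
        simp only
        rw [IsShape.vtx_of_lt hm1 hm2, neg_smul, neg_add_eq_sub, ← smul_sub, norm_sg_smul,
          show cis ((m + 1 / 2) * sideL r) - (1 - r) • cis ((m + 1 / 2) * sideL r) =
            r • cis ((m + 1 / 2) * sideL r) by rw [sub_smul, one_smul]; ring, norm_smul, norm_cis,
          mul_one, Real.norm_of_nonneg (inradii_pos hr).le]
      · rw [Ne, ZMod.intCast_eq_intCast_iff_dvd_sub]
        rintro ⟨c, hc⟩
        push_cast at hc
        have hc1 : (m : ℤ) - N = (2 * N + 1) * c := by linarith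
        have : c < 0 := by by_contra h; nlinarith
        have : -1 < c := by by_contra h; nlinarith
        omega
    · subst hm2
      refine iff_of_false ?_ (by simp)
      rintro ⟨_, ⟨φ, -, rfl⟩, hφ⟩
      rw [mem_sphere_zero_iff_norm] at hφ
      -- The vertex opposite to this side has norm less than `1 - r`, so every point at distance 1
      -- from it has norm greater than `r`.
      have h3 := norm_sub_norm_le (sg N • cis φ) (-vtx N (1 - r) (sideL r) (angleτ N r) N)
      rw [norm_sg_smul, norm_cis, norm_neg, sub_neg_eq_add, add_comm (sg N • cis φ)] at h3
      simp only at hφ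
      linarith [hvN.1]
  · rw [hk1, hb.vert_intCast, neg_neg]
    exact hmem _ (by omega) (by omega)
  · rw [hkm1', hb.vert_intCast, neg_neg]
    exact hmem _ (by omega) (by omega)
  · rw [hb.len_intCast, neg_neg, hs.brk_N_add_one, IsShape.brk_N, angleτ]
    ring
  · rw [hb.vert_intCast, neg_neg, Set.mem_sdiff, mem_ball_zero_iff, mem_closedBall_zero_iff, not_le]
    exact hvN
  · rw [hk2, hb.vert_intCast, neg_neg]
    exact hmem _ (by omega) (by omega)
  · rw [hkm2, hb.vert_intCast, neg_neg, show (N : ℤ) + 2 = -N + 1 + (2 * N + 1) by ring, hQs]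
    exact hmem _ (by omega) (by omega)
  · rw [hk1, hb.len_intCast, neg_neg, sub_add_cancel, IsShape.brk_N,
      IsShape.brk_inner (by omega) (by omega), ← htτ]
    push_cast
    ring
  · rw [hkm1', hb.len_intCast, neg_neg, IsShape.brk_inner (by omega) (by omega), hs.brk_neg_N,
      ← htτ]
    push_cast
    ring
  · intro j hj0 hj1 hj2
    obtain ⟨m, hm1, hm2, rfl⟩ := exists_eq_neg_intCast N j
    have hmN : m ≠ N := by rintro rfl; exact hj0 rfl
    have hmN1 : m ≠ N - 1 := by rintro rfl; exact hj1 hk1.symm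
    have hmN2 : m ≠ -N := by rintro rfl; exact hj2 hkm1'.symm
    have e1 : ((-m : ℤ) : ZMod (2 * N + 1)) + 1 = ((-(m - 1) : ℤ) : ZMod (2 * N + 1)) := by
      push_cast; ring
    have e2 : ((-m : ℤ) : ZMod (2 * N + 1)) - 1 = ((-(m + 1) : ℤ) : ZMod (2 * N + 1)) := by
      push_cast; ring
    rw [e1, e2, hb.vert_intCast, hb.vert_intCast, hb.len_intCast, neg_neg, neg_neg, neg_neg]
    refine ⟨hmem _ (by omega) (by omega), hmem _ (by omega) (by omega), ?_⟩
    rw [IsShape.brk_inner (by omega) (by omega), IsShape.brk_inner (by omega) (by omega)]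
    push_cast
    ring

theorem exists_isOmega {r : ℝ} (hr : r ∈ inradii) : ∃ Ω : Set ℂ, IsOmega r Ω := by
  rcases hr.2.lt_or_eq with hr2 | hr2
  · obtain ⟨N, hN, h0, h1⟩ := exists_paramH_mem hr hr2
    rcases h1.lt_or_eq with h1 | h1
    · have hN2 : 2 ≤ N := by
        by_contra h
        rw [show N = 1 by omega, paramH] at h1
        have := sideL_le hr
        push_cast at h1
        linarith
      exact ⟨_, Or.inr (Or.inl ⟨N, hN2, (paramH_pos_iff hr.2 hN2).mp h0,
        (paramH_lt_iff hr.2 hN).mp h1, isOneClusterPolygon_shapeBody hr hN2 h0 h1⟩)⟩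
    · obtain ⟨hp, hlen⟩ := isRegular_shapeBody hr hr2 hN h1
      exact ⟨_, Or.inl ⟨N, hN, (paramH_eq_iff hr.2 hN).mp h1, _, _, _, hp,
        fun j k => by rw [hlen, hlen]⟩⟩
  · exact ⟨_, Or.inr (Or.inr ⟨hr2, 0, rfl⟩)⟩

theorem admissible_nonempty {r : ℝ} (hr : r ∈ inradii) : (admissible r).Nonempty := by
  rcases hr.2.lt_or_eq with hr2 | hr2
  · obtain ⟨N, hN, h0, h1⟩ := exists_paramH_mem hr hr2
    have := (isShape hr hr2 hN h0 h1).body_mem_admissible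
    rw [sub_sub_cancel] at this
    exact ⟨_, this⟩
  · refine ⟨closedBall 0 (1 / 2), mem_admissible_iff.mpr ⟨?_, CW_closedBall, ?_⟩⟩
    · exact CW_closedBall.isConvexBody (isCompact_closedBall 0 _) (convex_closedBall 0 _)
        (by norm_num) subset_rfl
    · refine le_antisymm ?_ ?_
      · rw [hr2]
        refine (circR_le ⟨0, by simp⟩ subset_rfl).trans (by norm_num)
      · rw [hr2]
        have := CW_closedBall.half_le_circR (isCompact_closedBall 0 _)
        linarith

end ConstWidth

/-! ### Uniqueness of the shapes up to congruence -/

namespace ConstWidth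

open Filter Topology

/-! ### The side lengths determine a Reuleaux polygon up to congruence -/

/-- A linear functional that separates a point of `A` from `B` attains its maximum over `A` on the
frontier of `A`. -/
theorem subset_of_frontier_subset {A B : Set ℂ} (hA : IsCompact A) (hB : IsClosed B)
    (hBc : Convex ℝ B) (hBne : B.Nonempty) (h : frontier A ⊆ B) : A ⊆ B := by
  intro x hx
  by_contra hxB
  obtain ⟨u, hu, δ, hδ, hsep⟩ := exists_norm_eq_one_separating hB hBc hBne hxB
  obtain ⟨a, haA, hmax⟩ := hA.exists_isMaxOn ⟨x, hx⟩
    (f := fun w => (inner ℝ u w : ℝ)) (by fun_prop)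
  have ha : a ∈ frontier A :=
    ⟨subset_closure haA, notMem_interior_of_inner_le hu fun w hw => hmax hw⟩
  have h1 := hsep a (h ha)
  have h2 : inner ℝ u x ≤ (inner ℝ u a : ℝ) := hmax hx
  linarith

theorem IsConvexBody.eq_of_frontier_eq {A B : Set ℂ} (hA : IsConvexBody A) (hB : IsConvexBody B)
    (h : frontier A = frontier B) : A = B :=
  Set.Subset.antisymm
    (subset_of_frontier_subset hA.1 hB.1.isClosed hB.2.1 (hB.2.2.mono interior_subset)
      (h ▸ hB.1.isClosed.frontier_subset))
    (subset_of_frontier_subset hB.1 hA.1.isClosed hA.2.1 (hA.2.2.mono interior_subset)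
      (h ▸ hA.1.isClosed.frontier_subset))

/-- The motion `z ↦ q + u * (z - p)`. -/
noncomputable def motion (u : Circle) (p q : ℂ) : ℂ ≃ᵢ ℂ :=
  ((IsometryEquiv.subRight p).trans (rotation u).toIsometryEquiv).trans (IsometryEquiv.addLeft q)

theorem motion_apply (u : Circle) (p q z : ℂ) : motion u p q z = q + u * (z - p) := rfl

theorem IsConvexBody.image_motion {A : Set ℂ} (hA : IsConvexBody A) (u : Circle) (p q : ℂ) :
    IsConvexBody (motion u p q '' A) := by
  refine ⟨hA.1.image (motion u p q).continuous, ?_, ?_⟩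
  · rintro _ ⟨x, hx, rfl⟩ _ ⟨y, hy, rfl⟩ a b ha hb hab
    refine ⟨a • x + b • y, hA.2.1 hx hy ha hb hab, ?_⟩
    have : (a : ℂ) + b = 1 := by exact_mod_cast hab
    simp only [motion_apply, Complex.real_smul]
    linear_combination (u * p - q) * this
  · have := (motion u p q).toHomeomorph.image_interior A
    change motion u p q '' _ = interior (motion u p q '' A) at this
    rw [← this]
    exact hA.2.2.image _

theorem cis_sub (a b : ℝ) : cis (a - b) = cis a / cis b := by
  unfold cis
  rw [← Complex.exp_sub]
  push_cast
  ring_nf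

theorem cis_ne_zero (a : ℝ) : cis a ≠ 0 := Complex.exp_ne_zero _

namespace IsReuleauxPolygon

variable {N : ℕ} {Ω Ω' : Set ℂ} {P P' : ZMod (2 * N + 1) → ℂ} {α β α' β' : ZMod (2 * N + 1) → ℝ}

theorem shift (h : IsReuleauxPolygon N Ω P α β) (m : ZMod (2 * N + 1)) :
    IsReuleauxPolygon N Ω (fun k => P (k + m)) (fun k => α (k + m)) (fun k => β (k + m)) where
  convexBody := h.convexBody
  constantWidth := h.constantWidth
  vertices_distinct i j hij := add_right_cancel (h.vertices_distinct hij)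
  angle_lt k := h.angle_lt _
  angle_lt_add k := h.angle_lt_add _
  next_vertex k := by rw [← h.next_vertex, add_right_comm]
  prev_vertex k := by rw [← h.prev_vertex, sub_add_eq_add_sub]
  frontier_eq := by
    rw [h.frontier_eq]
    exact ((Equiv.addRight m).surjective.iUnion_comp fun k => arc (P k) (α k) (β k)).symm

theorem cis_β (h : IsReuleauxPolygon N Ω P α β) (k : ZMod (2 * N + 1)) :
    cis (β (k + 1)) = -cis (α k) := by
  have h1 := h.next_vertex k
  have h2 := h.prev_vertex (k + 1)
  rw [add_sub_cancel_right] at h2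
  unfold cis
  linear_combination -h1 - h2

theorem cis_α (h : IsReuleauxPolygon N Ω P α β) (k : ZMod (2 * N + 1)) :
    cis (α (k + 1)) = -cis (α k) / cis (β (k + 1) - α (k + 1)) := by
  rw [cis_sub, h.cis_β]
  have := cis_ne_zero (α k)
  have := cis_ne_zero (α (k + 1))
  field_simp

/-- The recursion `cis_α` determines the direction of each side from the previous one and the
length, up to the initial direction; the vertices follow from the directions. Working with `cis`
avoids the ambiguity of the angles modulo `2π`. -/
theorem exists_motion (h : IsReuleauxPolygon N Ω P α β) (h' : IsReuleauxPolygon N Ω' P' α' β')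
    (hlen : ∀ k, β' k - α' k = β k - α k) : ∃ T : ℂ ≃ᵢ ℂ, T '' Ω = Ω' := by
  obtain ⟨u, hu⟩ : ∃ u : Circle, (u : ℂ) = cis (α' 0) / cis (α 0) :=
    ⟨⟨_, mem_sphere_zero_iff_norm.mpr (by rw [← cis_sub, norm_cis])⟩, rfl⟩
  have key : ∀ m : ℕ, cis (α' (m : ZMod (2 * N + 1))) = u * cis (α (m : ZMod (2 * N + 1))) ∧
      P' (m : ZMod (2 * N + 1)) = P' 0 + u * (P (m : ZMod (2 * N + 1)) - P 0) := by
    intro m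
    induction m with
    | zero =>
      have := cis_ne_zero (α 0)
      rw [Nat.cast_zero, hu]
      refine ⟨by field_simp, by ring⟩
    | succ m ih =>
      rw [Nat.cast_succ, h'.cis_α, hlen, h.cis_α, h'.next_vertex, h.next_vertex, ih.1]
      have h1 := ih.1
      have h2 := ih.2
      unfold cis at h1
      refine ⟨by ring, by linear_combination h1 + h2⟩
  have key' : ∀ k, cis (α' k) = u * cis (α k) ∧ P' k = P' 0 + u * (P k - P 0) := by
    intro k
    have := key k.val
    rwa [ZMod.natCast_zmod_val] at this
  refine ⟨motion u (P 0) (P' 0), ?_⟩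
  refine (h.convexBody.image_motion u _ _).eq_of_frontier_eq h'.convexBody ?_
  have hf := (motion u (P 0) (P' 0)).toHomeomorph.image_frontier Ω
  change motion u (P 0) (P' 0) '' _ = frontier (motion u (P 0) (P' 0) '' Ω) at hf
  rw [← hf, h.frontier_eq, h'.frontier_eq, Set.image_iUnion]
  refine Set.iUnion_congr fun k => ?_
  have hk := hlen k
  have hmap : ∀ θ : ℝ, motion u (P 0) (P' 0) (P k + Complex.exp (θ * Complex.I)) =
      P' k + Complex.exp ((θ - α k + α' k : ℝ) * Complex.I) := by
    intro θ
    change _ = _ + cis _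
    rw [cis_add, cis_sub, (key' k).1, (key' k).2, motion_apply]
    change _ + _ * (_ + cis θ - _) = _
    have := cis_ne_zero (α k)
    field_simp
    ring
  apply Set.Subset.antisymm
  · rintro _ ⟨_, ⟨θ, hθ, rfl⟩, rfl⟩
    exact ⟨θ - α k + α' k, ⟨by linarith [hθ.1], by linarith [hθ.2]⟩, (hmap θ).symm⟩
  · rintro _ ⟨θ, hθ, rfl⟩
    refine ⟨_, ⟨θ - α' k + α k, ⟨by linarith [hθ.1], by linarith [hθ.2]⟩, rfl⟩, ?_⟩
    simp only
    rw [hmap, show θ - α' k + α k - α k + α' k = θ by ring]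

/-! ### The sides of a regular polygon -/

theorem cw (h : IsReuleauxPolygon N Ω P α β) : CW Ω :=
  (hasConstantWidth_iff h.convexBody.1 (h.convexBody.2.2.mono interior_subset)).mp h.constantWidth

theorem side_mem (h : IsReuleauxPolygon N Ω P α β) {k : ZMod (2 * N + 1)} {θ : ℝ}
    (hθ : θ ∈ Set.Icc (α k) (β k)) : P k + cis θ ∈ Ω := by
  refine h.convexBody.1.isClosed.frontier_subset ?_
  rw [h.frontier_eq]
  exact Set.mem_iUnion.mpr ⟨k, θ, hθ, rfl⟩

theorem vertex_mem (h : IsReuleauxPolygon N Ω P α β) (k : ZMod (2 * N + 1)) : P k ∈ Ω := by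
  have h1 := h.next_vertex (k - 1)
  rw [sub_add_cancel] at h1
  rw [h1]
  exact h.side_mem ⟨le_rfl, (h.angle_lt _).le⟩

/-- Different sides have different normals. -/
theorem eq_of_cis_eq (h : IsReuleauxPolygon N Ω P α β) {j k : ZMod (2 * N + 1)} {θ φ : ℝ}
    (hθ : θ ∈ Set.Icc (α j) (β j)) (hφ : φ ∈ Set.Icc (α k) (β k)) (heq : cis θ = cis φ) :
    j = k := by
  refine h.vertices_distinct (sub_eq_zero.mp (norm_eq_zero.mp ?_))
  have h1 := h.cw.diam _ (h.side_mem hθ) _ (h.vertex_mem k)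
  have h2 := h.cw.diam _ (h.side_mem hφ) _ (h.vertex_mem j)
  rw [← heq] at h2
  -- Both diagonals have length at most 1 by the diameter bound while one side is the unit vector
  -- `cis θ`, so the other side `P j - P k` vanishes.
  have hp := parallelogram_law_with_norm ℝ (cis θ) (P j - P k)
  rw [show cis θ + (P j - P k) = P j + cis θ - P k by ring,
    show cis θ - (P j - P k) = P k + cis θ - P j by ring, norm_cis] at hp
  nlinarith [norm_nonneg (P j + cis θ - P k), norm_nonneg (P k + cis θ - P j),
    norm_nonneg (P j - P k)]

theorem cis_α_natCast (h : IsReuleauxPolygon N Ω P α β) {s : ℝ} (hs : ∀ k, β k - α k = s) (m : ℕ) :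
    cis (α (m : ZMod (2 * N + 1))) = cis (α 0 + m * (Real.pi - s)) := by
  induction m with
  | zero => simp
  | succ m ih =>
    rw [Nat.cast_succ, h.cis_α, hs, ih, ← cis_add_pi, ← cis_sub]
    congr 1
    push_cast
    ring

/-- The side directions turn by `π - s` at each step and return after `2N + 1` steps, so `s = c π /
(2N + 1)` with `c = 2N + 1 - 2q` odd and positive. For `c ≥ 2` a second side would begin at a normal
already belonging to side 0, which is impossible. -/
theorem length_eq (h : IsReuleauxPolygon N Ω P α β) (hN : 1 ≤ N) {s : ℝ}
    (hs : ∀ k, β k - α k = s) : s = Real.pi / (2 * N + 1) := by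
  have hpi := Real.pi_pos
  have hn : (0 : ℝ) < 2 * N + 1 := by positivity
  have hs0 : 0 < s := by linarith [hs 0, h.angle_lt 0]
  obtain ⟨q, hq⟩ : ∃ q : ℤ, (2 * N + 1) * (Real.pi - s) = q * (2 * Real.pi) := by
    have h1 := h.cis_α_natCast hs (2 * N + 1)
    rw [ZMod.natCast_self, cis_add] at h1
    have h2 : cis ((2 * N + 1 : ℕ) * (Real.pi - s)) = 1 :=
      mul_left_cancel₀ (cis_ne_zero (α 0)) (by rw [← h1, mul_one])
    obtain ⟨q, hq⟩ := Complex.exp_eq_one_iff.mp h2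
    refine ⟨q, ?_⟩
    have := congrArg Complex.im hq
    simp at this
    linarith
  have hsq : s = Real.pi * (2 * N + 1 - 2 * q) / (2 * N + 1) := by
    rw [eq_div_iff hn.ne']
    linarith
  have hc0 : 0 < 2 * (N : ℤ) + 1 - 2 * q := by
    rw [hsq] at hs0
    have := pos_of_mul_pos_right ((div_pos_iff_of_pos_right hn).mp hs0) hpi.le
    exact_mod_cast this
  suffices hc : 2 * (N : ℤ) + 1 - 2 * q = 1 by
    have : (2 * N + 1 - 2 * q : ℝ) = 1 := by exact_mod_cast hc
    rw [hsq, this, mul_one]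
  by_contra hc
  have hc2 : 2 ≤ 2 * (N : ℤ) + 1 - 2 * q := by omega
  have hfact : Fact (1 < 2 * N + 1) := ⟨by omega⟩
  -- The side with index `m` begins at `m q` steps of `2π / (2N + 1)` from side 0. If `q` is a unit
  -- modulo `2N + 1`, some `m` gives one step, which is at most `s`; otherwise some `m ≠ 0` gives
  -- none.
  obtain ⟨m, e, hm, he, hme⟩ : ∃ (m : ZMod (2 * N + 1)) (e : ℤ), m ≠ 0 ∧ (e = 0 ∨ e = 1) ∧
      m * q = e := by
    by_cases hinj : Function.Injective fun m : ZMod (2 * N + 1) => m * q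
    · obtain ⟨m, hm⟩ := Finite.surjective_of_injective hinj 1
      refine ⟨m, 1, ?_, Or.inr rfl, by simpa using hm⟩
      rintro rfl
      simp at hm
    · obtain ⟨a, b, hab, hne⟩ : ∃ a b : ZMod (2 * N + 1), a * q = b * q ∧ a ≠ b := by
        simpa [Function.Injective] using hinj
      exact ⟨a - b, 0, sub_ne_zero.mpr hne, Or.inl rfl, by rw [sub_mul, hab]; simp⟩
  obtain ⟨p, hp⟩ : ∃ p : ℤ, (m.val : ℤ) * q = e + p * (2 * N + 1) := by
    have h1 : (((m.val : ℤ) * q : ℤ) : ZMod (2 * N + 1)) = (e : ℤ) := by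
      rw [← hme]
      push_cast
      rw [ZMod.natCast_zmod_val]
    rw [eq_comm, ZMod.intCast_eq_intCast_iff_dvd_sub] at h1
    obtain ⟨p, hp⟩ := h1
    refine ⟨p, ?_⟩
    push_cast at hp
    linarith
  have hα := h.cis_α_natCast hs m.val
  rw [ZMod.natCast_zmod_val] at hα
  have hval : α 0 + m.val * (Real.pi - s) =
      α 0 + e * (2 * Real.pi) / (2 * N + 1) + p * (2 * Real.pi) := by
    have hp' : (m.val : ℝ) * q = e + p * (2 * N + 1) := by exact_mod_cast hp
    rw [show Real.pi - s = q * (2 * Real.pi) / (2 * N + 1) by rw [eq_div_iff hn.ne']; linarith]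
    field_simp
    linear_combination 2 * Real.pi * hp'
  rw [hval, cis_add_int_mul_two_pi] at hα
  refine hm (h.eq_of_cis_eq ⟨le_rfl, (h.angle_lt m).le⟩ (k := 0) ⟨?_, ?_⟩ hα)
  · have : (0 : ℝ) ≤ e := by rcases he with rfl | rfl <;> simp
    have : 0 ≤ e * (2 * Real.pi) / (2 * N + 1) := by positivity
    linarith
  · have he1 : (e : ℝ) ≤ 1 := by rcases he with rfl | rfl <;> simp
    have hc' : (2 : ℝ) ≤ 2 * N + 1 - 2 * q := by exact_mod_cast hc2
    have : e * (2 * Real.pi) / (2 * N + 1) ≤ s := by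
      rw [hsq]
      refine div_le_div_of_nonneg_right ?_ hn.le
      nlinarith
    linarith [hs 0]

end IsReuleauxPolygon

/-- Consecutive values of `paramH` differ by `ℓ`, so only one can lie in `(0, ℓ]`. -/
theorem eq_of_paramH_mem {M N : ℕ} {r : ℝ} (hr : r < 1 / 2) (hM0 : 0 < paramH M r)
    (hM1 : paramH M r ≤ sideL r) (hN0 : 0 < paramH N r) (hN1 : paramH N r ≤ sideL r) : M = N := by
  have hl := sideL_pos hr
  rw [paramH] at hM0 hM1 hN0 hN1
  have h1 : (M : ℝ) < N + 1 := by
    by_contra h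
    nlinarith
  have h2 : (N : ℝ) < M + 1 := by
    by_contra h
    nlinarith
  have h1' : M < N + 1 := by exact_mod_cast h1
  have h2' : N < M + 1 := by exact_mod_cast h2
  omega

theorem IsOneClusterPolygon.exists_motion {N : ℕ} {r : ℝ} {Ω Ω' : Set ℂ}
    (h : IsOneClusterPolygon N r Ω) (h' : IsOneClusterPolygon N r Ω') :
    ∃ T : ℂ ≃ᵢ ℂ, T '' Ω = Ω' := by
  obtain ⟨P, α, β, O, k, hp, -, -, -, -, -, -, ha, -, -, -, hb1, hb2, hl⟩ := h
  obtain ⟨P', α', β', O', k', hp', -, -, -, -, -, -, ha', -, -, -, hb1', hb2', hl'⟩ := h'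
  -- The shift of indices matches the two non-tangent sides.
  refine (hp.shift (k - k')).exists_motion hp' fun j => ?_
  by_cases h0 : j = k'
  · rw [h0, ha', add_sub_cancel, ha]
  by_cases h1 : j = k' + 1
  · rw [h1, hb1', show k' + 1 + (k - k') = k + 1 by ring, hb1]
  by_cases h2 : j = k' - 1
  · rw [h2, hb2', show k' - 1 + (k - k') = k - 1 by ring, hb2]
  rw [(hl' j h0 h1 h2).2.2, (hl (j + (k - k')) ?_ ?_ ?_).2.2]
  · exact fun h => h0 (by linear_combination h)
  · exact fun h => h1 (by linear_combination h)
  · exact fun h => h2 (by linear_combination h)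

theorem IsOmega.exists_motion {N : ℕ} {r : ℝ} {Ω : Set ℂ} (h : IsOmega r Ω) (hr : r ∈ inradii)
    (hr2 : r < 1 / 2) (h0 : 0 < paramH N r) (h1 : paramH N r ≤ sideL r) :
    ∃ T : ℂ ≃ᵢ ℂ, T '' Ω = shapeBody N r := by
  rcases h with ⟨M, hM, hrM, P, α, β, hp, hlen⟩ | ⟨M, hM, hrM, hrM', hp⟩ | ⟨hr3, -⟩
  · have hH := (paramH_eq_iff hr.2 hM).mpr hrM
    obtain rfl := eq_of_paramH_mem hr2 (hH ▸ sideL_pos hr2) hH.le h0 h1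
    obtain ⟨hp', hlen'⟩ := isRegular_shapeBody hr hr2 hM hH
    refine hp.exists_motion hp' fun k => ?_
    rw [hlen', hp.length_eq hM fun j => hlen j k, (eq_regularInradius_iff hr.2 (by omega)).mp hrM]
    push_cast
    rfl
  · have hH0 := (paramH_pos_iff hr.2 hM).mpr hrM
    have hH1 := (paramH_lt_iff hr.2 (by omega)).mpr hrM'
    obtain rfl := eq_of_paramH_mem hr2 hH0 hH1.le h0 h1
    exact hp.exists_motion (isOneClusterPolygon_shapeBody hr hM hH0 hH1)
  · exact absurd hr3 hr2.ne

end ConstWidth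

/-! ### Continuity of the shapes in the Hausdorff distance -/

namespace ConstWidth

open Filter Topology

/-! ### Hausdorff distance -/

theorem hausdorffDist_le_of_subset_cthickening {A B : Set ℂ} (hA : IsCompact A) (hB : IsCompact B)
    {δ : ℝ} (hδ : 0 ≤ δ) (h1 : A ⊆ cthickening δ B) (h2 : B ⊆ cthickening δ A) :
    hausdorffDist A B ≤ δ := by
  rw [hB.cthickening_eq_biUnion_closedBall hδ] at h1
  rw [hA.cthickening_eq_biUnion_closedBall hδ] at h2
  refine hausdorffDist_le_of_mem_dist hδ (fun x hx => ?_) fun x hx => ?_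
  · simpa using h1 hx
  · simpa using h2 hx

theorem IsProfile.curveBody_subset_cthickening {c c' : ℂ} {ρ ρ' : ℝ → ℝ} {δ : ℝ}
    (h : ∀ θ, ‖curve c ρ θ - curve c' ρ' θ‖ ≤ δ) :
    curveBody c ρ ⊆ cthickening δ (curveBody c' ρ') := by
  refine closure_minimal (convexHull_min ?_ (convex_curveBody.cthickening δ)) isClosed_cthickening
  rintro _ ⟨θ, rfl⟩
  exact mem_cthickening_of_dist_le _ _ _ _ (curve_mem θ) (by rw [dist_eq_norm]; exact h θ)

/-- Both curves change by `-cis θ` under `θ ↦ θ + π`, so their difference has period `π`, and the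
angle may be taken in `[-π/2, π/2)`. -/
theorem IsProfile.norm_curve_sub_curve_le {c c' : ℂ} {ρ ρ' : ℝ → ℝ} (h : IsProfile c ρ)
    (h' : IsProfile c' ρ') (θ : ℝ) :
    ‖curve c ρ θ - curve c' ρ' θ‖ ≤
      ‖c - c'‖ + ∫ s in (-(Real.pi / 2))..(Real.pi / 2), |ρ s - ρ' s| := by
  have hpi := Real.pi_pos
  have hper : Function.Periodic (fun θ => curve c ρ θ - curve c' ρ' θ) Real.pi := fun θ => by
    simp only [h.curve_add_pi, h'.curve_add_pi]
    ring
  obtain ⟨φ, hφ, heq⟩ := hper.exists_mem_Ico hpi θ (-(Real.pi / 2))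
  have hint : IntervalIntegrable (fun s => |ρ s - ρ' s|) volume (-(Real.pi / 2)) (Real.pi / 2) := by
    refine (intervalIntegrable_const (c := (1 : ℝ)) (μ := volume)).mono_fun ?_ ?_
    · exact (continuous_abs.measurable.comp
        (h.measurable.sub h'.measurable)).aestronglyMeasurable
    · refine Eventually.of_forall fun s => ?_
      simp only [Real.norm_eq_abs, abs_abs, abs_one]
      rw [abs_le]
      constructor <;> linarith [h.nonneg s, h.le_one s, h'.nonneg s, h'.le_one s]
  have hsub : Set.uIoc 0 φ ⊆ Set.uIoc (-(Real.pi / 2)) (Real.pi / 2) := by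
    rw [Set.uIoc_of_le (a := -(Real.pi / 2)) (by linarith)]
    intro s hs
    rw [Set.mem_uIoc] at hs
    constructor <;> rcases hs with hs | hs <;> linarith [hs.1, hs.2, hφ.1, hφ.2]
  rw [heq, curve, curve, add_sub_add_comm,
    ← intervalIntegral.integral_sub (h.intervalIntegrable _ _) (h'.intervalIntegrable _ _)]
  refine (norm_add_le _ _).trans (add_le_add_right ?_ _)
  refine (intervalIntegral.norm_integral_le_integral_norm_uIoc).trans ?_
  rw [intervalIntegral.integral_of_le (by linarith),
    ← Set.uIoc_of_le (a := -(Real.pi / 2)) (by linarith)]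
  have hcongr : ∀ s, ‖ρ s • (Complex.I * cis s) - ρ' s • (Complex.I * cis s)‖ = |ρ s - ρ' s| := by
    intro s
    rw [← sub_smul, norm_smul, norm_mul, Complex.norm_I, norm_cis, one_mul, mul_one,
      Real.norm_eq_abs]
  simp only [hcongr]
  refine setIntegral_mono_set (intervalIntegrable_iff.mp hint)
    (Eventually.of_forall fun s => abs_nonneg _) (LE.le.eventuallyLE hsub)

/-! ### The profile of the extremal shapes -/

open Classical in
/-- The indicator of the even integers. -/
noncomputable def evenInd (j : ℤ) : ℝ := if Even j then 1 else 0

theorem stepProfile_eq {t : ℤ → ℝ} (ht : StrictMono t) {s : ℝ} {j : ℤ}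
    (hs : s ∈ Set.Ico (t j) (t (j + 1))) : stepProfile t s = evenInd j := by
  unfold evenInd
  split_ifs with hj
  · exact stepProfile_even hj hs
  · exact stepProfile_odd ht hj hs

namespace IsShape

variable {N : ℕ} {R ℓ τ : ℝ}

/-- Between `-τ` and `τ` the breaks are the multiples of `ℓ`, so the profile depends on neither `N`
nor `τ`. This permits comparing shapes with different numbers of sides. -/
theorem stepProfile_floor (h : IsShape N R ℓ τ) {s : ℝ} (hs : |s| < τ) :
    stepProfile (brk N ℓ τ) s = evenInd ⌊s / ℓ⌋ := by
  have hl := h.l_pos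
  obtain ⟨hs1, hs2⟩ := abs_lt.mp hs
  have hN := h.upper
  have hf1 : ⌊s / ℓ⌋ * ℓ ≤ s := (le_div_iff₀ hl).mp (Int.floor_le _)
  have hf2 : s < (⌊s / ℓ⌋ + 1) * ℓ := (div_lt_iff₀ hl).mp (Int.lt_floor_add_one _)
  have hjlt : ⌊s / ℓ⌋ < N := by
    have : (⌊s / ℓ⌋ : ℝ) < N := lt_of_mul_lt_mul_right (by linarith) hl.le
    exact_mod_cast this
  have hjge : -N ≤ ⌊s / ℓ⌋ := by
    have : (-N : ℝ) < ⌊s / ℓ⌋ + 1 := lt_of_mul_lt_mul_right (by linarith) hl.le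
    have : (-N : ℤ) < ⌊s / ℓ⌋ + 1 := by exact_mod_cast this
    omega
  refine stepProfile_eq h.isBreaks.strictMono ⟨?_, ?_⟩
  · rcases hjge.lt_or_eq with h1 | h1
    · rwa [brk_inner h1 hjlt]
    · rw [← h1, h.brk_neg_N]
      exact hs1.le
  · rcases (Int.add_one_le_of_lt hjlt).lt_or_eq with h1 | h1
    · rw [brk_inner (by omega) h1]
      push_cast
      exact hf2
    · rw [h1, brk_N]
      exact hs2

theorem stepProfile_right (h : IsShape N R ℓ τ) {s : ℝ} (h1 : τ < s) (h2 : s < Real.pi / 2) :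
    stepProfile (brk N ℓ τ) s = evenInd N := by
  refine stepProfile_eq h.isBreaks.strictMono ⟨?_, ?_⟩
  · rw [brk_N]
    exact h1.le
  · rw [h.brk_N_add_one]
    linarith [h.τ_lt]

theorem stepProfile_left (h : IsShape N R ℓ τ) {s : ℝ} (h1 : -(Real.pi / 2) < s) (h2 : s < -τ) :
    stepProfile (brk N ℓ τ) s = evenInd (-N - 1) := by
  have h3 := h.isBreaks.t_add (-N - 1)
  rw [show -(N : ℤ) - 1 + (2 * N + 1) = N by ring, brk_N] at h3
  refine stepProfile_eq h.isBreaks.strictMono ⟨?_, ?_⟩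
  · linarith [h.τ_lt]
  · rw [sub_add_cancel, h.brk_neg_N]
    exact h2

end IsShape

/-! ### Continuity of the shapes -/

theorem continuous_sideL : Continuous sideL := by
  unfold sideL
  fun_prop

theorem continuous_paramH (N : ℕ) : Continuous (paramH N) := by
  unfold paramH
  exact continuous_const.sub (continuous_const.mul continuous_sideL)

theorem continuous_angleτ (N : ℕ) : Continuous (angleτ N) := by
  unfold angleτ sideA
  have := continuous_paramH N
  have := Real.continuous_arcsin
  fun_prop

/-- The profile of the shape. -/
noncomputable def shapeProfile (N : ℕ) (r : ℝ) : ℝ → ℝ := stepProfile (brk N (sideL r) (angleτ N r))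

/-- The number `N` belonging to the inradius `r`. -/
def IsIndex (N : ℕ) (r : ℝ) : Prop := 1 ≤ N ∧ 0 < paramH N r ∧ paramH N r ≤ sideL r

theorem eventually_floor_eq {s r₀ : ℝ} (hr₀ : r₀ < 1 / 2) (hs : ∀ j : ℤ, s ≠ j * sideL r₀) :
    ∀ᶠ r in 𝓝 r₀, ⌊s / sideL r⌋ = ⌊s / sideL r₀⌋ := by
  have hl := sideL_pos hr₀
  have h1 : (⌊s / sideL r₀⌋ : ℝ) * sideL r₀ < s :=
    lt_of_le_of_ne ((le_div_iff₀ hl).mp (Int.floor_le _)) (hs _).symm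
  have h2 : s < (⌊s / sideL r₀⌋ + 1) * sideL r₀ := (div_lt_iff₀ hl).mp (Int.lt_floor_add_one _)
  have hc := continuous_sideL.tendsto r₀
  filter_upwards [(hc.const_mul (⌊s / sideL r₀⌋ : ℝ)).eventually_lt_const h1,
    (hc.const_mul (⌊s / sideL r₀⌋ + 1 : ℝ)).eventually_const_lt h2,
    hc.eventually_const_lt hl] with r hr1 hr2 hr3
  rw [Int.floor_eq_iff, le_div_iff₀ hr3, div_lt_iff₀ hr3]
  exact ⟨hr1.le, hr2⟩

theorem paramH_succ (N : ℕ) (r : ℝ) : paramH (N + 1) r = paramH N r - sideL r := by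
  rw [paramH, paramH]
  push_cast
  ring

/-- Near `r₀` the index is that of `r₀`, or possibly the next one if `r₀` belongs to a regular
polygon. -/
theorem eventually_index {r₀ : ℝ} {N₀ : ℕ} (hr₀ : r₀ < 1 / 2) (h₀ : IsIndex N₀ r₀) :
    ∀ᶠ r in 𝓝 r₀, ∀ N, IsIndex N r →
      N = N₀ ∨ (N = N₀ + 1 ∧ paramH N₀ r₀ = sideL r₀) := by
  have hlt : ∀ᶠ r in 𝓝 r₀, r < 1 / 2 := eventually_lt_nhds hr₀
  have hpos : ∀ᶠ r in 𝓝 r₀, 0 < paramH N₀ r :=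
    ((continuous_paramH N₀).tendsto r₀).eventually_const_lt h₀.2.1
  rcases h₀.2.2.lt_or_eq with hs | hs
  · have hle : ∀ᶠ r in 𝓝 r₀, paramH N₀ r < sideL r :=
      (continuous_paramH N₀).continuousAt.eventually_lt continuous_sideL.continuousAt hs
    filter_upwards [hlt, hpos, hle] with r h1 h2 h3 N hN
    exact Or.inl (eq_of_paramH_mem h1 hN.2.1 hN.2.2 h2 h3.le)
  · have hle : ∀ᶠ r in 𝓝 r₀, paramH (N₀ + 1) r < sideL r := by
      refine (continuous_paramH _).continuousAt.eventually_lt continuous_sideL.continuousAt ?_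
      rw [paramH_succ, hs, sub_self]
      exact sideL_pos hr₀
    filter_upwards [hlt, hpos, hle] with r h1 h2 h3 N hN
    rcases le_or_gt (paramH N₀ r) (sideL r) with h4 | h4
    · exact Or.inl (eq_of_paramH_mem h1 hN.2.1 hN.2.2 h2 h4)
    · refine Or.inr ⟨eq_of_paramH_mem h1 hN.2.1 hN.2.2 ?_ h3.le, hs⟩
      rw [paramH_succ]
      linarith

theorem IsIndex.isShape {N : ℕ} {r : ℝ} (h : IsIndex N r) (hr : r ∈ inradii) (hr2 : r < 1 / 2) :
    IsShape N (1 - r) (sideL r) (angleτ N r) :=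
  ConstWidth.isShape hr hr2 h.1 h.2.1 h.2.2

/-- Away from the breaks of the limit shape the profile at `s` is locally constant in `r`. If the
limit is regular, `N` may jump to `N₀ + 1`, but then `τ` for `N₀ + 1` is close to `π / 2`, and both
profiles at `s` are the parity of `⌊s / ℓ⌋`. -/
theorem eventually_shapeProfile_eq {r₀ : ℝ} {N₀ : ℕ} (hr₀ : r₀ ∈ inradii) (hr₀2 : r₀ < 1 / 2)
    (h₀ : IsIndex N₀ r₀) {s : ℝ} (hs : |s| < Real.pi / 2) (hsl : ∀ j : ℤ, s ≠ j * sideL r₀)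
    (hsτ : |s| ≠ angleτ N₀ r₀) :
    ∀ᶠ r in 𝓝 r₀, r ∈ inradii → ∀ N, IsIndex N r →
      shapeProfile N r s = shapeProfile N₀ r₀ s := by
  have hlt : ∀ᶠ r in 𝓝 r₀, r < 1 / 2 := eventually_lt_nhds hr₀2
  have hS₀ := h₀.isShape hr₀ hr₀2
  have hl := sideL_pos hr₀2
  obtain ⟨hs1, hs2⟩ := abs_lt.mp hs
  have hτ₀ := continuous_angleτ N₀
  have hsame : ∀ᶠ r in 𝓝 r₀, r ∈ inradii → IsIndex N₀ r →
      shapeProfile N₀ r s = shapeProfile N₀ r₀ s := by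
    rcases hsτ.lt_or_gt with h1 | h1
    · filter_upwards [hlt, eventually_floor_eq hr₀2 hsl,
        (hτ₀.tendsto r₀).eventually_const_lt h1] with r hr2 hfl hτ hr hN
      rw [shapeProfile, shapeProfile, (hN.isShape hr hr2).stepProfile_floor hτ,
        hS₀.stepProfile_floor h1, hfl]
    · filter_upwards [hlt, (hτ₀.tendsto r₀).eventually_lt_const h1] with r hr2 hτ hr hN
      rcases lt_abs.mp h1 with h2 | h2
      · rw [abs_of_pos (hS₀.τ_pos.trans h2)] at hτ
        rw [shapeProfile, shapeProfile, (hN.isShape hr hr2).stepProfile_right hτ hs2,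
          hS₀.stepProfile_right h2 hs2]
      · rw [abs_of_neg (by linarith [hS₀.τ_pos])] at hτ
        rw [shapeProfile, shapeProfile, (hN.isShape hr hr2).stepProfile_left hs1 (by linarith),
          hS₀.stepProfile_left hs1 (by linarith)]
  have hnext : ∀ᶠ r in 𝓝 r₀, r ∈ inradii → paramH N₀ r₀ = sideL r₀ → IsIndex (N₀ + 1) r →
      shapeProfile (N₀ + 1) r s = shapeProfile N₀ r₀ s := by
    by_cases hreg : paramH N₀ r₀ = sideL r₀
    swap
    · exact Eventually.of_forall fun r _ h => absurd h hreg
    have hτ1 : angleτ (N₀ + 1) r₀ = Real.pi / 2 := by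
      rw [angleτ, sideA, paramH_succ, hreg, sub_self, Real.sin_zero, mul_zero, Real.arcsin_zero]
      ring
    have hτ0 : angleτ N₀ r₀ = N₀ * sideL r₀ := by
      rw [angleτ, sideA_eq hr₀ hreg]
      rw [paramH] at hreg
      linarith
    have hpi : Real.pi / 2 = (N₀ + 1 / 2) * sideL r₀ := by
      rw [paramH] at hreg
      linarith
    -- In the regular case `τ = N₀ ℓ` and `π / 2 = (N₀ + 1/2) ℓ`, so the floor formula persists
    -- beyond `±τ` up to `±π / 2`.
    have hval : shapeProfile N₀ r₀ s = evenInd ⌊s / sideL r₀⌋ := by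
      rcases hsτ.lt_or_gt with h1 | h1
      · rw [shapeProfile, hS₀.stepProfile_floor h1]
      · rcases lt_abs.mp h1 with h2 | h2
        · rw [shapeProfile, hS₀.stepProfile_right h2 hs2]
          congr 1
          rw [eq_comm, Int.floor_eq_iff, le_div_iff₀ hl, div_lt_iff₀ hl]
          push_cast
          constructor <;> linarith
        · rw [shapeProfile, hS₀.stepProfile_left hs1 (by linarith)]
          congr 1
          rw [eq_comm, Int.floor_eq_iff, le_div_iff₀ hl, div_lt_iff₀ hl]
          push_cast
          constructor <;> linarith
    filter_upwards [hlt, eventually_floor_eq hr₀2 hsl,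
      ((continuous_angleτ (N₀ + 1)).tendsto r₀).eventually_const_lt (hτ1 ▸ hs)]
      with r hr2 hfl hτ hr _ hN
    rw [hval, shapeProfile, (hN.isShape hr hr2).stepProfile_floor hτ, hfl]
  filter_upwards [eventually_index hr₀2 h₀, hsame, hnext] with r h1 h2 h3 hr N hN
  rcases h1 N hN with rfl | ⟨rfl, hreg⟩
  · exact h2 hr hN
  · exact h3 hr hreg hN

theorem tendsto_integral_shapeProfile {r₀ : ℝ} {N₀ : ℕ} (hr₀ : r₀ ∈ inradii) (hr₀2 : r₀ < 1 / 2)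
    (h₀ : IsIndex N₀ r₀) {n : ℝ → ℕ} (hn : ∀ r ∈ inradii, r < 1 / 2 → IsIndex (n r) r) :
    Tendsto (fun r => ∫ s in (-(Real.pi / 2))..(Real.pi / 2),
      |shapeProfile (n r) r s - shapeProfile N₀ r₀ s|) (𝓝[inradii] r₀) (𝓝 0) := by
  have hpi := Real.pi_pos
  have h0 : (0 : ℝ) = ∫ s in (-(Real.pi / 2))..(Real.pi / 2), (0 : ℝ) := by simp
  rw [h0]
  refine intervalIntegral.tendsto_integral_filter_of_dominated_convergence (fun _ => 1) ?_ ?_ ?_ ?_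
  · exact Eventually.of_forall fun r => (continuous_abs.measurable.comp
      ((measurable_stepProfile _).sub (measurable_stepProfile _))).aestronglyMeasurable
  · refine Eventually.of_forall fun r => Eventually.of_forall fun s _ => ?_
    rcases stepProfile_mem (brk (n r) (sideL r) (angleτ (n r) r)) s with h1 | h1 <;>
      rcases stepProfile_mem (brk N₀ (sideL r₀) (angleτ N₀ r₀)) s with h2 | h2 <;>
      simp [shapeProfile, h1, h2]
  · exact intervalIntegrable_const
  -- Dominated convergence tolerates the countably many exceptional angles; `π / 2` is among them
  -- because the interval of integration contains its right end.
  · have hcount : (Set.range (fun j : ℤ => j * sideL r₀) ∪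
        {angleτ N₀ r₀, -angleτ N₀ r₀, Real.pi / 2}).Countable :=
      (Set.countable_range _).union (by simp)
    filter_upwards [hcount.ae_notMem volume] with s hs hsI
    rw [Set.uIoc_of_le (by linarith)] at hsI
    simp only [Set.mem_union, Set.mem_range, Set.mem_insert_iff, Set.mem_singleton_iff,
      not_or, not_exists] at hs
    obtain ⟨hs1, hs2, hs3, hs4⟩ := hs
    have hev := eventually_shapeProfile_eq hr₀ hr₀2 h₀ (s := s)
      (abs_lt.mpr ⟨hsI.1, lt_of_le_of_ne hsI.2 hs4⟩) (fun j h => hs1 j h.symm) (by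
        intro h
        rcases abs_choice s with h' | h'
        · exact hs2 (by rw [← h, h'])
        · exact hs3 (by rw [← h, h', neg_neg]))
    refine tendsto_const_nhds.congr' ?_
    filter_upwards [nhdsWithin_le_nhds hev, nhdsWithin_le_nhds (eventually_lt_nhds hr₀2),
      self_mem_nhdsWithin] with r h1 h2 h3
    rw [h1 h3 _ (hn r h3 h2), sub_self, abs_zero]

/-- The extremal shape in standard position, the disk included. -/
noncomputable def modelBody (n : ℝ → ℕ) (r : ℝ) : Set ℂ :=
  open Classical in
  if r ∈ inradii ∧ r < 1 / 2 then shapeBody (n r) r else closedBall 0 (1 / 2)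

theorem modelBody_of_lt {n : ℝ → ℕ} {r : ℝ} (hr : r ∈ inradii) (hr2 : r < 1 / 2) :
    modelBody n r = shapeBody (n r) r := if_pos ⟨hr, hr2⟩

theorem modelBody_half (n : ℝ → ℕ) : modelBody n (1 / 2) = closedBall 0 (1 / 2) :=
  if_neg fun h => lt_irrefl _ h.2

section

variable {n : ℝ → ℕ}

theorem isCompact_modelBody (hn : ∀ r ∈ inradii, r < 1 / 2 → IsIndex (n r) r) (r : ℝ) :
    IsCompact (modelBody n r) := by
  unfold modelBody
  split_ifs with h
  · exact ((hn r h.1 h.2).isShape h.1 h.2).isConvexBody.1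
  · exact isCompact_closedBall _ _

theorem nonempty_modelBody (hn : ∀ r ∈ inradii, r < 1 / 2 → IsIndex (n r) r) (r : ℝ) :
    (modelBody n r).Nonempty := by
  unfold modelBody
  split_ifs with h
  · exact ((hn r h.1 h.2).isShape h.1 h.2).isConvexBody.2.2.mono interior_subset
  · exact ⟨0, by simp⟩

/-- The base point `1 - (1 - r) cis (ℓ / 2)` does not involve `N`, so it is continuous in `r` even
where `N` jumps; the profiles converge in `L¹`. -/
theorem tendsto_hausdorffDist_modelBody_of_lt (hn : ∀ r ∈ inradii, r < 1 / 2 → IsIndex (n r) r)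
    {r₀ : ℝ} (hr₀ : r₀ ∈ inradii) (hr₀2 : r₀ < 1 / 2) :
    Tendsto (fun r => hausdorffDist (modelBody n r) (modelBody n r₀)) (𝓝[inradii] r₀) (𝓝 0) := by
  have h₀ := hn r₀ hr₀ hr₀2
  have hS₀ := h₀.isShape hr₀ hr₀2
  have hI := tendsto_integral_shapeProfile hr₀ hr₀2 h₀ hn
  have hc : Tendsto (fun r => ‖(1 - (1 - r) • cis (sideL r / 2)) -
      (1 - (1 - r₀) • cis (sideL r₀ / 2))‖) (𝓝[inradii] r₀) (𝓝 0) := by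
    have hcont : Continuous fun r => ‖(1 - (1 - r) • cis (sideL r / 2)) -
        (1 - (1 - r₀) • cis (sideL r₀ / 2))‖ := by
      have h1 := continuous_sideL
      have h2 := continuous_cis
      fun_prop
    have := hcont.tendsto r₀
    rw [sub_self, norm_zero] at this
    exact this.mono_left nhdsWithin_le_nhds
  have hsum := hc.add hI
  rw [add_zero] at hsum
  refine squeeze_zero' (Eventually.of_forall fun r => hausdorffDist_nonneg) ?_ hsum
  filter_upwards [nhdsWithin_le_nhds (eventually_lt_nhds hr₀2), self_mem_nhdsWithin] with r hr2 hr
  have hS := (hn r hr hr2).isShape hr hr2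
  have hp := hS.isBreaks.isProfile
  have hp₀ := hS₀.isBreaks.isProfile
  have hbound := hp.norm_curve_sub_curve_le hp₀
  rw [hS.vtx_zero, hS₀.vtx_zero, neg_add_eq_sub, neg_add_eq_sub] at hbound
  rw [hS.vtx_zero, neg_add_eq_sub] at hp
  rw [hS₀.vtx_zero, neg_add_eq_sub] at hp₀
  rw [modelBody_of_lt hr hr2, modelBody_of_lt hr₀ hr₀2, shapeBody, shapeBody, IsBreaks.body,
    IsBreaks.body, hS.vtx_zero, hS₀.vtx_zero, neg_add_eq_sub, neg_add_eq_sub]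
  refine hausdorffDist_le_of_subset_cthickening hp.isCompact_curveBody hp₀.isCompact_curveBody
    ((norm_nonneg _).trans (hbound 0)) (IsProfile.curveBody_subset_cthickening hbound)
    (IsProfile.curveBody_subset_cthickening fun θ => ?_)
  rw [norm_sub_rev]
  exact hbound θ

/-- The shape lies between the disks of radii `r` and `1 - r` about 0, both within `1/2 - r` of the
limit disk. -/
theorem tendsto_hausdorffDist_modelBody_half (hn : ∀ r ∈ inradii, r < 1 / 2 → IsIndex (n r) r) :
    Tendsto (fun r => hausdorffDist (modelBody n r) (modelBody n (1 / 2)))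
      (𝓝[inradii] (1 / 2)) (𝓝 0) := by
  have hlim : Tendsto (fun r : ℝ => 1 / 2 - r) (𝓝[inradii] (1 / 2)) (𝓝 0) := by
    have : Continuous fun r : ℝ => 1 / 2 - r := by fun_prop
    have h := this.tendsto (1 / 2)
    rw [sub_self] at h
    exact h.mono_left nhdsWithin_le_nhds
  refine squeeze_zero' (Eventually.of_forall fun r => hausdorffDist_nonneg) ?_ hlim
  filter_upwards [self_mem_nhdsWithin] with r hr
  rcases hr.2.lt_or_eq with hr2 | hr2
  · have hS := (hn r hr hr2).isShape hr hr2
    have h0 := inradii_pos hr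
    rw [modelBody_half, modelBody_of_lt hr hr2]
    refine hausdorffDist_le_of_subset_cthickening hS.isConvexBody.1 (isCompact_closedBall _ _)
      (by linarith) ?_ ?_
    · rw [cthickening_closedBall (by linarith) (by norm_num)]
      refine hS.body_subset.trans (closedBall_subset_closedBall (by linarith))
    · have h1 := hS.closedBall_subset_body
      rw [sub_sub_cancel] at h1
      refine Set.Subset.trans ?_ (cthickening_subset_of_subset _ h1)
      rw [cthickening_closedBall (by linarith) h0.le]
      exact closedBall_subset_closedBall (by linarith)
  · rw [hr2, hausdorffDist_self_zero, sub_self]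

theorem exists_modulus_modelBody (hn : ∀ r ∈ inradii, r < 1 / 2 → IsIndex (n r) r) {ε : ℝ}
    (hε : 0 < ε) : ∃ δ > 0, ∀ r₁ ∈ inradii, ∀ r₂ ∈ inradii, |r₁ - r₂| < δ →
      hausdorffDist (modelBody n r₁) (modelBody n r₂) < ε := by
  let F : ℝ → TopologicalSpace.NonemptyCompacts ℂ := fun r =>
    ⟨⟨modelBody n r, isCompact_modelBody hn r⟩, nonempty_modelBody hn r⟩
  have hF : ContinuousOn F inradii := by
    intro r hr
    rw [ContinuousWithinAt, tendsto_iff_dist_tendsto_zero]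
    rcases hr.2.lt_or_eq with hr2 | hr2
    · exact tendsto_hausdorffDist_modelBody_of_lt hn hr hr2
    · subst hr2
      exact tendsto_hausdorffDist_modelBody_half hn
  have hu := isCompact_Icc.uniformContinuousOn_of_continuous hF
  obtain ⟨δ, hδ, h⟩ := Metric.uniformContinuousOn_iff.mp hu ε hε
  exact ⟨δ, hδ, fun r₁ h₁ r₂ h₂ h12 => h r₁ h₁ r₂ h₂ h12⟩

theorem IsOmega.exists_motion_modelBody (hn : ∀ r ∈ inradii, r < 1 / 2 → IsIndex (n r) r)
    {r : ℝ} {Ω : Set ℂ} (hr : r ∈ inradii) (h : IsOmega r Ω) :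
    ∃ T : ℂ ≃ᵢ ℂ, T '' Ω = modelBody n r := by
  rcases hr.2.lt_or_eq with hr2 | hr2
  · have hi := hn r hr hr2
    rw [modelBody_of_lt hr hr2]
    exact h.exists_motion hr hr2 hi.2.1 hi.2.2
  · rcases h with ⟨M, hM, hrM, -⟩ | ⟨M, hM, -, hrM, -⟩ | ⟨-, O, rfl⟩
    · exact absurd (hrM ▸ regularInradius_lt_half (by omega)) (not_lt.mpr hr2.ge)
    · linarith [regularInradius_lt_half (m := 2 * M + 1) (by omega)]
    · refine ⟨IsometryEquiv.subRight O, ?_⟩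
      rw [hr2, modelBody_half, IsometryEquiv.image_closedBall]
      simp

end

theorem exists_motion_uniformContinuous (Ω : ℝ → Set ℂ) (hΩ : ∀ r ∈ inradii, IsOmega r (Ω r)) :
    ∃ T : ℝ → (ℂ ≃ᵢ ℂ), ∀ ε > 0, ∃ δ > 0, ∀ r₁ ∈ inradii, ∀ r₂ ∈ inradii, |r₁ - r₂| < δ →
      hausdorffDist (T r₁ '' Ω r₁) (T r₂ '' Ω r₂) < ε := by
  have hex : ∀ r, ∃ N, r ∈ inradii → r < 1 / 2 → IsIndex N r := fun r => by
    by_cases h : r ∈ inradii ∧ r < 1 / 2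
    · obtain ⟨N, hN⟩ := exists_paramH_mem h.1 h.2
      exact ⟨N, fun _ _ => hN⟩
    · exact ⟨0, fun h1 h2 => absurd ⟨h1, h2⟩ h⟩
  choose n hn using hex
  have hT : ∀ r, ∃ T : ℂ ≃ᵢ ℂ, r ∈ inradii → T '' Ω r = modelBody n r := fun r => by
    by_cases h : r ∈ inradii
    · obtain ⟨T, hT⟩ := (hΩ r h).exists_motion_modelBody hn h
      exact ⟨T, fun _ => hT⟩
    · exact ⟨IsometryEquiv.refl ℂ, fun h' => absurd h' h⟩
  choose T hT using hT
  refine ⟨T, fun ε hε => ?_⟩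
  obtain ⟨δ, hδ, h⟩ := exists_modulus_modelBody hn hε
  refine ⟨δ, hδ, fun r₁ h₁ r₂ h₂ h12 => ?_⟩
  rw [hT r₁ h₁, hT r₂ h₂]
  exact h r₁ h₁ r₂ h₂ h12

end ConstWidth

theorem proposition1p3 :
    -- the minimum `𝒜(r)` exists and depends continuously on `r`
    (∀ r ∈ ConstWidth.inradii,
      IsLeast ((fun Ω : Set ℂ => MeasureTheory.volume.real Ω) '' ConstWidth.admissible r)
        (ConstWidth.minArea r)) ∧
    ContinuousOn ConstWidth.minArea ConstWidth.inradii ∧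
    -- the shape `Ω(r)` exists, and any choice of it is continuous up to rigid motion
    (∀ r ∈ ConstWidth.inradii, ∃ Ω : Set ℂ, ConstWidth.IsOmega r Ω) ∧
    ∀ Ω : ℝ → Set ℂ, (∀ r ∈ ConstWidth.inradii, ConstWidth.IsOmega r (Ω r)) →
      ∃ T : ℝ → (ℂ ≃ᵢ ℂ), ∀ ε > 0, ∃ δ > 0,
        ∀ r₁ ∈ ConstWidth.inradii, ∀ r₂ ∈ ConstWidth.inradii, |r₁ - r₂| < δ →
          Metric.hausdorffDist (T r₁ '' Ω r₁) (T r₂ '' Ω r₂) < ε := by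
  exact ⟨fun r hr => ConstWidth.isLeast_minArea hr.1 (ConstWidth.admissible_nonempty hr),
    ConstWidth.continuousOn_minArea fun r hr => ConstWidth.admissible_nonempty hr,
    fun r hr => ConstWidth.exists_isOmega hr, ConstWidth.exists_motion_uniformContinuous⟩
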